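/- Let $d\in\mathbb N$, $1<p<\infty$, $T>0$, and let $b\in L^1((0,T);W^{1,p}(\mathbb R^d;\mathbb R^d))\cap L^\infty((0,T)\times\mathbb R^d;\mathbb R^d)$ be divergence-free. Let $X$ be a regular Lagrangian flow of $b$, that is, a measurable map $X:(0,T)\times\mathbb R^d\to\mathbb R^d$ such that (i) for every $\phi\in C_c^\infty([0,T)\times\mathbb R^d)$ the functions $X\,\partial_t\phi$ and $b(t,X)\,\phi$ are integrable on $(0,T)\times\mathbb R^d$ and $$\int_0^T\!\!\int_{\mathbb R^d}\big[X(t,x)\,\partial_t\phi(t,x)+b(t,X(t,x))\,\phi(t,x)\big]\,dx\,dt+\int_{\mathbb R^d}x\,\phi(0,x)\,dx=0;$$ (ii) there is a constant $L>0$ such that for a.e. $t\in(0,T)$ one has $\mathcal L^d(X(t,\cdot)^{-1}(A))\le L\,\mathcal L^d(A)$ for all open $A\subset\mathbb R^d$. Let $(b_\varepsilon)_{\varepsilon>0}$ be an approximating sequence for $b$, that is, measurable fields $b_\varepsilon:(0,T)\times\mathbb R^d\to\mathbb R^d$, with $b_\varepsilon(t,\cdot)$ continuous for a.e. $t$, such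 that for some $\bar C_0,\bar C_1,\bar C_2,\bar C_3,\alpha,\beta>0$ and all $\varepsilon>0$ $$\|b_\varepsilon-b\|_{L^1_tL^1_x}\le\bar C_0\varepsilon^\alpha,\qquad \|\nabla b_\varepsilon\|_{L^\infty_tL^\infty_x}\le\frac{\bar C_1}{\varepsilon^\beta},\qquad \|\operatorname{div}b_\varepsilon\|_{L^\infty_tL^\infty_x}\le\bar C_2,\qquad \|b_\varepsilon\|_{L^\infty_tL^\infty_x}\le\bar C_3 ,$$ where gradient and divergence are taken in $x$ in the sense of distributions. Let $\theta\in[0,1]$, let $N\ge1$ be an integer, and set $h=T/N$, $t_i=ih$, $\varepsilon=h^{1/(2\beta)}$. Let $X_i^{\theta,\varepsilon}:\mathbb R^d\to\mathbb R^d$, $0\le i\le N$, be any maps with $X_0^{\theta,\varepsilon}(x)=x$ that solve the regularized $\theta$-method $$\frac{X_{i+1}^{\theta,\varepsilon}-X_i^{\theta,\varepsilon}}h=(1-\theta)\,\frac1h\int_{t_i}^{t_{i+1}}b_\varepsilon(s,X_i^{\theta,\varepsilon})\,ds+\theta\,\frac1h\int_{t_i}^{t_{i+1}}b_\varepsilon(s,X_{i+1}^{\theta,\varepsilon})\,ds\qquad(0\le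 i<N)$$ for every $x\in\mathbb R^d$, and let $$\tilde X^{h,\theta,\varepsilon}(t,x)=\sum_{i=0}^{N-1}\Big(X_i^{\theta,\varepsilon}(x)+\frac{t-t_i}h\big(X_{i+1}^{\theta,\varepsilon}(x)-X_i^{\theta,\varepsilon}(x)\big)\Big)\chi_{[t_i,t_{i+1})}(t).$$ Then for every $r>0$ there is a constant $C>0$, depending only on $d,p,r,T,\bar C_1,\bar C_2$ and on upper bounds for $\|b\|_{L^\infty}$ and $\|\nabla b\|_{L^1_tL^p_x}$, such that, for all sufficiently small $h$, $$\int_{B_r}\big|\tilde X^{h,\theta,\varepsilon}(t,x)-X(t,x)\big|\,dx\le\frac{C}{|\log h|}\qquad\text{for a.e. }t\in(0,T).$$ Here "sufficiently small" means $h\le h_0$ for some $h_0\in(0,1)$ depending only on the quantities just listed and on $\bar C_0,\bar C_3,\alpha,\beta$. Moreover, the same estimate holds for all $h<1$ with $C$ replaced by a constant $C'$ that may depend also on $\bar C_0,\bar C_3,\alpha,\beta$. If $X$ is given by its representative for which $t\mapsto X(t,x)$ is continuous on $[0,T)$ for a.e. $x$, then both estimates hold for every $t\in[0,T)$. -/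

import Mathlib

open MeasureTheory Set
open scoped ContDiff

noncomputable section

/-- The Euclidean space `ℝ^d`. -/
abbrev Eu (d : ℕ) : Type := EuclideanSpace ℝ (Fin d)

/-- Lebesgue measure on the space-time slab `(0,T) × ℝ^d`. -/
def slab (d : ℕ) (T : ℝ) : Measure (ℝ × Eu d) :=
  (volume.restrict (Ioo (0 : ℝ) T)).prod volume

/-- `G` is the gradient of the vector field `f` on `ℝ^d` in the sense of distributions:
`∫ (∂_v φ) f = - ∫ φ (G v)` for all test functions `φ` and all directions `v`. -/
structure HasWeakGradient {d : ℕ} (f : Eu d → Eu d) (G : Eu d → Eu d →L[ℝ] Eu d) : Prop where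
  locallyIntegrable : LocallyIntegrable f volume
  locallyIntegrable_grad : LocallyIntegrable G volume
  integral_eq : ∀ φ : Eu d → ℝ, ContDiff ℝ ∞ φ → HasCompactSupport φ → ∀ v : Eu d,
    ∫ x, (fderiv ℝ φ x v) • f x = - ∫ x, φ x • G x v

/-- The trace of a `d × d` matrix, as a linear map; the divergence is the trace of the gradient. -/
def tr {d : ℕ} (A : Eu d →L[ℝ] Eu d) : ℝ :=
  LinearMap.trace ℝ (Eu d) (A : Eu d →ₗ[ℝ] Eu d)

/-- `b ∈ L¹((0,T); W^{1,p}(ℝ^d; ℝ^d))`, with spatial distributional gradient `D`. -/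
structure IsL1W1p {d : ℕ} (T p : ℝ) (b : ℝ → Eu d → Eu d)
    (D : ℝ → Eu d → Eu d →L[ℝ] Eu d) : Prop where
  aestronglyMeasurable : AEStronglyMeasurable (Function.uncurry b) (slab d T)
  aestronglyMeasurable_grad : AEStronglyMeasurable (Function.uncurry D) (slab d T)
  hasWeakGradient : ∀ᵐ t ∂(volume.restrict (Ioo (0 : ℝ) T)), HasWeakGradient (b t) (D t)
  memLp : ∀ᵐ t ∂(volume.restrict (Ioo (0 : ℝ) T)),
    MemLp (b t) (ENNReal.ofReal p) volume ∧ MemLp (D t) (ENNReal.ofReal p) volume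
  norm_lt_top : ∫⁻ t in Ioo (0 : ℝ) T, eLpNorm (b t) (ENNReal.ofReal p) volume < ⊤
  norm_grad_lt_top : ∫⁻ t in Ioo (0 : ℝ) T, eLpNorm (D t) (ENNReal.ofReal p) volume < ⊤

/-- `X` is a regular Lagrangian flow of `b` on `(0,T)`.
Test functions in `C_c^∞([0,T) × ℝ^d)` are the restrictions to `[0,T) × ℝ^d` of smooth compactly
supported functions on `ℝ × ℝ^d` whose support lies in `(-∞,T) × ℝ^d`. -/
structure IsRegularLagrangianFlow {d : ℕ} (T : ℝ) (b X : ℝ → Eu d → Eu d) : Prop where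
  aestronglyMeasurable : AEStronglyMeasurable (Function.uncurry X) (slab d T)
  weak_formulation : ∀ φ : ℝ → Eu d → ℝ, ContDiff ℝ ∞ (Function.uncurry φ) →
    HasCompactSupport (Function.uncurry φ) →
    tsupport (Function.uncurry φ) ⊆ Iio T ×ˢ univ →
    Integrable (fun z : ℝ × Eu d => deriv (fun s => φ s z.2) z.1 • X z.1 z.2) (slab d T) ∧
    Integrable (fun z : ℝ × Eu d => φ z.1 z.2 • b z.1 (X z.1 z.2)) (slab d T) ∧
    (∫ z, (deriv (fun s => φ s z.2) z.1 • X z.1 z.2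
        + φ z.1 z.2 • b z.1 (X z.1 z.2)) ∂(slab d T)) + ∫ x, φ 0 x • x = 0
  compressibility : ∃ L : ℝ, 0 < L ∧ ∀ᵐ t ∂(volume.restrict (Ioo (0 : ℝ) T)),
    ∀ A : Set (Eu d), IsOpen A → volume (X t ⁻¹' A) ≤ ENNReal.ofReal L * volume A

/-- The family `(b_ε)_{ε > 0}` (written `bε ε t x`) is an approximating sequence for `b` with
constants `C₀, C₁, C₂, C₃` and exponents `α, β`. The fields `b_ε(t,·)`, having a bounded gradient,
are given by their continuous representatives, which the numerical scheme evaluates pointwise. -/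
structure IsApproximatingSequence {d : ℕ} (T : ℝ) (b : ℝ → Eu d → Eu d)
    (bε : ℝ → ℝ → Eu d → Eu d) (C₀ C₁ C₂ C₃ α β : ℝ) : Prop where
  aestronglyMeasurable : ∀ ε : ℝ, 0 < ε →
    AEStronglyMeasurable (Function.uncurry (bε ε)) (slab d T)
  continuous : ∀ ε : ℝ, 0 < ε →
    ∀ᵐ t ∂(volume.restrict (Ioo (0 : ℝ) T)), Continuous (bε ε t)
  error_le : ∀ ε : ℝ, 0 < ε →
    ∫⁻ t in Ioo (0 : ℝ) T, eLpNorm (fun x => bε ε t x - b t x) 1 volume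
      ≤ ENNReal.ofReal (C₀ * ε ^ α)
  grad_div_le : ∀ ε : ℝ, 0 < ε → ∀ᵐ t ∂(volume.restrict (Ioo (0 : ℝ) T)),
    ∃ G : Eu d → Eu d →L[ℝ] Eu d, HasWeakGradient (bε ε t) G ∧
      (∀ᵐ x, ‖G x‖ ≤ C₁ / ε ^ β) ∧ (∀ᵐ x, |tr (G x)| ≤ C₂)
  bound : ∀ ε : ℝ, 0 < ε →
    ∀ᵐ t ∂(volume.restrict (Ioo (0 : ℝ) T)), ∀ᵐ x, ‖bε ε t x‖ ≤ C₃

/-- `Y 0, …, Y N` are iterates of the regularized `θ`-method for the field `c`,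
with time step `h` and nodes `t_i = i h`. -/
def IsThetaIteration {d : ℕ} (h θ : ℝ) (N : ℕ) (c : ℝ → Eu d → Eu d)
    (Y : ℕ → Eu d → Eu d) : Prop :=
  (∀ x, Y 0 x = x) ∧
  ∀ i : ℕ, i < N → ∀ x,
    h⁻¹ • (Y (i + 1) x - Y i x) =
      (1 - θ) • (⨍ s in (i * h)..((i + 1) * h), c s (Y i x))
        + θ • (⨍ s in (i * h)..((i + 1) * h), c s (Y (i + 1) x))

/-- The piecewise linear interpolant in time of the iterates `Y 0, …, Y N`. -/
def interpolant {d : ℕ} (h : ℝ) (N : ℕ) (Y : ℕ → Eu d → Eu d) (t : ℝ) (x : Eu d) : Eu d :=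
  ∑ i ∈ Finset.range N, (Ico (i * h) ((i + 1) * h)).indicator
    (fun s => Y i x + ((s - i * h) / h) • (Y (i + 1) x - Y i x)) t

/-- `∫_{B_r} |Z(t,x) - X(t,x)| dx ≤ ρ` for a.e. `t ∈ (0,T)`; and for every `t ∈ [0,T)` as soon as
`X`, which is determined only up to null sets, is given by its time-continuous representative. -/
def L1ErrorLe {d : ℕ} (T r : ℝ) (Z X : ℝ → Eu d → Eu d) (ρ : ℝ) : Prop :=
  (∀ᵐ t ∂(volume.restrict (Ioo (0 : ℝ) T)),
    ∫⁻ x in Metric.ball (0 : Eu d) r, ‖Z t x - X t x‖ₑ ≤ ENNReal.ofReal ρ) ∧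
  ((∀ᵐ x : Eu d, ContinuousOn (fun t => X t x) (Ico 0 T)) → ∀ t ∈ Ico (0 : ℝ) T,
    ∫⁻ x in Metric.ball (0 : Eu d) r, ‖Z t x - X t x‖ₑ ≤ ENNReal.ofReal ρ)

end

open scoped Topology NNReal ENNReal

noncomputable section

/-! ### Differences of weakly differentiable functions along segments -/

/-! The proof is a discrete-time version of quantitative stability for Lagrangian trajectories of
Sobolev fields. A field with gradient in `L^p` satisfies `|b(x) - b(y)| ≤ |x - y| (g(x) + g(y))` off
a null set, with `g` a multiple of the maximal function of the gradient
(`HasWeakGradient.exists_null_enorm_sub_le`), and for `p > 1` the maximal inequality keeps `g` in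
`L^p`. Along maps that compress Lebesgue measure by a bounded factor, null sets remain invisible,
and the time integral of `g` along the paths has a controlled `L^p` norm in the starting point
(`HasMaximalBound.rpow_mul_volume_le`).

Let `a_i` be the distance between the `i`-th iterate and the trajectory at `t_i`. Then `a_{i+1} ≤
a_i + (a_i + η) γ_i + ε_i`, where `η = O(h)`, `γ_i` integrates `g` over the step and `ε_i` is the
regularisation error. Discrete Gronwall yields `a_j ≤ exp(∑ γ_i) (η + ∑ ε_i)`. Where the total rate
is at most `κ |log h|`, the exponential costs only `h^{-κ}`, which `h` and `h^{α/(2β)}` beat for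
small `κ`. Elsewhere the error is merely bounded, but by Chebyshev that set has measure `O(|log
h|^{-p})`. Since `p > 1`, the sum is `o(1/|log h|)`, so the constant `1` suffices for small `h` and
the data only enter the threshold.

Two compressibility bounds are needed. For the iterates (`exists_scheme_compressibility`), a step is
`(id - hθf) ∘ Y_{i+1} = (id + h(1-θ)f) ∘ Y_i`, with `f` of Lipschitz constant `K = C₁/ε^β = C₁/√h`
and bounded divergence; the Jacobians are `1 + O(h) + O((hK)²) = 1 + O(h)`, and `T/h` such factors
have a bounded product. This explains the choice `ε = h^{1/(2β)}`. For the flow, its own constant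
must not enter the result; but explicit Euler iterates converge to it and compressibility survives
`L¹` limits, so the flow inherits the constant of the scheme
(`IsVelocity.isCompressible_trajectory`).

The weak formulation is used only to show that the flow agrees a.e. with paths `x + ∫ v` of a
bounded measurable velocity (`IsRegularLagrangianFlow.exists_velocity`). -/

lemma integrable_smul_comp_sub_smul {d : ℕ} {F : Type*} [NormedAddCommGroup F] [NormedSpace ℝ F]
    {ρ : Eu d → ℝ} (hρ : Continuous ρ) (hρc : HasCompactSupport ρ)
    {f : Eu d → F} (hf : LocallyIntegrable f volume) (v : Eu d) :
    Integrable (fun z : ℝ × Eu d => ρ (z.2 - z.1 • v) • f z.2)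
      ((volume.restrict (Ioc (0 : ℝ) 1)).prod volume) := by
  -- The sweep of the support of `ρ` along the segment: the integrand vanishes outside it for every
  -- `τ`, so one integrable majorant in `x` serves all `τ`.
  set K : Set (Eu d) := (fun z : ℝ × Eu d => z.2 + z.1 • v) '' (Icc (0 : ℝ) 1 ×ˢ tsupport ρ) with hK
  have hKc : IsCompact K := (isCompact_Icc.prod hρc).image (by fun_prop)
  obtain ⟨C, hC⟩ := hρ.bounded_above_of_compact_support hρc
  have hi : Integrable (fun x => C * ‖K.indicator f x‖) volume :=
    (((integrable_indicator_iff hKc.measurableSet).2 (hf.integrableOn_isCompact hKc)).norm).const_mul C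
  refine Integrable.mono' (g := fun z : ℝ × Eu d => C * ‖K.indicator f z.2‖) (hi.comp_snd _) ?_ ?_
  · refine AEStronglyMeasurable.smul ?_ hf.aestronglyMeasurable.comp_snd
    exact (hρ.comp (by fun_prop : Continuous fun z : ℝ × Eu d => z.2 - z.1 • v)).aestronglyMeasurable
  · have : ∀ᵐ z : ℝ × Eu d ∂((volume.restrict (Ioc (0 : ℝ) 1)).prod volume), z.1 ∈ Ioc (0 : ℝ) 1 :=
      Measure.quasiMeasurePreserving_fst.ae (ae_restrict_mem measurableSet_Ioc)
    filter_upwards [this] with z hz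
    by_cases h : z.2 ∈ K
    · rw [indicator_of_mem h, norm_smul]
      exact mul_le_mul_of_nonneg_right (hC _) (norm_nonneg _)
    · have : ρ (z.2 - z.1 • v) = 0 := by
        by_contra h0
        exact h ⟨(z.1, z.2 - z.1 • v), ⟨⟨hz.1.le, hz.2⟩, subset_tsupport _ h0⟩, by simp⟩
      simp [this, indicator_of_notMem h]

lemma integrable_smul_comp_add_smul {d : ℕ} {F : Type*} [NormedAddCommGroup F] [NormedSpace ℝ F]
    {ρ : Eu d → ℝ} (hρ : Continuous ρ) (hρc : HasCompactSupport ρ)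
    {f : Eu d → F} (hf : LocallyIntegrable f volume) (v : Eu d) :
    Integrable (fun z : ℝ × Eu d => ρ z.2 • f (z.2 + z.1 • v))
      ((volume.restrict (Ioc (0 : ℝ) 1)).prod volume) := by
  have hmp : MeasurePreserving (fun z : ℝ × Eu d => (z.1, z.2 + z.1 • v))
      ((volume.restrict (Ioc (0 : ℝ) 1)).prod volume)
      ((volume.restrict (Ioc (0 : ℝ) 1)).prod volume) :=
    (MeasurePreserving.id _).skew_product (g := fun τ x => x + τ • v) (by fun_prop)
      (ae_of_all _ fun τ => (measurePreserving_add_right volume (τ • v)).map_eq)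
  have := hmp.integrable_comp_of_integrable (integrable_smul_comp_sub_smul hρ hρc hf v)
  simpa [Function.comp_def] using this

lemma locallyIntegrable_integral_segment {d : ℕ} {F : Type*} [NormedAddCommGroup F]
    [NormedSpace ℝ F] {f : Eu d → F} (hf : LocallyIntegrable f volume) (v : Eu d) :
    LocallyIntegrable (fun x => ∫ τ in Ioc (0 : ℝ) 1, f (x + τ • v)) volume := by
  intro x₀
  let β : ContDiffBump x₀ := ⟨1, 2, one_pos, one_lt_two⟩
  refine ⟨Metric.closedBall x₀ 1, Metric.closedBall_mem_nhds _ one_pos, ?_⟩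
  have h := (integrable_smul_comp_add_smul (β.contDiff (n := 0)).continuous β.hasCompactSupport
    hf v).integral_prod_right
  refine (h.integrableOn (s := Metric.closedBall x₀ 1)).congr_fun ?_
    Metric.isClosed_closedBall.measurableSet
  intro x hx
  simp [β.one_of_mem_closedBall hx]

/-- Tested against `g`, the translation passes to `g`, where the classical fundamental theorem of
calculus applies. The weak gradient then moves the derivative onto `f`, and translating back
produces the segment integral of `G`. -/
lemma HasWeakGradient.ae_sub_eq_integral {d : ℕ} {f : Eu d → Eu d}
    {G : Eu d → Eu d →L[ℝ] Eu d} (hw : HasWeakGradient f G) (v : Eu d) :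
    ∀ᵐ x, f (x + v) - f x = ∫ τ in Ioc (0 : ℝ) 1, G (x + τ • v) v := by
  have hGv : LocallyIntegrable (fun x => G x v) volume := fun x => by
    obtain ⟨s, hs, hi⟩ := hw.locallyIntegrable_grad x
    exact ⟨s, hs, (ContinuousLinearMap.apply ℝ (Eu d) v).integrable_comp hi⟩
  have hH := locallyIntegrable_integral_segment hGv v
  have hfv : LocallyIntegrable (fun x => f (x + v)) volume := by
    have := hw.locallyIntegrable
    rw [locallyIntegrable_iff] at this ⊢
    intro k hk
    have h1 := this _ (hk.image (continuous_add_const v))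
    have := ((measurePreserving_add_right volume v).integrableOn_image
      (Homeomorph.addRight v).measurableEmbedding (f := f) (s := k)).1 h1
    exact this
  suffices h : ∀ᵐ x, (f (x + v) - f x) - ∫ τ in Ioc (0 : ℝ) 1, G (x + τ • v) v = 0 by
    filter_upwards [h] with x hx using sub_eq_zero.1 hx
  refine ae_eq_zero_of_integral_contDiff_smul_eq_zero ((hfv.sub hw.locallyIntegrable).sub hH) ?_
  intro g hg hgc
  have hgC : Continuous g := hg.continuous
  have i1 : Integrable (fun x => g x • f (x + v)) volume :=
    hfv.integrable_smul_left_of_hasCompactSupport hgC hgc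
  have i2 : Integrable (fun x => g x • f x) volume :=
    hw.locallyIntegrable.integrable_smul_left_of_hasCompactSupport hgC hgc
  have i3 : Integrable (fun x => g x • ∫ τ in Ioc (0 : ℝ) 1, G (x + τ • v) v) volume :=
    hH.integrable_smul_left_of_hasCompactSupport hgC hgc
  have e1 : ∫ x, g x • f (x + v) = ∫ x, g (x - v) • f x := by
    rw [← integral_sub_right_eq_self (fun x => g x • f (x + v)) v]
    simp
  have i1' : Integrable (fun x => g (x - v) • f x) volume := by
    simpa using i1.comp_sub_right v
  have hDc : HasCompactSupport fun x => fderiv ℝ g x v := by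
    refine (hgc.fderiv (𝕜 := ℝ)).comp_left (g := fun A : Eu d →L[ℝ] ℝ => A v) (by simp)
  have hDC : Continuous fun x => fderiv ℝ g x v :=
    (hg.continuous_fderiv (by simp)).clm_apply continuous_const
  have e2 : ∀ x, g (x - v) - g x = - ∫ τ in Ioc (0 : ℝ) 1, fderiv ℝ g (x - τ • v) v := by
    intro x
    have hd : ∀ τ : ℝ, HasDerivAt (fun τ : ℝ => g (x - τ • v)) (-(fderiv ℝ g (x - τ • v) v)) τ := by
      intro τ
      have h1 : HasDerivAt (fun τ : ℝ => x - τ • v) (-v) τ := by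
        simpa using ((hasDerivAt_id τ).smul_const v).const_sub x
      have := ((hg.differentiable (by simp) (x - τ • v)).hasFDerivAt).comp_hasDerivAt τ h1
      rw [map_neg] at this
      exact this
    have := intervalIntegral.integral_eq_sub_of_hasDerivAt (a := 0) (b := 1) (fun τ _ => hd τ)
      (by
        apply Continuous.intervalIntegrable
        exact (hDC.comp (by fun_prop : Continuous fun τ : ℝ => x - τ • v)).neg)
    rw [intervalIntegral.integral_of_le zero_le_one, integral_neg] at this
    simpa using this.symm
  have e3 : ∫ x, (g (x - v) - g x) • f x = ∫ x, g x • ∫ τ in Ioc (0 : ℝ) 1, G (x + τ • v) v := by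
    calc ∫ x, (g (x - v) - g x) • f x
        = - ∫ x, ∫ τ in Ioc (0 : ℝ) 1, (fderiv ℝ g (x - τ • v) v) • f x := by
          rw [← integral_neg]
          congr 1; ext1 x
          rw [e2, neg_smul, integral_smul_const]
      _ = - ∫ τ in Ioc (0 : ℝ) 1, ∫ x, (fderiv ℝ g (x - τ • v) v) • f x := by
          rw [integral_integral_swap]
          exact (integrable_smul_comp_sub_smul hDC hDc hw.locallyIntegrable v).swap
      _ = ∫ τ in Ioc (0 : ℝ) 1, ∫ x, g (x - τ • v) • G x v := by
          rw [← integral_neg]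
          congr 1; ext1 τ
          have := hw.integral_eq (fun x => g (x - τ • v)) (by fun_prop)
            (hgc.comp_homeomorph (Homeomorph.subRight (τ • v))) v
          rw [← neg_eq_iff_eq_neg] at this
          rw [← this]
          simp_rw [fderiv_comp_sub]
      _ = ∫ τ in Ioc (0 : ℝ) 1, ∫ x, g x • G (x + τ • v) v := by
          congr 1; ext1 τ
          rw [← integral_add_right_eq_self _ (τ • v)]
          simp
      _ = ∫ x, ∫ τ in Ioc (0 : ℝ) 1, g x • G (x + τ • v) v := by
          rw [integral_integral_swap]
          exact integrable_smul_comp_add_smul hgC hgc hGv v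
      _ = _ := by simp_rw [integral_smul]
  simp_rw [smul_sub] at *
  have i12 : Integrable (fun x => g x • f (x + v) - g x • f x) volume := i1.sub i2
  rw [integral_sub i12 i3, integral_sub i1 i2, e1, ← integral_sub i1' i2, ← e3]
  simp_rw [sub_smul]
  simp

lemma HasWeakGradient.lipschitzWith {d : ℕ} {f : Eu d → Eu d} {G : Eu d → Eu d →L[ℝ] Eu d}
    (hw : HasWeakGradient f G) (hf : Continuous f) {K : ℝ} (hK0 : 0 ≤ K)
    (hK : ∀ᵐ x, ‖G x‖ ≤ K) : LipschitzWith K.toNNReal f := by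
  have key : ∀ v x, ‖f (x + v) - f x‖ ≤ K * ‖v‖ := by
    intro v
    have hae : ∀ᵐ x, ‖f (x + v) - f x‖ ≤ K * ‖v‖ := by
      have h2 : ∀ᵐ x : Eu d, ∀ᵐ τ ∂(volume.restrict (Ioc (0 : ℝ) 1)), ‖G (x + τ • v)‖ ≤ K := by
        obtain ⟨N, hNs, hNm, hN0⟩ := exists_measurable_superset_of_null (ae_iff.1 hK)
        have hmeas : MeasurableSet {z : ℝ × Eu d | z.2 + z.1 • v ∈ N} :=
          (by fun_prop : Measurable fun z : ℝ × Eu d => z.2 + z.1 • v) hNm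
        have h3 : ∀ᵐ τ ∂(volume.restrict (Ioc (0 : ℝ) 1)), ∀ᵐ x : Eu d, x + τ • v ∉ N := by
          refine ae_of_all _ fun τ => ?_
          have hN : ∀ᵐ x : Eu d, x ∉ N := by rw [ae_iff]; simpa using hN0
          exact (measurePreserving_add_right volume (τ • v)).quasiMeasurePreserving.ae hN
        have := (Measure.ae_ae_comm (p := fun τ (x : Eu d) => x + τ • v ∉ N)
          (μ := volume.restrict (Ioc (0 : ℝ) 1)) (ν := volume) hmeas.compl).1 h3
        filter_upwards [this] with x hx
        filter_upwards [hx] with τ hτ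
        by_contra h; exact hτ (hNs h)
      filter_upwards [hw.ae_sub_eq_integral v, h2] with x hx hx2
      rw [hx]
      have := norm_setIntegral_le_of_norm_le_const_ae (μ := volume) (s := Ioc (0 : ℝ) 1)
        (f := fun τ => G (x + τ • v) v) (C := K * ‖v‖) (by simp) (by
          filter_upwards [hx2] with τ hτ
          exact (ContinuousLinearMap.le_opNorm _ _).trans
            (mul_le_mul_of_nonneg_right hτ (norm_nonneg _)))
      simpa using this
    -- The bound is a closed condition on `x` and holds on a set of full measure, which is dense; so
    -- it holds everywhere.
    have hcl : IsClosed {x | ‖f (x + v) - f x‖ ≤ K * ‖v‖} :=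
      isClosed_le (by fun_prop) continuous_const
    have hd : Dense {x | ‖f (x + v) - f x‖ ≤ K * ‖v‖} := Measure.dense_of_ae hae
    intro x
    have := hcl.closure_eq ▸ hd x
    exact this
  refine LipschitzWith.of_dist_le_mul fun x y => ?_
  have := key (x - y) y
  rw [dist_eq_norm, dist_eq_norm, Real.coe_toNNReal _ hK0]
  simpa using this

/-! ### The Hardy–Littlewood maximal function -/

/-- The maximal function over centred balls of dyadic radius. -/
def maximalFn {d : ℕ} (f : Eu d → ℝ≥0∞) (x : Eu d) : ℝ≥0∞ :=
  ⨆ k : ℤ, (volume (Metric.closedBall x ((2 : ℝ) ^ k)))⁻¹ *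
    ∫⁻ y in Metric.closedBall x ((2 : ℝ) ^ k), f y

lemma measurable_setLIntegral_closedBall {α : Type*} [MeasurableSpace α] {d : ℕ}
    {f : α → Eu d → ℝ≥0∞} (hf : Measurable (Function.uncurry f)) (r : ℝ) :
    Measurable fun z : α × Eu d => ∫⁻ y in Metric.closedBall z.2 r, f z.1 y := by
  have hset : MeasurableSet {w : (α × Eu d) × Eu d | dist w.2 w.1.2 ≤ r} :=
    measurableSet_le (by fun_prop) measurable_const
  have h : Measurable fun w : (α × Eu d) × Eu d =>
      ({w : (α × Eu d) × Eu d | dist w.2 w.1.2 ≤ r}).indicator (fun w => f w.1.1 w.2) w :=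
    (hf.comp (by fun_prop : Measurable fun w : (α × Eu d) × Eu d => (w.1.1, w.2))).indicator hset
  have h2 := h.lintegral_prod_right' (ν := (volume : Measure (Eu d)))
  have heq : (fun z : α × Eu d => ∫⁻ y in Metric.closedBall z.2 r, f z.1 y) = fun z =>
      ∫⁻ y, ({w : (α × Eu d) × Eu d | dist w.2 w.1.2 ≤ r}).indicator (fun w => f w.1.1 w.2) (z, y) := by
    ext1 z
    rw [← lintegral_indicator Metric.isClosed_closedBall.measurableSet]
    rfl
  rw [heq]
  exact h2

lemma measurable_maximalFn {α : Type*} [MeasurableSpace α] {d : ℕ}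
    {f : α → Eu d → ℝ≥0∞} (hf : Measurable (Function.uncurry f)) :
    Measurable fun z : α × Eu d => maximalFn (f z.1) z.2 := by
  refine Measurable.iSup fun k => ?_
  simp_rw [Measure.addHaar_closedBall_center]
  exact (measurable_setLIntegral_closedBall hf _).const_mul _

lemma exists_lt_of_lt_maximalFn {d : ℕ} {f : Eu d → ℝ≥0∞} {x : Eu d} {c : ℝ≥0∞}
    (h : c < maximalFn f x) : ∃ k : ℤ, c < (volume (Metric.closedBall x ((2 : ℝ) ^ k)))⁻¹ *
      ∫⁻ y in Metric.closedBall x ((2 : ℝ) ^ k), f y :=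
  lt_iSup_iff.1 h

/-- Weak type (1,1) by Vitali covering: balls enlarged five times cover the set while the balls
themselves are disjoint, whence `5 ^ d`. The covering theorem needs bounded radii, so the set is
exhausted by the `S n`, where some ball of radius at most `2 ^ n` is a witness. -/
lemma volume_lt_maximalFn_le {d : ℕ} (f : Eu d → ℝ≥0∞) {c : ℝ≥0∞} (hc : c ≠ 0) (hc' : c ≠ ⊤) :
    volume {x | c < maximalFn f x} ≤ ENNReal.ofReal (5 ^ d) * (c⁻¹ * ∫⁻ y, f y) := by
  set S : ℕ → Set (Eu d) := fun n => {x | ∃ k : ℤ, k ≤ n ∧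
    c * volume (Metric.closedBall x ((2 : ℝ) ^ k)) ≤ ∫⁻ y in Metric.closedBall x ((2 : ℝ) ^ k), f y}
    with hS
  have hsub : {x | c < maximalFn f x} ⊆ ⋃ n, S n := by
    intro x hx
    obtain ⟨k, hk⟩ := exists_lt_of_lt_maximalFn hx
    refine mem_iUnion.2 ⟨k.toNat, k, Int.self_le_toNat k, ?_⟩
    have hv : volume (Metric.closedBall x ((2 : ℝ) ^ k)) ≠ 0 :=
      (Metric.measure_closedBall_pos volume x (by positivity)).ne'
    have hv' : volume (Metric.closedBall x ((2 : ℝ) ^ k)) ≠ ⊤ := measure_closedBall_lt_top.ne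
    have := mul_le_mul_right hk.le (volume (Metric.closedBall x ((2 : ℝ) ^ k)))
    rw [← mul_assoc, ENNReal.mul_inv_cancel hv hv', one_mul] at this
    rwa [mul_comm]
  have hmono : Monotone S := fun m n hmn x ⟨k, hk, h⟩ => ⟨k, hk.trans (by exact_mod_cast hmn), h⟩
  refine (measure_mono hsub).trans ?_
  rw [hmono.measure_iUnion]
  refine iSup_le fun n => ?_
  choose! k hk hkf using (show ∀ x ∈ S n, ∃ k : ℤ, k ≤ n ∧ c * volume (Metric.closedBall x ((2 : ℝ) ^ k))
    ≤ ∫⁻ y in Metric.closedBall x ((2 : ℝ) ^ k), f y from fun x hx => hx)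
  obtain ⟨u, huS, hdisj, hcov⟩ := Vitali.exists_disjoint_subfamily_covering_enlargement_closedBall
    (S n) (fun x => x) (fun x => (2 : ℝ) ^ k x) ((2 : ℝ) ^ (n : ℤ))
    (fun x hx => zpow_le_zpow_right₀ one_le_two (hk x hx)) 5 (by norm_num)
  have huc : u.Countable := hdisj.countable_of_nonempty_interior fun x _ =>
    ⟨x, interior_mono Metric.ball_subset_closedBall (by
      rw [Metric.isOpen_ball.interior_eq]; exact Metric.mem_ball_self (by positivity))⟩
  have hSsub : S n ⊆ ⋃ x ∈ u, Metric.closedBall x (5 * (2 : ℝ) ^ k x) := by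
    intro x hx
    obtain ⟨b, hb, hxb⟩ := hcov x hx
    exact mem_biUnion hb (hxb (Metric.mem_closedBall_self (by positivity)))
  have : Countable u := huc.to_subtype
  calc volume (S n) ≤ volume (⋃ x ∈ u, Metric.closedBall x (5 * (2 : ℝ) ^ k x)) := measure_mono hSsub
    _ ≤ ∑' x : u, volume (Metric.closedBall (x : Eu d) (5 * (2 : ℝ) ^ k x)) :=
        measure_biUnion_le _ huc _
    _ ≤ ∑' x : u, ENNReal.ofReal (5 ^ d) * (c⁻¹ * ∫⁻ y in Metric.closedBall (x : Eu d) ((2 : ℝ) ^ k x), f y) := by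
        refine ENNReal.tsum_le_tsum fun x => ?_
        rw [Measure.addHaar_closedBall_mul _ _ (by norm_num) (by positivity), finrank_euclideanSpace_fin]
        refine mul_le_mul_right ?_ _
        have := mul_le_mul_right (hkf x (huS x.2)) c⁻¹
        rw [← mul_assoc, ENNReal.inv_mul_cancel hc hc', one_mul] at this
        rwa [Measure.addHaar_closedBall_center] at this
    _ = ENNReal.ofReal (5 ^ d) * (c⁻¹ * ∫⁻ y in ⋃ x ∈ u, Metric.closedBall x ((2 : ℝ) ^ k x), f y) := by
        rw [ENNReal.tsum_mul_left, ENNReal.tsum_mul_left,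
          lintegral_biUnion huc (fun x _ => Metric.isClosed_closedBall.measurableSet) hdisj]
    _ ≤ _ := by gcongr; exact Measure.restrict_le_self

/-- The density of the layer-cake representation of `a ^ q`. -/
def layerWeight (q : ℝ) (a : ℝ≥0∞) (t : ℝ) : ℝ≥0∞ :=
  if ENNReal.ofReal t < a then ENNReal.ofReal (q * t ^ (q - 1)) else 0

lemma layerWeight_eq_indicator (q : ℝ) (a : ℝ≥0∞) (t : ℝ) :
    layerWeight q a t = ({t : ℝ | ENNReal.ofReal t < a}).indicator
      (fun t => ENNReal.ofReal (q * t ^ (q - 1))) t := by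
  by_cases h : ENNReal.ofReal t < a
  · rw [indicator_of_mem (show t ∈ {t : ℝ | ENNReal.ofReal t < a} from h), layerWeight, if_pos h]
  · rw [indicator_of_notMem (show t ∉ {t : ℝ | ENNReal.ofReal t < a} from h), layerWeight, if_neg h]

lemma Measurable.layerWeight {α : Type*} [MeasurableSpace α] (q : ℝ) {a : α → ℝ≥0∞} {t : α → ℝ}
    (ha : Measurable a) (ht : Measurable t) : Measurable fun z => layerWeight q (a z) (t z) :=
  Measurable.ite (measurableSet_lt (by fun_prop) ha) (by fun_prop) measurable_const

lemma lintegral_layer_eq_rpow {q : ℝ} (hq : 0 < q) (a : ℝ≥0∞) :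
    ∫⁻ t in Ioi (0 : ℝ), layerWeight q a t = a ^ q := by
  have hm : ∀ a : ℝ≥0∞, MeasurableSet {t : ℝ | ENNReal.ofReal t < a} := fun a =>
    measurableSet_lt (by fun_prop) measurable_const
  have hfin : ∀ r : ℝ, 0 ≤ r → ∫⁻ t in Ioi (0 : ℝ), layerWeight q (ENNReal.ofReal r) t = ENNReal.ofReal (r ^ q) := by
    intro r hr
    simp_rw [layerWeight_eq_indicator]
    rw [lintegral_indicator (hm _), Measure.restrict_restrict (hm _)]
    have hset : {t : ℝ | ENNReal.ofReal t < ENNReal.ofReal r} ∩ Ioi 0 = Ioo 0 r := by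
      ext t
      simp only [mem_inter_iff, mem_ofPred_eq, mem_Ioi, mem_Ioo]
      constructor
      · rintro ⟨h1, h2⟩
        exact ⟨h2, (ENNReal.ofReal_lt_ofReal_iff_of_nonneg h2.le).1 h1⟩
      · rintro ⟨h1, h2⟩
        exact ⟨(ENNReal.ofReal_lt_ofReal_iff_of_nonneg h1.le).2 h2, h1⟩
    rw [hset, restrict_Ioo_eq_restrict_Ioc]
    have hint : IntervalIntegrable (fun t : ℝ => q * t ^ (q - 1)) volume 0 r :=
      (intervalIntegral.intervalIntegrable_rpow' (by linarith)).const_mul q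
    rw [← ofReal_integral_eq_lintegral_ofReal
      ((intervalIntegrable_iff_integrableOn_Ioc_of_le hr).1 hint)
      ((ae_restrict_iff' measurableSet_Ioc).2 (ae_of_all _ fun t ht => by
        have := ht.1.le
        positivity))]
    rw [← intervalIntegral.integral_of_le hr, intervalIntegral.integral_const_mul,
      integral_rpow (Or.inl (by linarith))]
    congr 1
    rw [sub_add_cancel, Real.zero_rpow hq.ne']
    field_simp
    ring
  rcases eq_or_ne a ⊤ with rfl | ha
  -- For `a = ⊤` the integral dominates the one for every finite level, and the level `r ^ (1 / q)`
  -- gives exactly `r`.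
  · rw [ENNReal.top_rpow_of_pos hq, ← top_le_iff]
    refine ENNReal.le_of_forall_nnreal_lt fun r _ => ?_
    have h1 := hfin ((r : ℝ) ^ (1 / q)) (by positivity)
    rw [← Real.rpow_mul r.coe_nonneg, one_div_mul_cancel hq.ne', Real.rpow_one,
      ENNReal.ofReal_coe_nnreal] at h1
    rw [← h1]
    refine lintegral_mono fun t => ?_
    unfold layerWeight
    split_ifs <;> simp_all
  · have := hfin a.toReal ENNReal.toReal_nonneg
    rw [ENNReal.ofReal_toReal ha] at this
    rw [this, ← ENNReal.ofReal_rpow_of_nonneg ENNReal.toReal_nonneg hq.le, ENNReal.ofReal_toReal ha]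

/-- Truncation as in Marcinkiewicz interpolation: the part of `f` where `2 * f ≤ t` adds at most `t
/ 2` to any average, so the maximal function of the remaining part must exceed `t / 2`, and the weak
bound applies to that part alone. -/
lemma volume_lt_maximalFn_le_truncated {d : ℕ} (f : Eu d → ℝ≥0∞) {t : ℝ}
    (ht : 0 < t) :
    volume {x | ENNReal.ofReal t < maximalFn f x} ≤
      ENNReal.ofReal (5 ^ d) * (ENNReal.ofReal (2 / t) *
        ∫⁻ y, ({y | ENNReal.ofReal t < 2 * f y}).indicator f y) := by
  set A := {y | ENNReal.ofReal t < 2 * f y}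
  have ht2 : ENNReal.ofReal t = ENNReal.ofReal (t / 2) + ENNReal.ofReal (t / 2) := by
    rw [← ENNReal.ofReal_add (by positivity) (by positivity)]; ring_nf
  have hsub : {x | ENNReal.ofReal t < maximalFn f x} ⊆
      {x | ENNReal.ofReal (t / 2) < maximalFn (A.indicator f) x} := by
    intro x hx
    obtain ⟨k, hk⟩ := exists_lt_of_lt_maximalFn hx
    by_contra hcon
    have hcon' : maximalFn (A.indicator f) x ≤ ENNReal.ofReal (t / 2) := not_lt.1 hcon
    refine absurd hk (not_lt.2 ?_)
    have hv : volume (Metric.closedBall x ((2 : ℝ) ^ k)) ≠ 0 :=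
      (Metric.measure_closedBall_pos volume x (by positivity)).ne'
    have hv' : volume (Metric.closedBall x ((2 : ℝ) ^ k)) ≠ ⊤ := measure_closedBall_lt_top.ne
    have hle : ∀ y, f y ≤ A.indicator f y + ENNReal.ofReal (t / 2) := by
      intro y
      by_cases hy : y ∈ A
      · rw [indicator_of_mem hy]; exact le_self_add
      · rw [indicator_of_notMem hy, zero_add]
        have : 2 * f y ≤ ENNReal.ofReal t := not_lt.1 hy
        rw [ENNReal.ofReal_div_of_pos two_pos, ENNReal.le_div_iff_mul_le (by simp) (by simp)]
        simpa [mul_comm] using this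
    calc _ ≤ (volume (Metric.closedBall x ((2 : ℝ) ^ k)))⁻¹ *
          ∫⁻ y in Metric.closedBall x ((2 : ℝ) ^ k), (A.indicator f y + ENNReal.ofReal (t / 2)) := by
            gcongr with y; exact hle y
      _ = (volume (Metric.closedBall x ((2 : ℝ) ^ k)))⁻¹ *
          (∫⁻ y in Metric.closedBall x ((2 : ℝ) ^ k), A.indicator f y) + ENNReal.ofReal (t / 2) := by
            rw [lintegral_add_right _ measurable_const, setLIntegral_const, mul_add, ← mul_assoc,
              mul_comm _ (ENNReal.ofReal (t / 2)), mul_assoc, ENNReal.inv_mul_cancel hv hv', mul_one]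
      _ ≤ ENNReal.ofReal (t / 2) + ENNReal.ofReal (t / 2) := by
            gcongr
            exact (le_iSup (fun k : ℤ => (volume (Metric.closedBall x ((2 : ℝ) ^ k)))⁻¹ *
              ∫⁻ y in Metric.closedBall x ((2 : ℝ) ^ k), A.indicator f y) k).trans hcon'
      _ = _ := ht2.symm
  refine (measure_mono hsub).trans ((volume_lt_maximalFn_le _ (by simpa using ht) (by simp)).trans ?_)
  rw [← ENNReal.ofReal_inv_of_pos (by positivity), inv_div]

/-- The Hardy–Littlewood maximal inequality in `L^p`, `p > 1`. -/
lemma lintegral_maximalFn_rpow_le {d : ℕ} {p : ℝ} (hp : 1 < p) {f : Eu d → ℝ≥0∞}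
    (hf : Measurable f) :
    ∫⁻ x, maximalFn f x ^ p ≤
      ENNReal.ofReal (5 ^ d * (2 * p / (p - 1)) * 2 ^ (p - 1)) * ∫⁻ x, f x ^ p := by
  have hp1 : 0 < p - 1 := by linarith
  have hp0 : 0 < p := by linarith
  have hM : Measurable (maximalFn f) := by
    have h : Measurable fun z : Unit × Eu d => maximalFn ((fun _ => f) z.1) z.2 :=
      measurable_maximalFn (f := fun _ => f)
        (hf.comp (measurable_snd : Measurable (Prod.snd : Unit × Eu d → Eu d)))
    have h2 : Measurable fun x : Eu d => ((), x) := measurable_prodMk_left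
    have h3 := h.comp h2
    simpa only [Function.comp_def] using h3
  set K := ENNReal.ofReal (5 ^ d * (2 * p / (p - 1))) with hK
  calc ∫⁻ x, maximalFn f x ^ p
      = ∫⁻ x, ∫⁻ t in Ioi (0 : ℝ), layerWeight p (maximalFn f x) t := by
        simp_rw [lintegral_layer_eq_rpow hp0]
    _ = ∫⁻ t in Ioi (0 : ℝ), ∫⁻ x, layerWeight p (maximalFn f x) t :=
        lintegral_lintegral_swap
          (Measurable.layerWeight p (hM.comp measurable_fst) measurable_snd).aemeasurable
    -- The factor `2 / t` of the truncated bound lowers `t ^ (p - 1)` to `t ^ (p - 2)`. This is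
    -- again a layer weight, of exponent `p - 1 > 0` at level `2 * f x`, so the `t`-integral can be
    -- evaluated.
    _ ≤ ∫⁻ t in Ioi (0 : ℝ), K * ∫⁻ x, f x * layerWeight (p - 1) (2 * f x) t := by
        refine setLIntegral_mono' measurableSet_Ioi fun t (ht : 0 < t) => ?_
        have e1 : ∀ x, layerWeight p (maximalFn f x) t =
            ({x | ENNReal.ofReal t < maximalFn f x}).indicator
              (fun _ => ENNReal.ofReal (p * t ^ (p - 1))) x := by
          intro x
          by_cases h : ENNReal.ofReal t < maximalFn f x
          · rw [indicator_of_mem (show x ∈ {x | ENNReal.ofReal t < maximalFn f x} from h),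
              layerWeight, if_pos h]
          · rw [indicator_of_notMem (show x ∉ {x | ENNReal.ofReal t < maximalFn f x} from h),
              layerWeight, if_neg h]
        have e2 : ∀ x, f x * layerWeight (p - 1) (2 * f x) t =
            ENNReal.ofReal ((p - 1) * t ^ (p - 1 - 1)) *
              ({x | ENNReal.ofReal t < 2 * f x}).indicator f x := by
          intro x
          by_cases h : ENNReal.ofReal t < 2 * f x
          · rw [indicator_of_mem (show x ∈ {x | ENNReal.ofReal t < 2 * f x} from h),
              layerWeight, if_pos h, mul_comm]
          · rw [indicator_of_notMem (show x ∉ {x | ENNReal.ofReal t < 2 * f x} from h),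
              layerWeight, if_neg h]
            simp
        simp_rw [e1, e2]
        have hA : MeasurableSet {x | ENNReal.ofReal t < 2 * f x} :=
          measurableSet_lt measurable_const (by fun_prop)
        rw [lintegral_indicator_const (measurableSet_lt measurable_const hM),
          lintegral_const_mul _ (hf.indicator hA)]
        refine (mul_le_mul_right (volume_lt_maximalFn_le_truncated f ht) _).trans (le_of_eq ?_)
        rw [← mul_assoc, ← mul_assoc, ← mul_assoc, hK, ← ENNReal.ofReal_mul (by positivity),
          ← ENNReal.ofReal_mul (by positivity), ← ENNReal.ofReal_mul (by positivity)]
        congr 2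
        rw [Real.rpow_sub_one ht.ne' (p - 1), Real.rpow_sub_one ht.ne' p]
        field_simp
    _ = K * ∫⁻ x, f x * (2 * f x) ^ (p - 1) := by
        have hm2 : Measurable fun z : ℝ × Eu d => f z.2 * layerWeight (p - 1) (2 * f z.2) z.1 :=
          (hf.comp measurable_snd).mul (Measurable.layerWeight _ (by fun_prop) measurable_fst)
        rw [lintegral_const_mul _ hm2.lintegral_prod_right',
          lintegral_lintegral_swap hm2.aemeasurable]
        congr 1
        refine lintegral_congr fun x => ?_
        dsimp only
        rw [lintegral_const_mul _ (Measurable.layerWeight _ measurable_const measurable_id'),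
          lintegral_layer_eq_rpow hp1]
    _ = _ := by
        have : ∀ x, f x * (2 * f x) ^ (p - 1) = ENNReal.ofReal (2 ^ (p - 1)) * f x ^ p := by
          intro x
          rw [ENNReal.mul_rpow_of_nonneg _ _ hp1.le, mul_left_comm]
          have h1 : f x * f x ^ (p - 1) = f x ^ p := by
            have := ENNReal.rpow_add_of_nonneg (x := f x) 1 (p - 1) zero_le_one hp1.le
            rw [ENNReal.rpow_one] at this
            rw [← this]; ring_nf
          rw [h1, ← ENNReal.ofReal_rpow_of_nonneg zero_le_two hp1.le]
          simp
        simp_rw [this]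
        rw [lintegral_const_mul _ (by fun_prop), ← mul_assoc, hK, ← ENNReal.ofReal_mul (by positivity)]

/-! ### Pointwise Lipschitz estimate by the maximal function of the gradient -/

/-- The dyadic radius next above `ρ` is at most `2 * ρ`; this loss is the price of a maximal
function over countably many radii. -/
lemma setLIntegral_closedBall_le_maximalFn {d : ℕ} (F : Eu d → ℝ≥0∞) (x : Eu d) {ρ : ℝ} (hρ : 0 < ρ) :
    ∫⁻ y in Metric.closedBall x ρ, F y ≤
      ENNReal.ofReal ((2 * ρ) ^ d) * volume (Metric.closedBall (0 : Eu d) 1) * maximalFn F x := by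
  obtain ⟨k, hk1, hk2⟩ := exists_mem_Ioc_zpow hρ one_lt_two
  have hle : ρ ≤ (2 : ℝ) ^ (k + 1) := hk2
  have hle2 : (2 : ℝ) ^ (k + 1) ≤ 2 * ρ := by
    rw [zpow_add_one₀ two_ne_zero]; linarith
  have hv : volume (Metric.closedBall x ((2 : ℝ) ^ (k + 1))) ≠ 0 :=
    (Metric.measure_closedBall_pos volume x (by positivity)).ne'
  have hv' : volume (Metric.closedBall x ((2 : ℝ) ^ (k + 1))) ≠ ⊤ := measure_closedBall_lt_top.ne
  calc ∫⁻ y in Metric.closedBall x ρ, F y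
      ≤ ∫⁻ y in Metric.closedBall x ((2 : ℝ) ^ (k + 1)), F y :=
        lintegral_mono_set (Metric.closedBall_subset_closedBall hle)
    _ = volume (Metric.closedBall x ((2 : ℝ) ^ (k + 1))) *
          ((volume (Metric.closedBall x ((2 : ℝ) ^ (k + 1))))⁻¹ *
            ∫⁻ y in Metric.closedBall x ((2 : ℝ) ^ (k + 1)), F y) := by
        rw [← mul_assoc, ENNReal.mul_inv_cancel hv hv', one_mul]
    _ ≤ volume (Metric.closedBall x (2 * ρ)) * maximalFn F x := by
        gcongr
        exact le_iSup (fun k : ℤ => (volume (Metric.closedBall x ((2 : ℝ) ^ k)))⁻¹ *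
            ∫⁻ y in Metric.closedBall x ((2 : ℝ) ^ k), F y) (k + 1)
    _ = _ := by
        have := Measure.addHaar_closedBall_mul volume x (r := 2 * ρ) (by positivity) (s := 1) zero_le_one
        rw [mul_one, finrank_euclideanSpace_fin] at this
        rw [this]

lemma lintegral_closedBall_comp_smul {d : ℕ} {F : Eu d → ℝ≥0∞} (hF : Measurable F) (x : Eu d)
    {τ : ℝ} (hτ : 0 < τ) (R : ℝ) :
    ∫⁻ v in Metric.closedBall (0 : Eu d) R, F (x + τ • v) =
      ENNReal.ofReal ((τ ^ d)⁻¹) * ∫⁻ y in Metric.closedBall x (τ * R), F y := by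
  have h1 : ∫⁻ v in Metric.closedBall (0 : Eu d) R, F (x + τ • v) =
      ∫⁻ v, (Metric.closedBall x (τ * R)).indicator F (x + τ • v) := by
    rw [← lintegral_indicator Metric.isClosed_closedBall.measurableSet]
    refine lintegral_congr fun v => ?_
    have hiff : v ∈ Metric.closedBall (0 : Eu d) R ↔ x + τ • v ∈ Metric.closedBall x (τ * R) := by
      rw [Metric.mem_closedBall, Metric.mem_closedBall, dist_zero_right, dist_eq_norm,
        add_sub_cancel_left, norm_smul, Real.norm_of_nonneg hτ.le, mul_le_mul_iff_right₀ hτ]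
    by_cases hv : v ∈ Metric.closedBall (0 : Eu d) R
    · rw [indicator_of_mem hv, indicator_of_mem (hiff.1 hv)]
    · rw [indicator_of_notMem hv, indicator_of_notMem (fun h => hv (hiff.2 h))]
  have hm : Measurable ((Metric.closedBall x (τ * R)).indicator F) :=
    hF.indicator Metric.isClosed_closedBall.measurableSet
  have h2 := lintegral_map (μ := (volume : Measure (Eu d)))
    (f := fun y => (Metric.closedBall x (τ * R)).indicator F (x + y)) (g := fun v : Eu d => τ • v)
    (hm.comp (measurable_const_add x)) (measurable_const_smul τ)
  have hmap : Measure.map (fun v : Eu d => τ • v) volume =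
      ENNReal.ofReal |(τ ^ Module.finrank ℝ (Eu d))⁻¹| • (volume : Measure (Eu d)) :=
    Measure.map_addHaar_smul volume hτ.ne'
  rw [hmap, lintegral_smul_measure, finrank_euclideanSpace_fin, abs_of_pos (by positivity)] at h2
  rw [h1, ← h2, lintegral_add_left_eq_self, lintegral_indicator Metric.isClosed_closedBall.measurableSet,
    smul_eq_mul]

/-- After exchanging integrals, `y = x + τ • v` turns the inner integral into one over the ball of
radius `τ * R`. Its maximal bound carries `τ ^ d`, which cancels the Jacobian `τ ^ (-d)`, so the
estimate is uniform in `τ`. -/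
lemma setLIntegral_enorm_sub_le {d : ℕ} {f : Eu d → Eu d} {F : Eu d → ℝ≥0∞} (hF : Measurable F)
    {x : Eu d} (hx : ∀ᵐ v : Eu d, ‖f (x + v) - f x‖ₑ ≤ ‖v‖ₑ * ∫⁻ τ in Ioc (0 : ℝ) 1, F (x + τ • v))
    {R : ℝ} (hR : 0 < R) :
    ∫⁻ z in Metric.closedBall x R, ‖f z - f x‖ₑ ≤ ENNReal.ofReal R *
      (ENNReal.ofReal ((2 * R) ^ d) * volume (Metric.closedBall (0 : Eu d) 1) * maximalFn F x) := by
  have hFm : Measurable fun z : Eu d × ℝ => F (x + z.2 • z.1) := hF.comp (by fun_prop)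
  calc ∫⁻ z in Metric.closedBall x R, ‖f z - f x‖ₑ
      = ∫⁻ v in Metric.closedBall (0 : Eu d) R, ‖f (x + v) - f x‖ₑ := by
        rw [← lintegral_indicator Metric.isClosed_closedBall.measurableSet,
          ← lintegral_indicator Metric.isClosed_closedBall.measurableSet,
          ← lintegral_add_left_eq_self _ x]
        refine lintegral_congr fun v => ?_
        have hiff : v ∈ Metric.closedBall (0 : Eu d) R ↔ x + v ∈ Metric.closedBall x R := by
          simp [Metric.mem_closedBall, dist_eq_norm]
        by_cases hv : v ∈ Metric.closedBall (0 : Eu d) R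
        · rw [indicator_of_mem hv, indicator_of_mem (hiff.1 hv)]
        · rw [indicator_of_notMem hv, indicator_of_notMem (fun h => hv (hiff.2 h))]
    _ ≤ ∫⁻ v in Metric.closedBall (0 : Eu d) R,
          ENNReal.ofReal R * ∫⁻ τ in Ioc (0 : ℝ) 1, F (x + τ • v) := by
        refine lintegral_mono_ae ?_
        filter_upwards [ae_restrict_of_ae hx, ae_restrict_mem Metric.isClosed_closedBall.measurableSet]
          with v hv hvR
        refine hv.trans ?_
        gcongr
        rw [← ofReal_norm]
        exact ENNReal.ofReal_le_ofReal (by simpa using hvR)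
    _ = ENNReal.ofReal R * ∫⁻ τ in Ioc (0 : ℝ) 1, ∫⁻ v in Metric.closedBall (0 : Eu d) R, F (x + τ • v) := by
        rw [lintegral_const_mul _ hFm.lintegral_prod_right', lintegral_lintegral_swap hFm.aemeasurable]
    _ ≤ ENNReal.ofReal R * ∫⁻ _ in Ioc (0 : ℝ) 1,
          ENNReal.ofReal ((2 * R) ^ d) * volume (Metric.closedBall (0 : Eu d) 1) * maximalFn F x := by
        refine mul_le_mul_right (setLIntegral_mono' measurableSet_Ioc fun τ hτ => ?_) _
        rw [lintegral_closedBall_comp_smul hF x hτ.1]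
        refine (mul_le_mul_right (setLIntegral_closedBall_le_maximalFn F x (mul_pos hτ.1 hR)) _).trans
          (le_of_eq ?_)
        rw [← mul_assoc, ← mul_assoc, ← ENNReal.ofReal_mul (by have := hτ.1; positivity)]
        have : (τ ^ d)⁻¹ * (2 * (τ * R)) ^ d = (2 * R) ^ d := by
          have := hτ.1.ne'
          rw [mul_left_comm, mul_pow τ, inv_mul_cancel_left₀ (pow_ne_zero _ this)]
        rw [this]
    _ = _ := by simp

/-- A weakly differentiable function satisfies a pointwise Lipschitz estimate, off a null set,
with the maximal function of its gradient. -/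
lemma HasWeakGradient.exists_null_enorm_sub_le {d : ℕ} {f : Eu d → Eu d}
    {G : Eu d → Eu d →L[ℝ] Eu d} (hw : HasWeakGradient f G) (hf : Measurable f)
    (hG : Measurable fun x => ‖G x‖ₑ) :
    ∃ S : Set (Eu d), volume S = 0 ∧ ∀ x ∉ S, ∀ y ∉ S, ‖f x - f y‖ₑ ≤ ‖x - y‖ₑ *
      (ENNReal.ofReal (4 ^ d) * maximalFn (fun x => ‖G x‖ₑ) x +
        ENNReal.ofReal (4 ^ d) * maximalFn (fun x => ‖G x‖ₑ) y) := by
  set F : Eu d → ℝ≥0∞ := fun x => ‖G x‖ₑ with hF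
  set S : Set (Eu d) := {x | ¬ ∀ᵐ v : Eu d, ‖f (x + v) - f x‖ₑ ≤
    ‖v‖ₑ * ∫⁻ τ in Ioc (0 : ℝ) 1, F (x + τ • v)} with hS
  have hFm : Measurable fun w : (Eu d × Eu d) × ℝ => F (w.1.2 + w.2 • w.1.1) := hG.comp (by fun_prop)
  have hae : ∀ᵐ x : Eu d, ∀ᵐ v : Eu d, ‖f (x + v) - f x‖ₑ ≤
      ‖v‖ₑ * ∫⁻ τ in Ioc (0 : ℝ) 1, F (x + τ • v) := by
    have hm : MeasurableSet {z : Eu d × Eu d | ‖f (z.2 + z.1) - f z.2‖ₑ ≤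
        ‖z.1‖ₑ * ∫⁻ τ in Ioc (0 : ℝ) 1, F (z.2 + τ • z.1)} := by
      refine measurableSet_le ?_ ?_
      · exact ((hf.comp (by fun_prop)).sub (hf.comp measurable_snd)).enorm
      · exact measurable_fst.enorm.mul hFm.lintegral_prod_right'
    -- The segment formula has a null set of `x` depending on `v`. Exchanging the quantifiers gives
    -- a single null set of `x`, off which the bound holds for a.e. `v`.
    refine (Measure.ae_ae_comm (p := fun v x : Eu d => ‖f (x + v) - f x‖ₑ ≤
        ‖v‖ₑ * ∫⁻ τ in Ioc (0 : ℝ) 1, F (x + τ • v)) hm).1 (ae_of_all _ fun v => ?_)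
    filter_upwards [hw.ae_sub_eq_integral v] with x hx
    rw [hx]
    refine (enorm_integral_le_lintegral_enorm _).trans ?_
    rw [← lintegral_const_mul' _ _ enorm_ne_top]
    refine lintegral_mono fun τ => ?_
    rw [mul_comm]
    exact ContinuousLinearMap.le_opENorm _ _
  refine ⟨S, ae_iff.1 hae, fun x hx y hy => ?_⟩
  have hx' := not_not.1 hx
  have hy' := not_not.1 hy
  rcases eq_or_ne x y with rfl | hxy
  · simp
  set R := dist x y with hR
  have hR0 : 0 < R := dist_pos.2 hxy
  set m := midpoint ℝ x y with hm
  -- The ball around the midpoint lies in the balls of radius `R` around both points. Averaging `|f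
  -- x - f y| ≤ |f z - f x| + |f z - f y|` over it and comparing `(2 * R) ^ d` with `(R / 2) ^ d`
  -- gives the constant `4 ^ d`.
  set Q := Metric.closedBall m (R / 2) with hQ
  set V := volume (Metric.closedBall (0 : Eu d) 1) with hV
  have hV0 : V ≠ 0 := (Metric.measure_closedBall_pos volume _ one_pos).ne'
  have hVt : V ≠ ⊤ := measure_closedBall_lt_top.ne
  have hQv : volume Q = ENNReal.ofReal ((R / 2) ^ d) * V := by
    have := Measure.addHaar_closedBall_mul volume m (r := R / 2) (by positivity) (s := 1) zero_le_one
    rwa [mul_one, finrank_euclideanSpace_fin] at this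
  have hmx : dist m x = R / 2 := by
    rw [hm, dist_midpoint_left, Real.norm_ofNat]; ring
  have hmy : dist m y = R / 2 := by
    rw [hm, dist_midpoint_right, Real.norm_ofNat]; ring
  have hQx : Q ⊆ Metric.closedBall x R := Metric.closedBall_subset_closedBall' (by linarith)
  have hQy : Q ⊆ Metric.closedBall y R := Metric.closedBall_subset_closedBall' (by linarith)
  have key : ‖f x - f y‖ₑ * volume Q ≤ ENNReal.ofReal R *
      (ENNReal.ofReal ((2 * R) ^ d) * V * (maximalFn F x + maximalFn F y)) := by
    calc ‖f x - f y‖ₑ * volume Q = ∫⁻ _ in Q, ‖f x - f y‖ₑ := by rw [setLIntegral_const]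
      _ ≤ ∫⁻ z in Q, (‖f z - f x‖ₑ + ‖f z - f y‖ₑ) := by
          refine lintegral_mono fun z => ?_
          have : f x - f y = -(f z - f x) + (f z - f y) := by abel
          rw [this]
          exact (enorm_add_le _ _).trans (by rw [enorm_neg])
      _ = (∫⁻ z in Q, ‖f z - f x‖ₑ) + ∫⁻ z in Q, ‖f z - f y‖ₑ :=
          lintegral_add_left (hf.sub_const _).enorm _
      _ ≤ (∫⁻ z in Metric.closedBall x R, ‖f z - f x‖ₑ) + ∫⁻ z in Metric.closedBall y R, ‖f z - f y‖ₑ :=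
          add_le_add (lintegral_mono_set hQx) (lintegral_mono_set hQy)
      _ ≤ _ := by
          refine (add_le_add (setLIntegral_enorm_sub_le hG hx' hR0)
            (setLIntegral_enorm_sub_le hG hy' hR0)).trans (le_of_eq ?_)
          rw [← mul_add, ← mul_add]
  have hQ0 : volume Q ≠ 0 := by
    rw [hQv]; exact mul_ne_zero (by simp; positivity) hV0
  have hQt : volume Q ≠ ⊤ := measure_closedBall_lt_top.ne
  have hxyR : ‖x - y‖ₑ = ENNReal.ofReal R := by rw [← ofReal_norm, hR, dist_eq_norm]
  rw [hxyR, ← mul_add]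
  refine (ENNReal.mul_le_mul_iff_left hQ0 hQt).1 (key.trans (le_of_eq ?_))
  rw [hQv]
  have : ENNReal.ofReal ((2 * R) ^ d) = ENNReal.ofReal (4 ^ d) * ENNReal.ofReal ((R / 2) ^ d) := by
    rw [← ENNReal.ofReal_mul (by positivity), ← mul_pow]; ring_nf
  rw [this]
  ring

/-! ### Determinant, trace and distributional divergence -/

lemma tr_eq_sum {d : ℕ} (A : Eu d →L[ℝ] Eu d) :
    tr A = ∑ j, (A (EuclideanSpace.single j 1)) j := by
  rw [tr, LinearMap.trace_eq_sum_inner _ (EuclideanSpace.basisFun (Fin d) ℝ)]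
  simp [EuclideanSpace.inner_single_left]

lemma det_eq_det_of {d : ℕ} (A : Eu d →L[ℝ] Eu d) :
    A.det = (Matrix.of fun i j => (A (EuclideanSpace.single j 1)) i).det := by
  rw [ContinuousLinearMap.det, ← LinearMap.det_toMatrix (EuclideanSpace.basisFun (Fin d) ℝ).toBasis]
  congr 1

/-- The determinant is polynomial, hence `C²`, and its derivative at the identity is the trace. A
locally Lipschitz derivative makes the Taylor remainder quadratic. -/
lemma exists_abs_det_one_add_sub_le (d : ℕ) : ∃ c > 0, ∃ ρ > 0, ∀ A : Eu d →L[ℝ] Eu d, ‖A‖ ≤ ρ →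
    |(1 + A).det - 1 - tr A| ≤ c * ‖A‖ ^ 2 := by
  set f : (Eu d →L[ℝ] Eu d) → ℝ := fun A => (1 + A).det with hf
  have hfc : ContDiff ℝ 2 f := by
    have : f = fun A => ∑ σ : Equiv.Perm (Fin d), (Equiv.Perm.sign σ : ℤ) •
        ∏ i, ((1 + A : Eu d →L[ℝ] Eu d) (EuclideanSpace.single i 1)) (σ i) := by
      ext A
      simp only [hf]
      rw [det_eq_det_of, Matrix.det_apply]
      rfl
    rw [this]
    refine ContDiff.sum fun σ _ => ContDiff.const_smul _ (contDiff_prod fun i _ => ?_)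
    have : (fun A : Eu d →L[ℝ] Eu d => ((1 + A : Eu d →L[ℝ] Eu d) (EuclideanSpace.single i 1)) (σ i)) =
      fun A => EuclideanSpace.proj (𝕜 := ℝ) (σ i) ((1 + A : Eu d →L[ℝ] Eu d) (EuclideanSpace.single i 1)) := rfl
    rw [this]
    exact (ContinuousLinearMap.contDiff _).comp ((contDiff_const.add contDiff_id).clm_apply contDiff_const)
  have hf' : ContDiff ℝ 1 (fderiv ℝ f) := hfc.fderiv_right (by norm_num)
  obtain ⟨K, t, ht, hK⟩ := (hf'.contDiffAt (x := 0)).exists_lipschitzOnWith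
  obtain ⟨ρ, hρ, hball⟩ := Metric.mem_nhds_iff.1 ht
  have hf0 : f 0 = 1 := by simp [hf, ContinuousLinearMap.det]
  have hd0 : ∀ A, fderiv ℝ f 0 A = tr A := by
    intro A
    have h1 : HasDerivAt (fun s : ℝ => f (s • A)) (fderiv ℝ f 0 A) 0 := by
      have hs : HasDerivAt (fun s : ℝ => s • A) A 0 := by
        simpa using (hasDerivAt_id (0 : ℝ)).smul_const A
      have hfd : HasFDerivAt f (fderiv ℝ f 0) ((0 : ℝ) • A) := by
        have h0 : (0 : ℝ) • A = 0 := by ext; simp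
        rw [h0]; exact (hfc.differentiable (by norm_num) 0).hasFDerivAt
      exact hfd.comp_hasDerivAt 0 hs
    set M : Matrix (Fin d) (Fin d) ℝ := Matrix.of fun i j => (A (EuclideanSpace.single j 1)) i with hM
    -- Dropping the two lowest coefficients leaves the `q` with `det (1 + s M) = 1 + s tr M + s²
    -- q(s)`, from which the derivative at `s = 0` can be read off.
    set q := ((1 + (Polynomial.X : Polynomial ℝ) • M.map Polynomial.C).det).divX.divX with hq
    have h2 : (fun s : ℝ => f (s • A)) = fun s => 1 + M.trace * s + q.eval s * s ^ 2 := by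
      ext s
      rw [← Matrix.det_one_add_smul]
      simp only [hf]
      rw [det_eq_det_of]
      congr 1
      ext i j
      simp [hM, Matrix.one_apply]
    have h3 : HasDerivAt (fun s : ℝ => 1 + M.trace * s + q.eval s * s ^ 2) M.trace 0 := by
      have := (((hasDerivAt_id (0 : ℝ)).const_mul M.trace).const_add 1).add
        ((q.hasDerivAt 0).mul ((hasDerivAt_id (0 : ℝ)).pow 2))
      refine this.congr_deriv ?_
      simp
    rw [h2] at h1
    rw [h1.unique h3, tr_eq_sum]
    rfl
  refine ⟨K + 1, by positivity, ρ / 2, by positivity, fun A hA => ?_⟩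
  have hmem : ∀ B ∈ Metric.closedBall (0 : Eu d →L[ℝ] Eu d) ‖A‖, B ∈ t := by
    intro B hB
    refine hball ?_
    rw [Metric.mem_closedBall, dist_zero_right] at hB
    rw [Metric.mem_ball, dist_zero_right]
    linarith
  have := (convex_closedBall (0 : Eu d →L[ℝ] Eu d) ‖A‖).norm_image_sub_le_of_norm_fderiv_le'
    (f := f) (φ := fderiv ℝ f 0) (C := K * ‖A‖) (x := 0) (y := A)
    (fun x _ => hfc.differentiable (by norm_num) x) (fun B hB => by
      have h := hK.norm_sub_le (hmem B hB) (mem_of_mem_nhds ht)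
      refine h.trans ?_
      rw [sub_zero]
      gcongr
      simpa using hB) (by simp) (by simp)
  rw [sub_zero, hf0, hd0, Real.norm_eq_abs] at this
  refine this.trans ?_
  nlinarith [sq_nonneg ‖A‖]

/-- A nonnegative bump of integral one centred at `x`, used as `φ`, bounds the mollification of `g`
at `x` by `C`; mollifications converge to `g` almost everywhere. -/
lemma ae_abs_le_of_abs_integral_mul_le {d : ℕ} {g : Eu d → ℝ} (hg : LocallyIntegrable g volume)
    {C : ℝ} (h : ∀ φ : Eu d → ℝ, ContDiff ℝ ∞ φ → HasCompactSupport φ →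
      |∫ x, φ x * g x| ≤ C * ∫ x, |φ x|) : ∀ᵐ x, |g x| ≤ C := by
  let β : ℕ → ContDiffBump (0 : Eu d) := fun n =>
    ⟨1 / (n + 1), 2 / (n + 1), by positivity, by gcongr; norm_num⟩
  have hβ : Filter.Tendsto (fun n => (β n).rOut) Filter.atTop (𝓝 0) := by
    have : (fun n => (β n).rOut) = fun n : ℕ => 2 * (1 / ((n : ℝ) + 1)) := by
      ext n; simp only [β]; ring
    rw [this]
    simpa using tendsto_one_div_add_atTop_nhds_zero_nat.const_mul (2 : ℝ)
  filter_upwards [ContDiffBump.ae_convolution_tendsto_right_of_locallyIntegrable (μ := volume)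
    (φ := β) (K := 2) hβ (Filter.Eventually.of_forall fun n => by simp only [β]; ring_nf; rfl) hg] with x hx
  refine le_of_tendsto hx.abs (Filter.Eventually.of_forall fun n => ?_)
  have e := convolution_lsmul_swap (𝕜 := ℝ) (μ := (volume : Measure (Eu d)))
    (f := (β n).normed volume) (g := g) (x := x)
  rw [e]
  have := h (fun y => (β n).normed volume (x - y))
    ((ContDiffBump.contDiff_normed (n := ⊤) (β n)).comp (by fun_prop))
    ((β n).hasCompactSupport_normed.comp_homeomorph (Homeomorph.subLeft x))
  simp_rw [abs_of_nonneg ((β n).nonneg_normed _)] at this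
  rw [integral_sub_left_eq_self (fun y => (β n).normed volume y), (β n).integral_normed, mul_one] at this
  exact this

lemma sum_fderiv_single_mul {d : ℕ} (φ : Eu d → ℝ) (x v : Eu d) :
    ∑ j, fderiv ℝ φ x (EuclideanSpace.single j 1) * v j = fderiv ℝ φ x v := by
  have hv : v = ∑ j, v j • EuclideanSpace.single j (1 : ℝ) := by
    have := (EuclideanSpace.basisFun (Fin d) ℝ).sum_repr v
    simpa using this.symm
  conv_rhs => rw [hv]
  rw [map_sum]
  exact Finset.sum_congr rfl fun j _ => by rw [map_smul, smul_eq_mul, mul_comm]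

lemma integrable_fderiv_apply_of_locallyIntegrable {d : ℕ} {φ : Eu d → ℝ} (hφ : ContDiff ℝ ∞ φ)
    (hφc : HasCompactSupport φ) (v : Eu d) {F : Type*} [NormedAddCommGroup F] [NormedSpace ℝ F]
    {f : Eu d → F} (hf : LocallyIntegrable f volume) :
    Integrable (fun x => fderiv ℝ φ x v • f x) volume :=
  hf.integrable_smul_left_of_hasCompactSupport
    ((hφ.continuous_fderiv (by simp)).clm_apply continuous_const)
    ((hφc.fderiv (𝕜 := ℝ)).comp_left (g := fun A : Eu d →L[ℝ] ℝ => A v) (by simp))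

lemma locallyIntegrable_apply {d : ℕ} {f : Eu d → Eu d} (hf : LocallyIntegrable f volume) (j : Fin d) :
    LocallyIntegrable (fun x => f x j) volume := fun x => by
  obtain ⟨s, hs, hi⟩ := hf x
  exact ⟨s, hs, (EuclideanSpace.proj (𝕜 := ℝ) (ι := Fin d) j).integrable_comp hi⟩

/-- The divergence bound in a form linear in `f` and free of its derivatives, so that it passes to
time averages by Fubini. -/
lemma HasWeakGradient.abs_integral_fderiv_le {d : ℕ} {f : Eu d → Eu d} {G : Eu d → Eu d →L[ℝ] Eu d}
    (hw : HasWeakGradient f G) {C : ℝ} (hC : ∀ᵐ x, |tr (G x)| ≤ C)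
    {φ : Eu d → ℝ} (hφ : ContDiff ℝ ∞ φ) (hφc : HasCompactSupport φ) :
    |∫ x, fderiv ℝ φ x (f x)| ≤ C * ∫ x, |φ x| := by
  have hGj : ∀ j : Fin d, LocallyIntegrable (fun x => G x (EuclideanSpace.single j 1)) volume :=
    fun j x => by
      obtain ⟨s, hs, hi⟩ := hw.locallyIntegrable_grad x
      exact ⟨s, hs, (ContinuousLinearMap.apply ℝ (Eu d)
        (EuclideanSpace.single j (1 : ℝ) : Eu d)).integrable_comp hi⟩
  have hcomp : ∀ j : Fin d, ∫ x, fderiv ℝ φ x (EuclideanSpace.single j 1) * f x j =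
      - ∫ x, φ x * G x (EuclideanSpace.single j 1) j := by
    intro j
    have h1 := hw.integral_eq φ hφ hφc (EuclideanSpace.single j 1)
    have h2 := congrArg (EuclideanSpace.proj (𝕜 := ℝ) (ι := Fin d) j) h1
    rw [map_neg, ← ContinuousLinearMap.integral_comp_comm, ← ContinuousLinearMap.integral_comp_comm] at h2
    · simpa using h2
    · exact (hGj j).integrable_smul_left_of_hasCompactSupport hφ.continuous hφc
    · exact integrable_fderiv_apply_of_locallyIntegrable hφ hφc _ hw.locallyIntegrable
  have heq : ∫ x, fderiv ℝ φ x (f x) = - ∫ x, φ x * tr (G x) := by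
    simp_rw [← sum_fderiv_single_mul φ _ (f _), tr_eq_sum, Finset.mul_sum]
    rw [integral_finsetSum, integral_finsetSum, ← Finset.sum_neg_distrib]
    · exact Finset.sum_congr rfl fun j _ => hcomp j
    · intro j _
      exact (locallyIntegrable_apply (hGj j) j).integrable_smul_left_of_hasCompactSupport hφ.continuous hφc
    · intro j _
      exact integrable_fderiv_apply_of_locallyIntegrable hφ hφc _ (locallyIntegrable_apply hw.locallyIntegrable j)
  rw [heq, abs_neg, ← integral_const_mul, ← Real.norm_eq_abs]
  refine norm_integral_le_of_norm_le ((hφ.continuous.integrable_of_hasCompactSupport hφc).abs.const_mul C) ?_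
  filter_upwards [hC] with x hx
  rw [norm_mul, mul_comm, Real.norm_eq_abs, Real.norm_eq_abs]
  gcongr

/-- The way back from the weak form: by Rademacher the classical derivative exists a.e., and
integration by parts for Lipschitz functions identifies its trace with the distributional
divergence. -/
lemma LipschitzWith.ae_abs_tr_fderiv_le {d : ℕ} {f : Eu d → Eu d} {K : ℝ≥0} (hf : LipschitzWith K f)
    {C : ℝ} (h : ∀ φ : Eu d → ℝ, ContDiff ℝ ∞ φ → HasCompactSupport φ →
      |∫ x, fderiv ℝ φ x (f x)| ≤ C * ∫ x, |φ x|) : ∀ᵐ x, |tr (fderiv ℝ f x)| ≤ C := by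
  have hfj : ∀ j : Fin d, LipschitzWith K (fun x => f x j) := fun j => by
    refine LipschitzWith.of_dist_le_mul fun x y => (le_trans ?_ (hf.dist_le_mul x y))
    rw [dist_eq_norm, dist_eq_norm]
    exact PiLp.norm_apply_le (f x - f y) j
  set g : Eu d → ℝ := fun x => ∑ j, lineDeriv ℝ (fun x => f x j) x (EuclideanSpace.single j 1) with hg
  have hgj : ∀ j : Fin d, LocallyIntegrable
      (fun x => lineDeriv ℝ (fun x => f x j) x (EuclideanSpace.single j 1)) volume :=
    fun j => (hfj j).locallyIntegrable_lineDeriv _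
  have hgl : LocallyIntegrable g volume := locallyIntegrable_finsetSum _ fun j _ => hgj j
  have hgeq : ∀ᵐ x, tr (fderiv ℝ f x) = g x := by
    filter_upwards [hf.ae_differentiableAt (μ := volume)] with x hx
    rw [tr_eq_sum]
    refine Finset.sum_congr rfl fun j _ => ?_
    have h1 : HasFDerivAt (fun x => f x j)
        ((EuclideanSpace.proj (𝕜 := ℝ) (ι := Fin d) j).comp (fderiv ℝ f x)) x :=
      (EuclideanSpace.proj (𝕜 := ℝ) (ι := Fin d) j).hasFDerivAt.comp x hx.hasFDerivAt
    rw [(h1.hasLineDerivAt _).lineDeriv]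
    rfl
  have hmain : ∀ᵐ x, |g x| ≤ C := by
    refine ae_abs_le_of_abs_integral_mul_le hgl fun φ hφ hφc => ?_
    obtain ⟨D, hD⟩ := (hφ.of_le (m := 1) (by simp)).lipschitzWith_of_hasCompactSupport hφc (by simp)
    have e : ∫ x, φ x * g x = - ∫ x, fderiv ℝ φ x (f x) := by
      simp_rw [← sum_fderiv_single_mul φ _ (f _), hg, Finset.mul_sum]
      rw [integral_finsetSum, integral_finsetSum, ← Finset.sum_neg_distrib]
      · refine Finset.sum_congr rfl fun j _ => ?_
        have := (hfj j).integral_lineDeriv_mul_eq (μ := volume) hD hφc (EuclideanSpace.single j 1)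
        simp_rw [mul_comm (φ _)]
        rw [this, ← integral_neg]
        congr 1; ext1 x
        rw [((hφ.differentiable (by simp) x).hasFDerivAt.hasLineDerivAt _).lineDeriv, map_neg, neg_mul]
      · intro j _
        exact integrable_fderiv_apply_of_locallyIntegrable hφ hφc _ (hfj j).continuous.locallyIntegrable
      · intro j _
        exact (hgj j).integrable_smul_left_of_hasCompactSupport hφ.continuous hφc
    rw [e, abs_neg]
    exact h φ hφ hφc
  filter_upwards [hgeq, hmain] with x h1 h2
  rwa [h1]

/-! ### Near incompressibility of one implicit step -/

lemma antilipschitz_add_smul {d : ℕ} {f : Eu d → Eu d} {K τ h ρ : ℝ} (hK : 0 ≤ K)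
    (hf : LipschitzWith K.toNNReal f) (hτ : |τ| ≤ h) (hρ : h * K ≤ ρ) (hρ1 : ρ < 1) (hρ0 : 0 < ρ) :
    AntilipschitzWith (1 - ρ).toNNReal⁻¹ (fun x => x + τ • f x) ∧
      LipschitzWith (1 + ρ).toNNReal (fun x => x + τ • f x) ∧
      ∀ x y, ‖(x + τ • f x) - (y + τ • f y) - (x - y)‖ ≤ ρ * ‖x - y‖ := by
  have key : ∀ x y, ‖(x + τ • f x) - (y + τ • f y) - (x - y)‖ ≤ ρ * ‖x - y‖ := by
    intro x y
    have h1 : (x + τ • f x) - (y + τ • f y) - (x - y) = τ • (f x - f y) := by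
      rw [smul_sub]; abel
    have h2 := hf.norm_sub_le x y
    rw [Real.coe_toNNReal _ hK] at h2
    rw [h1, norm_smul, Real.norm_eq_abs]
    calc |τ| * ‖f x - f y‖ ≤ h * (K * ‖x - y‖) := by gcongr; exact (abs_nonneg _).trans hτ
      _ = h * K * ‖x - y‖ := by ring
      _ ≤ _ := by gcongr
  refine ⟨AntilipschitzWith.of_le_mul_dist fun x y => ?_, LipschitzWith.of_dist_le_mul fun x y => ?_, key⟩
  · rw [dist_eq_norm, dist_eq_norm, NNReal.coe_inv, Real.coe_toNNReal _ (by linarith),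
      ← div_eq_inv_mul, le_div_iff₀ (by linarith)]
    have := norm_sub_norm_le (x - y) ((x + τ • f x) - (y + τ • f y))
    rw [norm_sub_rev (x - y) ((x + τ • f x) - (y + τ • f y))] at this
    linarith [key x y]
  · rw [dist_eq_norm, dist_eq_norm, Real.coe_toNNReal _ (by linarith)]
    have := norm_sub_norm_le ((x + τ • f x) - (y + τ • f y)) (x - y)
    nlinarith [key x y]

/-- The map is injective and a.e. differentiable with Jacobian within `h * C + c * (h * K) ^ 2` of
one, so the area formula applies off a null set. The bound on images will serve the implicit half of
a step, the bound on preimages the explicit half. -/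
lemma exists_volume_estimate (d : ℕ) : ∃ c > 0, ∃ ρ > 0, ρ < 1 ∧ ∀ (τ h K C : ℝ) (f : Eu d → Eu d),
    0 ≤ K → LipschitzWith K.toNNReal f → (∀ᵐ x, |tr (fderiv ℝ f x)| ≤ C) → 0 ≤ C →
    |τ| ≤ h → h * K ≤ ρ →
    (∀ A, MeasurableSet A → volume ((fun x => x + τ • f x) '' A) ≤
      ENNReal.ofReal (1 + (h * C + c * (h * K) ^ 2)) * volume A) ∧
    (∀ A, MeasurableSet A → ENNReal.ofReal (1 - (h * C + c * (h * K) ^ 2)) *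
      volume ((fun x => x + τ • f x) ⁻¹' A) ≤ volume A) := by
  obtain ⟨c, hc, ρ₁, hρ₁, hdet⟩ := exists_abs_det_one_add_sub_le d
  have hd1 : ENNReal.ofReal |(1 : Eu d →L[ℝ] Eu d).det| < (2 : ℝ≥0) := by
    simp [ContinuousLinearMap.det]
  -- Maps close to the identity at most double volumes. This crude bound only serves to make the
  -- image of the exceptional null set null.
  obtain ⟨δ, hδ, hδ0⟩ := ((addHaar_image_le_mul_of_det_lt volume (1 : Eu d →L[ℝ] Eu d) hd1).and
    self_mem_nhdsWithin).exists
  have hδ0 : (0 : ℝ) < δ := hδ0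
  refine ⟨c, hc, min (min ρ₁ δ) (1 / 2), by positivity, by
    exact (min_le_right _ _).trans_lt (by norm_num), ?_⟩
  set ρ := min (min ρ₁ (δ : ℝ)) (1 / 2)
  have hρ0 : 0 < ρ := by positivity
  have hρ1 : ρ < 1 := (min_le_right _ _).trans_lt (by norm_num)
  have hρδ : ρ ≤ δ := (min_le_left _ _).trans (min_le_right _ _)
  have hρρ : ρ ≤ ρ₁ := (min_le_left _ _).trans (min_le_left _ _)
  intro τ h K C f hK hf htr hC hτ hhK
  set P : Eu d → Eu d := fun x => x + τ • f x with hP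
  set κ := h * C + c * (h * K) ^ 2 with hκ
  obtain ⟨hanti, hlip, happ⟩ := antilipschitz_add_smul hK hf hτ hhK hρ1 hρ0
  have hh : 0 ≤ h := (abs_nonneg _).trans hτ
  have hgood : ∀ᵐ x, HasFDerivAt P (1 + τ • fderiv ℝ f x) x ∧ |(1 + τ • fderiv ℝ f x).det - 1| ≤ κ := by
    filter_upwards [hf.ae_differentiableAt (μ := volume), htr] with x hx htrx
    refine ⟨(hasFDerivAt_id x).add (hx.hasFDerivAt.const_smul τ), ?_⟩
    have hn : ‖τ • fderiv ℝ f x‖ ≤ h * K := by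
      rw [norm_smul, Real.norm_eq_abs]
      have := norm_fderiv_le_of_lipschitz ℝ hf (x₀ := x)
      rw [Real.coe_toNNReal _ hK] at this
      gcongr
    have h1 := hdet (τ • fderiv ℝ f x) (hn.trans (hhK.trans hρρ))
    have h2 : |tr (τ • fderiv ℝ f x)| ≤ h * C := by
      have : tr (τ • fderiv ℝ f x) = τ * tr (fderiv ℝ f x) := by simp [tr]
      rw [this, abs_mul]
      gcongr
    have h3 : c * ‖τ • fderiv ℝ f x‖ ^ 2 ≤ c * (h * K) ^ 2 := by gcongr
    have h4 := abs_add_le ((1 + τ • fderiv ℝ f x).det - 1 - tr (τ • fderiv ℝ f x)) (tr (τ • fderiv ℝ f x))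
    rw [sub_add_cancel] at h4
    linarith
  obtain ⟨S, hSs, hSm, hS0⟩ := exists_measurable_superset_of_null (ae_iff.1 hgood)
  have hgoodS : ∀ x ∉ S, HasFDerivAt P (1 + τ • fderiv ℝ f x) x ∧ |(1 + τ • fderiv ℝ f x).det - 1| ≤ κ :=
    fun x hx => by_contra fun hcon => hx (hSs hcon)
  have hinj : Function.Injective P := hanti.injective
  have himg : ∀ A, MeasurableSet A → ∫⁻ x in A \ S, ENNReal.ofReal |(1 + τ • fderiv ℝ f x).det| =
      volume (P '' (A \ S)) := fun A hA =>
    lintegral_abs_det_fderiv_eq_addHaar_image volume (hA.diff hSm)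
      (fun x hx => (hgoodS x hx.2).1.hasFDerivWithinAt) hinj.injOn
  have hPS : volume (P '' S) = 0 := by
    have := hδ S P (fun x _ y _ => by
      refine (happ x y).trans ?_
      gcongr)
    rw [hS0, mul_zero] at this
    exact le_antisymm this bot_le
  constructor
  · intro A hA
    calc volume (P '' A) ≤ volume (P '' (A \ S) ∪ P '' S) := by
          refine measure_mono ?_
          rw [← image_union]
          exact image_mono (by rw [sdiff_union_self]; exact subset_union_left)
      _ ≤ volume (P '' (A \ S)) + volume (P '' S) := measure_union_le _ _
      _ = ∫⁻ x in A \ S, ENNReal.ofReal |(1 + τ • fderiv ℝ f x).det| := by rw [hPS, add_zero, himg A hA]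
      _ ≤ ∫⁻ x in A \ S, ENNReal.ofReal (1 + κ) := by
          refine setLIntegral_mono' (hA.diff hSm) fun x hx => ENNReal.ofReal_le_ofReal ?_
          have := abs_le.1 (hgoodS x hx.2).2
          have h1 := abs_sub_abs_le_abs_sub ((1 + τ • fderiv ℝ f x).det) 1
          rw [abs_one] at h1
          linarith [(hgoodS x hx.2).2]
      _ ≤ ENNReal.ofReal (1 + κ) * volume A := by
          rw [setLIntegral_const]
          gcongr
          exact sdiff_subset
  · intro A hA
    have hPm : MeasurableSet (P ⁻¹' A) := hlip.continuous.measurable hA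
    calc ENNReal.ofReal (1 - κ) * volume (P ⁻¹' A) = ENNReal.ofReal (1 - κ) * volume (P ⁻¹' A \ S) := by
          rw [measure_sdiff_null hS0]
      _ = ∫⁻ x in P ⁻¹' A \ S, ENNReal.ofReal (1 - κ) := by rw [setLIntegral_const]
      _ ≤ ∫⁻ x in P ⁻¹' A \ S, ENNReal.ofReal |(1 + τ • fderiv ℝ f x).det| := by
          refine setLIntegral_mono' (hPm.diff hSm) fun x hx => ENNReal.ofReal_le_ofReal ?_
          have := abs_le.1 (hgoodS x hx.2).2
          exact le_trans (by linarith) (le_abs_self _)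
      _ = volume (P '' (P ⁻¹' A \ S)) := himg _ hPm
      _ ≤ volume A := measure_mono (by
          rintro _ ⟨x, hx, rfl⟩
          exact hx.1)

/-- For small `h`, the iterates of an implicit-explicit scheme whose fields have small Lipschitz
constants and bounded divergence are continuous and nearly incompressible. -/
lemma exists_scheme_compressibility (d : ℕ) : ∃ c > 0, ∃ ρ > 0, ∀ (h K C θ : ℝ) (N : ℕ)
    (f : ℕ → Eu d → Eu d) (Y : ℕ → Eu d → Eu d), 0 ≤ K → 0 ≤ C → 0 < h → 0 ≤ θ → θ ≤ 1 →
    (∀ i < N, LipschitzWith K.toNNReal (f i)) → (∀ i < N, ∀ᵐ x, |tr (fderiv ℝ (f i) x)| ≤ C) →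
    h * K ≤ ρ → h * C + c * (h * K) ^ 2 ≤ 1 / 2 → (∀ x, Y 0 x = x) →
    (∀ i < N, ∀ x, Y (i + 1) x - Y i x = h • ((1 - θ) • f i (Y i x) + θ • f i (Y (i + 1) x))) →
    ∀ i ≤ N, Continuous (Y i) ∧ Measure.map (Y i) volume ≤
      ENNReal.ofReal (Real.exp (4 * (h * C + c * (h * K) ^ 2) * i)) • volume := by
  obtain ⟨c, hc, ρ, hρ, hρ1, hest⟩ := exists_volume_estimate d
  refine ⟨c, hc, ρ, hρ, fun h K C θ N f Y hK hC hh hθ0 hθ1 hf htr hhK hκ2 hY0 hY => ?_⟩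
  set κ := h * C + c * (h * K) ^ 2 with hκ
  have hκ0 : 0 ≤ κ := by positivity
  suffices H : ∀ i ≤ N, Continuous (Y i) ∧ ∀ A, MeasurableSet A → volume (Y i ⁻¹' A) ≤
      ENNReal.ofReal (Real.exp (4 * κ * i)) * volume A by
    intro i hi
    refine ⟨(H i hi).1, Measure.le_iff.2 fun A hA => ?_⟩
    rw [Measure.map_apply (H i hi).1.measurable hA]
    exact (H i hi).2 A hA
  intro i
  induction i with
  | zero =>
    intro _
    have : Y 0 = id := funext hY0
    rw [this]
    exact ⟨continuous_id, fun A _ => by simp⟩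
  | succ i ih =>
    intro hi
    obtain ⟨hYc, hYv⟩ := ih (by omega)
    have hiN : i < N := by omega
    -- A step reads `R ∘ Y (i + 1) = P ∘ Y i`, with `P` the explicit and `R` the implicit half.
    -- Hence a preimage under `Y (i + 1)` lies in one under `Y i` of `P ⁻¹' (R '' A)`, and each half
    -- changes volumes by a factor `1 ± κ`.
    set P : Eu d → Eu d := fun x => x + (h * (1 - θ)) • f i x with hP
    set R : Eu d → Eu d := fun x => x + (-(h * θ)) • f i x with hR
    have hτP : |h * (1 - θ)| ≤ h := by
      rw [abs_of_nonneg (mul_nonneg hh.le (by linarith))]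
      nlinarith
    have hτR : |-(h * θ)| ≤ h := by
      rw [abs_neg, abs_of_nonneg (mul_nonneg hh.le hθ0)]
      nlinarith
    have hRP : ∀ x, R (Y (i + 1) x) = P (Y i x) := by
      intro x
      have := hY i hiN x
      rw [sub_eq_iff_eq_add] at this
      simp only [hP, hR]
      rw [neg_smul, ← sub_eq_add_neg, sub_eq_iff_eq_add]
      conv_lhs => rw [this]
      rw [smul_add, smul_smul, smul_smul]
      abel
    obtain ⟨-, hPlip, -⟩ := antilipschitz_add_smul hK (hf i hiN) hτP hhK hρ1 hρ
    obtain ⟨hRanti, hRlip, -⟩ := antilipschitz_add_smul hK (hf i hiN) hτR hhK hρ1 hρ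
    obtain ⟨-, hPv⟩ := hest _ h K C (f i) hK (hf i hiN) (htr i hiN) hC hτP hhK
    obtain ⟨hRv, -⟩ := hest _ h K C (f i) hK (hf i hiN) (htr i hiN) hC hτR hhK
    refine ⟨?_, fun A hA => ?_⟩
    -- `R` is an embedding, so `Y (i + 1)` is continuous because `R ∘ Y (i + 1)` is: regularity of
    -- the iterates follows from the implicit equation.
    · rw [(hRanti.isUniformInducing hRlip.uniformContinuous).isInducing.continuous_iff]
      have : R ∘ Y (i + 1) = P ∘ Y i := funext hRP
      exact this ▸ hPlip.continuous.comp hYc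
    · have hRA : MeasurableSet (R '' A) :=
        hA.image_of_continuousOn_injOn hRlip.continuous.continuousOn hRanti.injective.injOn
      have hPRA : MeasurableSet (P ⁻¹' (R '' A)) := hPlip.continuous.measurable hRA
      have hsub : Y (i + 1) ⁻¹' A ⊆ Y i ⁻¹' (P ⁻¹' (R '' A)) := fun x hx =>
        ⟨Y (i + 1) x, hx, hRP x⟩
      have hone : 0 < 1 - κ := by linarith
      have h1 : volume (P ⁻¹' (R '' A)) ≤ ENNReal.ofReal ((1 - κ)⁻¹) * (ENNReal.ofReal (1 + κ) * volume A) := by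
        have := (hPv _ hRA).trans (hRv A hA)
        calc volume (P ⁻¹' (R '' A)) = ENNReal.ofReal ((1 - κ)⁻¹) *
              (ENNReal.ofReal (1 - κ) * volume (P ⁻¹' (R '' A))) := by
              rw [← mul_assoc, ← ENNReal.ofReal_mul (by positivity), inv_mul_cancel₀ hone.ne']
              simp
          _ ≤ _ := by gcongr
      calc volume (Y (i + 1) ⁻¹' A) ≤ volume (Y i ⁻¹' (P ⁻¹' (R '' A))) := measure_mono hsub
        _ ≤ ENNReal.ofReal (Real.exp (4 * κ * i)) * volume (P ⁻¹' (R '' A)) := hYv _ hPRA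
        _ ≤ ENNReal.ofReal (Real.exp (4 * κ * i)) *
            (ENNReal.ofReal ((1 - κ)⁻¹) * (ENNReal.ofReal (1 + κ) * volume A)) := by gcongr
        _ = ENNReal.ofReal (Real.exp (4 * κ * i) * ((1 - κ)⁻¹ * (1 + κ))) * volume A := by
            rw [ENNReal.ofReal_mul (by positivity), ENNReal.ofReal_mul (by positivity)]
            ring
        _ ≤ _ := by
            gcongr
            -- `(1 + κ) / (1 - κ) ≤ 1 + 4 * κ` holds for `0 ≤ κ ≤ 1/2`; this is the origin of the
            -- `4` in the exponent.
            have : (1 - κ)⁻¹ * (1 + κ) ≤ Real.exp (4 * κ) := by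
              refine le_trans ?_ (Real.add_one_le_exp _)
              rw [inv_mul_le_iff₀ hone]
              nlinarith
            calc Real.exp (4 * κ * i) * ((1 - κ)⁻¹ * (1 + κ)) ≤ Real.exp (4 * κ * i) * Real.exp (4 * κ) := by gcongr
              _ = _ := by rw [← Real.exp_add]; push_cast; ring_nf

/-! ### Everywhere regular versions of the approximating fields and the integrated scheme -/

/-- Spatial mollifications depend only on the a.e. class of each slice, so they can be computed from
the jointly measurable `c'`; they converge at every point because the slices of `c` are continuous.
-/
lemma measurable_of_continuous_version {d : ℕ} {c c' : ℝ → Eu d → Eu d} {M : Set ℝ}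
    (hM : MeasurableSet M) (hc' : StronglyMeasurable (Function.uncurry c'))
    (hcont : ∀ t, Continuous (c t)) (h0 : ∀ t ∈ M, c t = 0)
    (hae : ∀ t ∉ M, c' t =ᵐ[volume] c t) : Measurable (Function.uncurry c) := by
  let β : ℕ → ContDiffBump (0 : Eu d) := fun n =>
    ⟨1 / (n + 1), 2 / (n + 1), by positivity, by gcongr; norm_num⟩
  have hβ : Filter.Tendsto (fun n => (β n).rOut) Filter.atTop (𝓝 0) := by
    have : (fun n => (β n).rOut) = fun n : ℕ => 2 * (1 / ((n : ℝ) + 1)) := by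
      ext n; simp only [β]; ring
    rw [this]
    simpa using tendsto_one_div_add_atTop_nhds_zero_nat.const_mul (2 : ℝ)
  let F : ℕ → ℝ × Eu d → Eu d := fun n z => (Mᶜ).indicator (fun t => ∫ y, (β n).normed volume (z.2 - y) • c' t y) z.1
  refine measurable_of_tendsto_metrizable (f := F) (fun n => ?_) (tendsto_pi_nhds.2 fun z => ?_)
  · have h1 : StronglyMeasurable fun w : (ℝ × Eu d) × Eu d =>
        (β n).normed volume (w.1.2 - w.2) • c' w.1.1 w.2 := by
      have ha : StronglyMeasurable fun w : (ℝ × Eu d) × Eu d => (β n).normed volume (w.1.2 - w.2) :=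
        ((β n).continuous_normed.comp
          (by fun_prop : Continuous fun w : (ℝ × Eu d) × Eu d => w.1.2 - w.2)).stronglyMeasurable
      have hb : StronglyMeasurable fun w : (ℝ × Eu d) × Eu d => c' w.1.1 w.2 :=
        hc'.comp_measurable (by fun_prop : Measurable fun w : (ℝ × Eu d) × Eu d => (w.1.1, w.2))
      exact ha.smul hb
    have h2 := (h1.integral_prod_right' (ν := (volume : Measure (Eu d)))).measurable
    have h3 : Measurable ((Prod.fst ⁻¹' Mᶜ : Set (ℝ × Eu d)).indicator
      fun z => ∫ y, (β n).normed volume (z.2 - y) • c' z.1 y) := h2.indicator (measurable_fst hM.compl)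
    exact h3
  · obtain ⟨t, x⟩ := z
    by_cases ht : t ∈ M
    · have : ∀ n, F n (t, x) = 0 := fun n => by simp [F, ht]
      simp_rw [this]
      simp only [Function.uncurry_apply_pair, h0 t ht]
      exact tendsto_const_nhds
    · have : ∀ n, F n (t, x) = convolution ((β n).normed volume) (c t) (ContinuousLinearMap.lsmul ℝ ℝ) volume x := by
        intro n
        simp only [F]
        rw [indicator_of_mem (by exact ht), convolution_lsmul_swap]
        refine integral_congr_ae ?_
        filter_upwards [hae t ht] with y hy
        rw [hy]
      simp_rw [this]
      exact ContDiffBump.convolution_tendsto_right_of_continuous hβ (hcont t) x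

/-- The scheme evaluates the field at points, so a version may not be altered on null sets of `x`.
Only a null set of times is changed, where the field becomes `0`; hence the requirement `P 0`. -/
lemma exists_regular_version {d : ℕ} {T : ℝ} {f : ℝ → Eu d → Eu d}
    (hf : AEStronglyMeasurable (Function.uncurry f) (slab d T)) {P : (Eu d → Eu d) → Prop}
    (hP0 : P 0) (hPc : ∀ g, P g → Continuous g)
    (hP : ∀ᵐ t ∂(volume.restrict (Ioo (0 : ℝ) T)), P (f t)) :
    ∃ c : ℝ → Eu d → Eu d, Measurable (Function.uncurry c) ∧ (∀ t, P (c t)) ∧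
      ∀ᵐ t ∂(volume.restrict (Ioo (0 : ℝ) T)), c t = f t := by
  classical
  have h1 : ∀ᵐ t ∂(volume.restrict (Ioo (0 : ℝ) T)), P (f t) ∧
      (fun x => hf.mk _ (t, x)) =ᵐ[volume] f t := by
    filter_upwards [hP, Measure.ae_ae_of_ae_prod hf.ae_eq_mk] with t ht h
    refine ⟨ht, ?_⟩
    filter_upwards [h] with x hx using hx.symm
  obtain ⟨M, hMs, hMm, hM0⟩ := exists_measurable_superset_of_null (ae_iff.1 h1)
  have hgood : ∀ t ∉ M, P (f t) ∧ (fun x => hf.mk _ (t, x)) =ᵐ[volume] f t :=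
    fun t ht => by_contra fun hcon => ht (hMs hcon)
  refine ⟨fun t => if t ∈ M then 0 else f t, ?_, fun t => ?_, ?_⟩
  · refine measurable_of_continuous_version (c' := fun t x => hf.mk _ (t, x)) hMm
      hf.stronglyMeasurable_mk (fun t => ?_) (fun t ht => if_pos ht) (fun t ht => ?_)
    · split_ifs with ht
      · exact continuous_const
      · exact hPc _ (hgood t ht).1
    · rw [if_neg ht]
      exact (hgood t ht).2
  · dsimp only
    split_ifs with ht
    · exact hP0
    · exact (hgood t ht).1
  · filter_upwards [measure_eq_zero_iff_ae_notMem.1 hM0] with t ht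
    exact if_neg ht

/-- A jointly measurable bounded field, Lipschitz in space and with bounded divergence. -/
structure IsRegularField {d : ℕ} (c : ℝ → Eu d → Eu d) (K C B : ℝ) : Prop where
  measurable : Measurable (Function.uncurry c)
  lipschitz : ∀ t, LipschitzWith K.toNNReal (c t)
  bound : ∀ t x, ‖c t x‖ ≤ B
  div_le : ∀ t, ∀ φ : Eu d → ℝ, ContDiff ℝ ∞ φ → HasCompactSupport φ →
    |∫ x, fderiv ℝ φ x (c t x)| ≤ C * ∫ x, |φ x|

lemma IsApproximatingSequence.exists_isRegularField {d : ℕ} {T : ℝ} {b : ℝ → Eu d → Eu d}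
    {bε : ℝ → ℝ → Eu d → Eu d} {C₀ C₁ C₂ C₃ α β : ℝ}
    (H : IsApproximatingSequence T b bε C₀ C₁ C₂ C₃ α β) (hC₁ : 0 ≤ C₁) (hC₂ : 0 ≤ C₂) (hC₃ : 0 ≤ C₃)
    {ε : ℝ} (hε : 0 < ε) :
    ∃ c : ℝ → Eu d → Eu d, IsRegularField c (C₁ / ε ^ β) C₂ C₃ ∧
      ∀ᵐ t ∂(volume.restrict (Ioo (0 : ℝ) T)), c t = bε ε t := by
  have hK : 0 ≤ C₁ / ε ^ β := by positivity
  obtain ⟨c, hcm, hcP, hcae⟩ := exists_regular_version (H.aestronglyMeasurable ε hε)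
    (P := fun g => LipschitzWith (C₁ / ε ^ β).toNNReal g ∧ (∀ x, ‖g x‖ ≤ C₃) ∧
      ∀ φ : Eu d → ℝ, ContDiff ℝ ∞ φ → HasCompactSupport φ →
        |∫ x, fderiv ℝ φ x (g x)| ≤ C₂ * ∫ x, |φ x|)
    ⟨LipschitzWith.const' 0, fun x => by simpa using hC₃, fun φ _ _ => by
      simp only [Pi.zero_apply, map_zero, integral_zero, abs_zero]
      exact mul_nonneg hC₂ (integral_nonneg fun x => abs_nonneg _)⟩
    (fun g hg => hg.1.continuous) (by
      filter_upwards [H.continuous ε hε, H.grad_div_le ε hε, H.bound ε hε] with t h1 h2 h3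
      obtain ⟨G, hG, hGn, hGt⟩ := h2
      refine ⟨hG.lipschitzWith h1 hK hGn, ?_, fun φ hφ hφc => hG.abs_integral_fderiv_le hGt hφ hφc⟩
      have hcl : IsClosed {x | ‖bε ε t x‖ ≤ C₃} := isClosed_le h1.norm continuous_const
      have hd : Dense {x | ‖bε ε t x‖ ≤ C₃} := Measure.dense_of_ae h3
      intro x
      have := hcl.closure_eq ▸ hd x
      exact this)
  exact ⟨c, ⟨hcm, fun t => (hcP t).1, fun t => (hcP t).2.1, fun t => (hcP t).2.2⟩, hcae⟩

/-! ### Time averages of regular fields. -/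

namespace IsRegularField

variable {d : ℕ} {c : ℝ → Eu d → Eu d} {K C B : ℝ}

lemma intervalIntegrable (hc : IsRegularField c K C B) (x : Eu d) (a b : ℝ) :
    IntervalIntegrable (fun s => c s x) volume a b := by
  have : IsFiniteMeasure (volume.restrict (uIoc a b)) := ⟨by simp [uIoc]⟩
  refine intervalIntegrable_iff.2 (Integrable.of_bound (C := B) ?_ (ae_of_all _ fun s => hc.bound s x))
  exact (hc.measurable.comp (by fun_prop : Measurable fun s : ℝ => (s, x))).aestronglyMeasurable

lemma lipschitzWith_average (hc : IsRegularField c K C B) {a b : ℝ} (hab : a < b) :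
    LipschitzWith K.toNNReal fun x => ⨍ s in a..b, c s x := by
  refine LipschitzWith.of_dist_le_mul fun x y => ?_
  rw [dist_eq_norm, interval_average_eq, interval_average_eq, ← smul_sub,
    ← intervalIntegral.integral_sub (hc.intervalIntegrable x a b) (hc.intervalIntegrable y a b),
    norm_smul, norm_inv, Real.norm_of_nonneg (by linarith : 0 ≤ b - a),
    inv_mul_le_iff₀ (by linarith)]
  have := intervalIntegral.norm_integral_le_of_norm_le_const (a := a) (b := b)
    (f := fun s => c s x - c s y) (C := K.toNNReal * dist x y) (fun s _ => by
      rw [← dist_eq_norm]; exact (hc.lipschitz s).dist_le_mul x y)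
  rw [abs_of_pos (by linarith : 0 < b - a)] at this
  linarith

lemma ae_abs_tr_fderiv_average_le (hc : IsRegularField c K C B) {a b : ℝ}
    (hab : a < b) : ∀ᵐ x, |tr (fderiv ℝ (fun x => ⨍ s in a..b, c s x) x)| ≤ C := by
  refine (hc.lipschitzWith_average hab).ae_abs_tr_fderiv_le fun φ hφ hφc => ?_
  have hba : 0 < b - a := by linarith
  have hDc : Continuous (fderiv ℝ φ) := hφ.continuous_fderiv (by simp)
  have hDi : Integrable (fun x => B * ‖fderiv ℝ φ x‖) volume :=
    (hDc.integrable_of_hasCompactSupport (hφc.fderiv (𝕜 := ℝ))).norm.const_mul B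
  have hint : Integrable (Function.uncurry fun (s : ℝ) (x : Eu d) => fderiv ℝ φ x (c s x))
      ((volume.restrict (Ioc a b)).prod volume) := by
    refine Integrable.mono' (g := fun z : ℝ × Eu d => B * ‖fderiv ℝ φ z.2‖) (hDi.comp_snd _) ?_
      (ae_of_all _ fun z => ?_)
    · have h1 : Continuous fun w : Eu d × Eu d => fderiv ℝ φ w.1 w.2 :=
        (hDc.comp continuous_fst).clm_apply continuous_snd
      exact (h1.measurable.comp (measurable_snd.prodMk hc.measurable)).aestronglyMeasurable
    · refine (ContinuousLinearMap.le_opNorm _ _).trans ?_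
      rw [mul_comm]
      exact mul_le_mul_of_nonneg_right (hc.bound z.1 z.2) (norm_nonneg _)
  have e : ∫ x, fderiv ℝ φ x (⨍ s in a..b, c s x) =
      (b - a)⁻¹ * ∫ s in Ioc a b, ∫ x, fderiv ℝ φ x (c s x) := by
    rw [integral_integral_swap hint, ← integral_const_mul]
    congr 1; ext1 x
    rw [interval_average_eq, map_smul, smul_eq_mul, intervalIntegral.integral_of_le hab.le,
      ContinuousLinearMap.integral_comp_comm]
    exact (intervalIntegrable_iff_integrableOn_Ioc_of_le hab.le).1 (hc.intervalIntegrable x a b)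
  rw [e, abs_mul, abs_of_pos (inv_pos.2 hba), inv_mul_le_iff₀ hba, ← Real.norm_eq_abs]
  refine (norm_setIntegral_le_of_norm_le_const (C := C * ∫ x, |φ x|) (by simp) (fun s _ => ?_)).trans ?_
  · exact hc.div_le s φ hφ hφc
  · simp [Measure.real, hba.le, mul_comm]

end IsRegularField

/-- The `θ`-method in integrated form. -/
structure IsIntegralIteration {d : ℕ} (h θ : ℝ) (N : ℕ) (c : ℝ → Eu d → Eu d)
    (Y : ℕ → Eu d → Eu d) : Prop where
  zero : ∀ x, Y 0 x = x
  step : ∀ i < N, ∀ x, Y (i + 1) x - Y i x =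
    ∫ s in Ioc (i * h) ((i + 1) * h), ((1 - θ) • c s (Y i x) + θ • c s (Y (i + 1) x))

lemma IsRegularField.setIntegral_eq_average {d : ℕ} {c : ℝ → Eu d → Eu d} {K C B : ℝ}
    (hc : IsRegularField c K C B) {h : ℝ} (hh : 0 < h) (θ : ℝ) (i : ℕ) (x y : Eu d) :
    ∫ s in Ioc (i * h) ((i + 1) * h), ((1 - θ) • c s x + θ • c s y) =
      h • ((1 - θ) • (⨍ s in (i * h)..((i + 1) * h), c s x) +
        θ • (⨍ s in (i * h)..((i + 1) * h), c s y)) := by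
  have hle : i * h ≤ (i + 1) * h := by nlinarith
  have e : (i + 1) * h - i * h = h := by ring
  have i1 : IntervalIntegrable (fun s => (1 - θ) • c s x) volume (i * h) ((i + 1) * h) :=
    (hc.intervalIntegrable x _ _).smul (1 - θ)
  have i2 : IntervalIntegrable (fun s => θ • c s y) volume (i * h) ((i + 1) * h) :=
    (hc.intervalIntegrable y _ _).smul θ
  rw [← intervalIntegral.integral_of_le hle, intervalIntegral.integral_add i1 i2,
    intervalIntegral.integral_smul, intervalIntegral.integral_smul, interval_average_eq,
    interval_average_eq, e, smul_add, smul_comm h (1 - θ), smul_comm h θ, smul_inv_smul₀ hh.ne',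
    smul_inv_smul₀ hh.ne']

lemma Ioc_subset_Ioc_of_lt {T h : ℝ} {N i : ℕ} (hh : 0 < h) (hN : N * h = T) (hi : i < N) :
    Ioc (i * h) ((i + 1) * h) ⊆ Ioc 0 T := by
  refine Ioc_subset_Ioc (by positivity) ?_
  rw [← hN]
  have : ((i : ℝ) + 1) ≤ N := by exact_mod_cast hi
  gcongr

lemma IsThetaIteration.isIntegralIteration {d : ℕ} {T h θ : ℝ} {N : ℕ} {b c : ℝ → Eu d → Eu d}
    {K C B : ℝ} {Y : ℕ → Eu d → Eu d} (hY : IsThetaIteration h θ N b Y) (hh : 0 < h) (hN : N * h = T)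
    (hc : IsRegularField c K C B) (hcb : ∀ᵐ t ∂(volume.restrict (Ioo (0 : ℝ) T)), c t = b t) :
    IsIntegralIteration h θ N c Y := by
  refine ⟨hY.1, fun i hi x => ?_⟩
  have hle : i * h ≤ (i + 1) * h := by nlinarith
  rw [restrict_Ioo_eq_restrict_Ioc] at hcb
  have hcb' := ae_restrict_of_ae_restrict_of_subset (Ioc_subset_Ioc_of_lt hh hN hi) hcb
  have hav : ∀ y, ⨍ s in (i * h)..((i + 1) * h), c s y = ⨍ s in (i * h)..((i + 1) * h), b s y := by
    intro y
    rw [interval_average_eq, interval_average_eq, intervalIntegral.integral_of_le hle,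
      intervalIntegral.integral_of_le hle]
    congr 1
    refine integral_congr_ae ?_
    filter_upwards [hcb'] with s hs
    rw [hs]
  rw [hc.setIntegral_eq_average hh, hav, hav, ← hY.2 i hi x, smul_inv_smul₀ hh.ne']

/-- Uniform compressibility of the iterates for small time steps. -/
lemma exists_iterates_compressibility (d : ℕ) (T C₁ C₂ : ℝ) (hC₁ : 0 < C₁) (hC₂ : 0 < C₂) :
    ∃ L : ℝ, 1 ≤ L ∧ ∃ h₁ > 0, ∀ (h θ B : ℝ) (N : ℕ) (c : ℝ → Eu d → Eu d) (Y : ℕ → Eu d → Eu d),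
      0 < h → h ≤ h₁ → N * h = T → 0 ≤ θ → θ ≤ 1 → IsRegularField c (C₁ / √h) C₂ B →
      IsIntegralIteration h θ N c Y →
      ∀ i ≤ N, Continuous (Y i) ∧ Measure.map (Y i) volume ≤ ENNReal.ofReal L • volume := by
  obtain ⟨a, ha, ρ, hρ, H⟩ := exists_scheme_compressibility d
  -- With Lipschitz constant `C₁ / √h`, the defect per step is exactly `h * (C₂ + a * C₁ ^ 2)`, so
  -- at most `N = T / h` steps give an exponent independent of `h`. The threshold ensures `h * K ≤
  -- ρ` and a defect of at most `1 / 2`.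
  refine ⟨Real.exp (4 * (C₂ + a * C₁ ^ 2) * |T|), Real.one_le_exp (by positivity),
    min ((ρ / C₁) ^ 2) (1 / (2 * (C₂ + a * C₁ ^ 2))), by positivity, ?_⟩
  intro h θ B N c Y hh hh1 hN hθ0 hθ1 hc hY i hi
  have hs : 0 < √h := Real.sqrt_pos.2 hh
  have hK : 0 ≤ C₁ / √h := by positivity
  have e1 : h * (C₁ / √h) = C₁ * √h := by
    have := Real.mul_self_sqrt hh.le
    field_simp
    nlinarith
  have e2 : (C₁ * √h) ^ 2 = C₁ ^ 2 * h := by rw [mul_pow, Real.sq_sqrt hh.le]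
  have e3 : h * C₂ + a * (h * (C₁ / √h)) ^ 2 = h * (C₂ + a * C₁ ^ 2) := by rw [e1, e2]; ring
  have hab : ∀ i : ℕ, i * h < (i + 1) * h := fun i => by nlinarith
  obtain ⟨h1, h2⟩ := H h (C₁ / √h) C₂ θ N (fun i x => ⨍ s in (i * h)..((i + 1) * h), c s x) Y hK
    hC₂.le hh hθ0 hθ1 (fun i _ => hc.lipschitzWith_average (hab i))
    (fun i _ => hc.ae_abs_tr_fderiv_average_le (hab i))
    (by
      rw [e1, ← le_div_iff₀' hC₁]
      exact Real.sqrt_le_left (by positivity) |>.2 (hh1.trans (min_le_left _ _)))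
    (by
      rw [e3]
      have := hh1.trans (min_le_right _ _)
      rw [le_div_iff₀ (by positivity)] at this
      linarith)
    hY.zero
    (fun i hi x => by rw [hY.step i hi x, hc.setIntegral_eq_average hh]) i hi
  refine ⟨h1, h2.trans (Measure.le_iff.2 fun A _ => ?_)⟩
  rw [e3, Measure.smul_apply, Measure.smul_apply, smul_eq_mul, smul_eq_mul]
  have hNi : (i : ℝ) * h ≤ |T| := by
    refine le_trans ?_ (le_abs_self T)
    rw [← hN]
    have : (i : ℝ) ≤ N := by exact_mod_cast hi
    gcongr
  have : 4 * (h * (C₂ + a * C₁ ^ 2)) * i ≤ 4 * (C₂ + a * C₁ ^ 2) * |T| := by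
    calc 4 * (h * (C₂ + a * C₁ ^ 2)) * i = 4 * (C₂ + a * C₁ ^ 2) * (i * h) := by ring
      _ ≤ _ := by gcongr
  gcongr

/-! ### Trajectories as integrals of a bounded velocity -/

/-- The position at time `t` of the trajectory from `x` with velocity `v · x`. -/
def trajectory {d : ℕ} (v : ℝ → Eu d → Eu d) (t : ℝ) (x : Eu d) : Eu d :=
  x + ∫ s in Ioc 0 t, v s x

section Trajectory

variable {d : ℕ} {v : ℝ → Eu d → Eu d} {B : ℝ}

lemma integrableOn_of_measurable_of_bound (hv : Measurable (Function.uncurry v))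
    (hB : ∀ t x, ‖v t x‖ ≤ B) (x : Eu d) (a b : ℝ) : IntegrableOn (fun s => v s x) (Ioc a b) volume := by
  refine Integrable.of_bound (C := B) ?_ (ae_of_all _ fun s => hB s x)
  exact (hv.comp (by fun_prop : Measurable fun s : ℝ => (s, x))).aestronglyMeasurable

lemma measurable_trajectory (hv : Measurable (Function.uncurry v)) :
    Measurable (Function.uncurry (trajectory v)) := by
  have hset : MeasurableSet {w : (ℝ × Eu d) × ℝ | w.2 ∈ Ioc 0 w.1.1} :=
    (measurableSet_lt measurable_const measurable_snd).inter
      (measurableSet_le measurable_snd (by fun_prop))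
  have h1 : StronglyMeasurable fun w : (ℝ × Eu d) × ℝ =>
      ({w : (ℝ × Eu d) × ℝ | w.2 ∈ Ioc 0 w.1.1}).indicator (fun w => v w.2 w.1.2) w :=
    ((hv.comp (by fun_prop : Measurable fun w : (ℝ × Eu d) × ℝ => (w.2, w.1.2))).indicator
      hset).stronglyMeasurable
  have h2 := (h1.integral_prod_right' (ν := (volume : Measure ℝ))).measurable
  have heq : Function.uncurry (trajectory v) = fun z : ℝ × Eu d => z.2 + ∫ s,
      ({w : (ℝ × Eu d) × ℝ | w.2 ∈ Ioc 0 w.1.1}).indicator (fun w => v w.2 w.1.2) (z, s) := by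
    ext1 z
    simp only [Function.uncurry, trajectory]
    rw [← integral_indicator measurableSet_Ioc]
    rfl
  rw [heq]
  exact measurable_snd.add h2

lemma trajectory_sub (hv : Measurable (Function.uncurry v)) (hB : ∀ t x, ‖v t x‖ ≤ B) {s t : ℝ}
    (hs : 0 ≤ s) (hst : s ≤ t) (x : Eu d) :
    trajectory v t x - trajectory v s x = ∫ r in Ioc s t, v r x := by
  have h1 : Ioc 0 t = Ioc 0 s ∪ Ioc s t := (Ioc_union_Ioc_eq_Ioc hs hst).symm
  rw [trajectory, trajectory, h1, setIntegral_union (by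
    rw [Set.disjoint_left]; intro r h h'; exact absurd h.2 (not_le.2 h'.1)) measurableSet_Ioc
    (integrableOn_of_measurable_of_bound hv hB x _ _) (integrableOn_of_measurable_of_bound hv hB x _ _)]
  abel

lemma norm_trajectory_sub_le (hv : Measurable (Function.uncurry v)) (hB : ∀ t x, ‖v t x‖ ≤ B)
    {s t : ℝ} (hs : 0 ≤ s) (hst : s ≤ t) (x : Eu d) :
    ‖trajectory v t x - trajectory v s x‖ ≤ B * (t - s) := by
  rw [trajectory_sub hv hB hs hst]
  refine (norm_setIntegral_le_of_norm_le_const (by simp) (fun r _ => hB r x)).trans ?_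
  rw [Measure.real, Real.volume_Ioc, ENNReal.toReal_ofReal (by linarith)]

lemma continuousOn_trajectory (hv : Measurable (Function.uncurry v)) (hB : ∀ t x, ‖v t x‖ ≤ B)
    (x : Eu d) : ContinuousOn (fun t => trajectory v t x) (Ici 0) := by
  have hB0 : 0 ≤ B := (norm_nonneg _).trans (hB 0 x)
  refine (LipschitzOnWith.of_dist_le_mul (K := B.toNNReal) fun s hs t ht => ?_).continuousOn
  rw [Real.coe_toNNReal _ hB0, dist_eq_norm, Real.dist_eq]
  rcases le_total s t with h | h
  · rw [norm_sub_rev, abs_sub_comm, abs_of_nonneg (by linarith)]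
    exact norm_trajectory_sub_le hv hB hs h x
  · rw [abs_of_nonneg (by linarith)]
    exact norm_trajectory_sub_le hv hB ht h x

end Trajectory

/-! ### From the weak formulation to trajectories -/

/-- The weak formulation of `∂_t X = v`, `X(0) = id`, with measurable `X` and `v`. -/
def IsWeakTrajectory {d : ℕ} (T : ℝ) (X v : ℝ → Eu d → Eu d) : Prop :=
  ∀ ψ : ℝ → ℝ, ContDiff ℝ ∞ ψ → HasCompactSupport ψ → tsupport ψ ⊆ Iio T →
    ∀ χ : Eu d → ℝ, ContDiff ℝ ∞ χ → HasCompactSupport χ →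
    Integrable (fun z : ℝ × Eu d => (deriv ψ z.1 * χ z.2) • X z.1 z.2) (slab d T) ∧
    (∫ z, ((deriv ψ z.1 * χ z.2) • X z.1 z.2 + (ψ z.1 * χ z.2) • v z.1 z.2) ∂(slab d T))
      + ∫ x, (ψ 0 * χ x) • x = 0

lemma integrable_mul_smul_slab {d : ℕ} {T B : ℝ} {v : ℝ → Eu d → Eu d}
    (hv : Measurable (Function.uncurry v)) (hB : ∀ t x, ‖v t x‖ ≤ B) {ψ : ℝ → ℝ}
    (hψ : Continuous ψ) (hψc : HasCompactSupport ψ) {χ : Eu d → ℝ}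
    (hχ : Continuous χ) (hχc : HasCompactSupport χ) :
    Integrable (fun z : ℝ × Eu d => (ψ z.1 * χ z.2) • v z.1 z.2) (slab d T) := by
  have h1 : Integrable (fun z : ℝ × Eu d => ψ z.1 * χ z.2) (slab d T) :=
    Integrable.mul_prod ((hψ.integrable_of_hasCompactSupport hψc).mono_measure Measure.restrict_le_self)
      (hχ.integrable_of_hasCompactSupport hχc)
  refine (h1.norm.const_mul B).mono' (h1.aestronglyMeasurable.smul hv.aestronglyMeasurable)
    (ae_of_all _ fun z => ?_)
  rw [norm_smul, mul_comm]
  exact mul_le_mul_of_nonneg_right (hB _ _) (norm_nonneg _)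

/-- The spatial factor of a product test function is arbitrary, so the weak formulation localises to
a.e. `x`, with a null set that depends on `ψ`. -/
lemma IsWeakTrajectory.ae_integral_eq_zero {d : ℕ} {T B : ℝ} {X v : ℝ → Eu d → Eu d}
    (H : IsWeakTrajectory T X v) (hv : Measurable (Function.uncurry v)) (hB : ∀ t x, ‖v t x‖ ≤ B)
    {ψ : ℝ → ℝ} (hψ : ContDiff ℝ ∞ ψ) (hψc : HasCompactSupport ψ) (hψT : tsupport ψ ⊆ Iio T) :
    ∀ᵐ x, (∫ t in Ioo 0 T, (deriv ψ t • X t x + ψ t • v t x)) + ψ 0 • x = 0 := by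
  have hint : ∀ χ : Eu d → ℝ, ContDiff ℝ ∞ χ → HasCompactSupport χ →
      Integrable (fun z : ℝ × Eu d => χ z.2 • (deriv ψ z.1 • X z.1 z.2 + ψ z.1 • v z.1 z.2)) (slab d T) := by
    intro χ hχ hχc
    have h1 := (H ψ hψ hψc hψT χ hχ hχc).1.add
      (integrable_mul_smul_slab (T := T) hv hB hψ.continuous hψc hχ.continuous hχc)
    refine h1.congr (ae_of_all _ fun z => ?_)
    simp only [Pi.add_apply, smul_add, smul_smul, mul_comm]
  have hint2 : ∀ χ : Eu d → ℝ, ContDiff ℝ ∞ χ → HasCompactSupport χ →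
      Integrable (fun x => χ x • ∫ t in Ioo 0 T, (deriv ψ t • X t x + ψ t • v t x)) volume := by
    intro χ hχ hχc
    have h2 := (hint χ hχ hχc).integral_prod_right
    refine h2.congr (ae_of_all _ fun x => ?_)
    simp only [integral_smul]
  have hloc1 : LocallyIntegrable (fun x => ∫ t in Ioo 0 T, (deriv ψ t • X t x + ψ t • v t x)) volume := by
    intro x₀
    let β : ContDiffBump x₀ := ⟨1, 2, one_pos, one_lt_two⟩
    refine ⟨Metric.closedBall x₀ 1, Metric.closedBall_mem_nhds _ one_pos, ?_⟩
    refine ((hint2 β β.contDiff β.hasCompactSupport).integrableOn (s := Metric.closedBall x₀ 1)).congr_fun ?_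
      Metric.isClosed_closedBall.measurableSet
    intro x hx
    simp [β.one_of_mem_closedBall hx]
  have hloc2 : LocallyIntegrable (fun x : Eu d => ψ 0 • x) volume :=
    (continuous_const_smul (ψ 0)).locallyIntegrable
  refine ae_eq_zero_of_integral_contDiff_smul_eq_zero (hloc1.add hloc2) fun χ hχ hχc => ?_
  have h := (H ψ hψ hψc hψT χ hχ hχc).2
  have i2 : Integrable (fun x => χ x • ψ 0 • x) volume :=
    hloc2.integrable_smul_left_of_hasCompactSupport hχ.continuous hχc
  simp only [smul_add]
  rw [integral_add (hint2 χ hχ hχc) i2, ← h]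
  congr 1
  · have h3 := integral_prod_symm _ (hint χ hχ hχc)
    simp only [integral_smul] at h3
    rw [← h3]
    refine integral_congr_ae (ae_of_all _ fun z => ?_)
    simp only [smul_add, smul_smul, mul_comm]
  · simp only [smul_smul, mul_comm]

/-- Integration by parts, carried out as Fubini on the triangle `s ≤ t`. The boundary term at `T`
vanishes by the support of `ψ`; the one at `0` remains. -/
lemma integral_deriv_smul_trajectory {d : ℕ} {T B : ℝ} (hT : 0 < T) {v : ℝ → Eu d → Eu d}
    (hv : Measurable (Function.uncurry v)) (hB : ∀ t x, ‖v t x‖ ≤ B)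
    {ψ : ℝ → ℝ} (hψ : ContDiff ℝ ∞ ψ) (hψT : tsupport ψ ⊆ Iio T) (x : Eu d) :
    ∫ t in Ioo 0 T, deriv ψ t • trajectory v t x = - (∫ t in Ioo 0 T, ψ t • v t x) - ψ 0 • x := by
  have hψ' : Continuous (deriv ψ) := hψ.continuous_deriv (by simp)
  have hψT0 : ψ T = 0 := image_eq_zero_of_notMem_tsupport fun h => lt_irrefl T (mem_Iio.1 (hψT h))
  have hftc : ∀ s ∈ Ico 0 T, ∫ t in Ioo s T, deriv ψ t = - ψ s := by
    intro s hs
    rw [← integral_Ioc_eq_integral_Ioo, ← intervalIntegral.integral_of_le hs.2.le,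
      intervalIntegral.integral_deriv_eq_sub (fun t _ => hψ.differentiable (by simp) t)
        (hψ'.intervalIntegrable _ _), hψT0, zero_sub]
  obtain ⟨D, hD⟩ := (isCompact_Icc (a := (0 : ℝ)) (b := T)).exists_bound_of_continuousOn hψ'.continuousOn
  have hvx : Measurable fun s => v s x := hv.comp (by fun_prop : Measurable fun s : ℝ => (s, x))
  set μ := (volume : Measure ℝ).restrict (Ioo 0 T) with hμ
  set F : ℝ → ℝ → Eu d := fun t s => ({z : ℝ × ℝ | z.2 ≤ z.1}).indicator (fun z => deriv ψ z.1 • v z.2 x) (t, s) with hF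
  have hset : MeasurableSet {z : ℝ × ℝ | z.2 ≤ z.1} := measurableSet_le measurable_snd measurable_fst
  have hmem : ∀ᵐ z : ℝ × ℝ ∂(μ.prod μ), z.1 ∈ Ioo 0 T :=
    Measure.quasiMeasurePreserving_fst.ae (ae_restrict_mem measurableSet_Ioo)
  have hFi : Integrable (Function.uncurry F) (μ.prod μ) := by
    refine Integrable.of_bound (C := D * B) ?_ ?_
    · have : Measurable fun z : ℝ × ℝ => deriv ψ z.1 • v z.2 x :=
        (hψ'.measurable.comp measurable_fst).smul (hvx.comp measurable_snd)
      exact (this.indicator hset).aestronglyMeasurable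
    · filter_upwards [hmem] with z hz
      have h0 : ‖Function.uncurry F z‖ ≤ ‖deriv ψ z.1 • v z.2 x‖ :=
        norm_indicator_le_norm_self (fun z : ℝ × ℝ => deriv ψ z.1 • v z.2 x) z
      refine h0.trans ?_
      rw [norm_smul]
      have h1 := hD z.1 ⟨hz.1.le, hz.2.le⟩
      exact mul_le_mul h1 (hB _ _) (norm_nonneg _) ((norm_nonneg _).trans h1)
  have e1 : ∀ t ∈ Ioo 0 T, ∫ s, F t s ∂μ = deriv ψ t • ∫ s in Ioc 0 t, v s x := by
    intro t ht
    have : ∀ s, F t s = (Iic t).indicator (fun s => deriv ψ t • v s x) s := fun s => by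
      by_cases h : s ≤ t
      · rw [indicator_of_mem (show s ∈ Iic t from h)]
        exact indicator_of_mem (show (t, s) ∈ {z : ℝ × ℝ | z.2 ≤ z.1} from h) _
      · rw [indicator_of_notMem (show s ∉ Iic t from h)]
        exact indicator_of_notMem (show (t, s) ∉ {z : ℝ × ℝ | z.2 ≤ z.1} from h) _
    simp_rw [this]
    rw [integral_indicator measurableSet_Iic, hμ, Measure.restrict_restrict measurableSet_Iic,
      integral_smul]
    congr 3
    ext s
    simp only [mem_inter_iff, mem_Iic, mem_Ioo, mem_Ioc]
    constructor
    · rintro ⟨h1, h2, -⟩; exact ⟨h2, h1⟩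
    · rintro ⟨h1, h2⟩; exact ⟨h2, h1, h2.trans_lt ht.2⟩
  have e2 : ∀ s ∈ Ioo 0 T, ∫ t, F t s ∂μ = - (ψ s • v s x) := by
    intro s hs
    have : ∀ t, F t s = (Ici s).indicator (fun t => deriv ψ t • v s x) t := fun t => by
      by_cases h : s ≤ t
      · rw [indicator_of_mem (show t ∈ Ici s from h)]
        exact indicator_of_mem (show (t, s) ∈ {z : ℝ × ℝ | z.2 ≤ z.1} from h) _
      · rw [indicator_of_notMem (show t ∉ Ici s from h)]
        exact indicator_of_notMem (show (t, s) ∉ {z : ℝ × ℝ | z.2 ≤ z.1} from h) _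
    simp_rw [this]
    have hset2 : Ici s ∩ Ioo 0 T = Ico s T := by
      ext t
      simp only [mem_inter_iff, mem_Ici, mem_Ioo, mem_Ico]
      exact ⟨fun h => ⟨h.1, h.2.2⟩, fun h => ⟨h.1, hs.1.trans_le h.1, h.2⟩⟩
    rw [integral_indicator measurableSet_Ici, hμ, Measure.restrict_restrict measurableSet_Ici,
      integral_smul_const, hset2, integral_Ico_eq_integral_Ioo, hftc s ⟨hs.1.le, hs.2⟩, neg_smul]
  have hi1 : Integrable (fun t => deriv ψ t • x) μ := by
    refine Integrable.smul_const ?_ x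
    exact (hψ'.integrableOn_Icc (a := 0) (b := T)).mono_set Ioo_subset_Icc_self
  have hi2 : Integrable (fun t => deriv ψ t • ∫ s in Ioc 0 t, v s x) μ := by
    refine hFi.integral_prod_left.congr ?_
    filter_upwards [ae_restrict_mem measurableSet_Ioo] with t ht using e1 t ht
  calc ∫ t, deriv ψ t • trajectory v t x ∂μ
      = (∫ t, deriv ψ t • x ∂μ) + ∫ t, deriv ψ t • (∫ s in Ioc 0 t, v s x) ∂μ := by
        rw [← integral_add hi1 hi2]
        simp only [trajectory, smul_add]
    _ = - (ψ 0 • x) + ∫ t, ∫ s, F t s ∂μ ∂μ := by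
        rw [integral_smul_const, hftc 0 ⟨le_rfl, hT⟩, neg_smul]
        congr 1
        refine integral_congr_ae ?_
        filter_upwards [ae_restrict_mem measurableSet_Ioo] with t ht using (e1 t ht).symm
    _ = - (ψ 0 • x) + ∫ s, - (ψ s • v s x) ∂μ := by
        rw [integral_integral_swap hFi]
        congr 1
        refine integral_congr_ae ?_
        filter_upwards [ae_restrict_mem measurableSet_Ioo] with s hs using e2 s hs
    _ = _ := by rw [integral_neg]; abel

lemma Integrable.ae_eq_zero_of_setIntegral_prod_eq_zero {α β F : Type*} [MeasurableSpace α]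
    [MeasurableSpace β] [NormedAddCommGroup F] [NormedSpace ℝ F] [CompleteSpace F]
    {μ : Measure α} {ν : Measure β} [IsFiniteMeasure μ] [IsFiniteMeasure ν]
    {u : α × β → F} (hu : Integrable u (μ.prod ν))
    (h : ∀ A, MeasurableSet A → ∀ E, MeasurableSet E → ∫ z in A ×ˢ E, u z ∂(μ.prod ν) = 0) :
    u =ᵐ[μ.prod ν] 0 := by
  refine hu.ae_eq_zero_of_forall_setIntegral_eq_zero fun S hS _ => ?_
  have huniv : ∫ z, u z ∂(μ.prod ν) = 0 := by
    have := h univ .univ univ .univ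
    rwa [univ_prod_univ, setIntegral_univ] at this
  refine MeasurableSpace.induction_on_inter (C := fun S _ => ∫ z in S, u z ∂(μ.prod ν) = 0)
    generateFrom_prod.symm isPiSystem_prod ?_ ?_ ?_ ?_ S hS
  · simp
  · rintro _ ⟨A, hA, E, hE, rfl⟩
    exact h A hA E hE
  · intro t ht h0
    have := integral_add_compl ht hu
    rw [h0, huniv, zero_add] at this
    exact this
  · intro f hd hm h0
    have := integral_iUnion hm hd hu.integrableOn
    rw [this]
    simp [h0]

/-- The value `ψ 0` is unconstrained, so every `η` is a derivative on `(0, T)` of an admissible test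
function: the primitive that vanishes at `T`, times a cutoff equal to one on `(0, T)`. -/
lemma exists_primitive_test {T : ℝ} (hT : 0 < T) {η : ℝ → ℝ} (hη : ContDiff ℝ ∞ η)
    (hηc : HasCompactSupport η) (hηT : tsupport η ⊆ Iio T) :
    ∃ ψ : ℝ → ℝ, ContDiff ℝ ∞ ψ ∧ HasCompactSupport ψ ∧ tsupport ψ ⊆ Iio T ∧
      ∀ t ∈ Ioo 0 T, deriv ψ t = η t := by
  obtain ⟨m, hmem, hmax⟩ := (hηc.isCompact.union (isCompact_singleton (x := (0 : ℝ)))).exists_isGreatest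
    ⟨0, Or.inr rfl⟩
  have hmT : m < T := by
    rcases hmem with h | h
    · exact hηT h
    · rw [mem_singleton_iff.1 h]; exact hT
  have hη0 : ∀ t, m < t → η t = 0 := fun t ht =>
    image_eq_zero_of_notMem_tsupport fun h => absurd (hmax (Or.inl h)) (not_le.2 ht)
  set I : ℝ → ℝ := fun t => ∫ s in T..t, η s with hI
  have hId : ∀ t, HasDerivAt I (η t) t := fun t =>
    intervalIntegral.integral_hasDerivAt_right (hη.continuous.intervalIntegrable _ _)
      hη.continuous.stronglyMeasurable.stronglyMeasurableAtFilter hη.continuous.continuousAt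
  have hIc : ContDiff ℝ ∞ I := by
    rw [contDiff_infty_iff_deriv]
    refine ⟨fun t => (hId t).differentiableAt, ?_⟩
    rwa [show deriv I = η from funext fun t => (hId t).deriv]
  have hI0 : ∀ t, m < t → I t = 0 := by
    intro t ht
    simp only [hI]
    refine intervalIntegral.integral_zero_ae (ae_of_all _ fun s hs => hη0 s ?_)
    exact (lt_min hmT ht).trans hs.1
  let ρ : ContDiffBump (0 : ℝ) := ⟨T, T + 1, hT, by linarith⟩
  refine ⟨fun t => ρ t * I t, ρ.contDiff.mul hIc, ρ.hasCompactSupport.mul_right, ?_, fun t ht => ?_⟩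
  · refine (closure_minimal (fun t ht => ?_) isClosed_Iic).trans (Iic_subset_Iio.2 hmT)
    by_contra hcon
    exact ht (by simp [hI0 t (not_le.1 hcon)])
  · have hev : (fun t => ρ t * I t) =ᶠ[𝓝 t] I := by
      have : Metric.ball (0 : ℝ) T ∈ 𝓝 t := Metric.isOpen_ball.mem_nhds (by
        rw [Metric.mem_ball, Real.dist_eq, sub_zero, abs_of_pos ht.1]; exact ht.2)
      filter_upwards [this] with s hs
      have := ρ.one_of_mem_closedBall (Metric.ball_subset_closedBall hs)
      simp [this]
    rw [hev.deriv_eq, (hId t).deriv]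

/-- With derivative one on `(0, T')`, this test function turns the integrability required in the
weak formulation into local integrability of the flow itself, away from time `T`. -/
lemma exists_linear_test {T T' : ℝ} (hT' : 0 < T') (hTT : T' < T) :
    ∃ ψ : ℝ → ℝ, ContDiff ℝ ∞ ψ ∧ HasCompactSupport ψ ∧ tsupport ψ ⊆ Iio T ∧
      ∀ t ∈ Ioo 0 T', deriv ψ t = 1 := by
  let ρ : ContDiffBump (0 : ℝ) := ⟨T', (T' + T) / 2, hT', by linarith⟩
  refine ⟨fun t => ρ t * t, ρ.contDiff.mul contDiff_id, ρ.hasCompactSupport.mul_right, ?_, fun t ht => ?_⟩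
  · refine (tsupport_mul_subset_left).trans ?_
    rw [ρ.tsupport_eq]
    intro t ht
    rw [Metric.mem_closedBall, Real.dist_eq, sub_zero] at ht
    have h1 := (le_abs_self t).trans ht
    have h2 : ρ.rOut = (T' + T) / 2 := rfl
    rw [mem_Iio]; linarith
  · have hev : (fun t => ρ t * t) =ᶠ[𝓝 t] fun t => t := by
      have : Metric.ball (0 : ℝ) T' ∈ 𝓝 t := Metric.isOpen_ball.mem_nhds (by
        rw [Metric.mem_ball, Real.dist_eq, sub_zero, abs_of_pos ht.1]; exact ht.2)
      filter_upwards [this] with s hs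
      have := ρ.one_of_mem_closedBall (Metric.ball_subset_closedBall hs)
      simp [this]
    rw [hev.deriv_eq]
    simp

/-! ### Weak solutions coincide with trajectories. -/

section Identification

variable {d : ℕ} {T B : ℝ} {X v : ℝ → Eu d → Eu d}

lemma IsWeakTrajectory.integrable_restrict (H : IsWeakTrajectory T X v) {T' : ℝ} (hT' : 0 < T')
    (hTT : T' < T) {R : ℝ} (hR : 0 < R) :
    Integrable (Function.uncurry X)
      (((volume : Measure ℝ).restrict (Ioo 0 T')).prod (volume.restrict (Metric.ball (0 : Eu d) R))) := by
  obtain ⟨ψ, hψ, hψc, hψT, hψ1⟩ := exists_linear_test hT' hTT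
  let χ : ContDiffBump (0 : Eu d) := ⟨R, R + 1, hR, by linarith⟩
  have h1 := (H ψ hψ hψc hψT χ χ.contDiff χ.hasCompactSupport).1
  have h2 := h1.mono_measure (μ := ((volume : Measure ℝ).restrict (Ioo 0 T')).prod
    (volume.restrict (Metric.ball (0 : Eu d) R))) (by
      refine Measure.prod_mono ?_ Measure.restrict_le_self
      exact Measure.restrict_mono (Ioo_subset_Ioo_right hTT.le) le_rfl)
  refine h2.congr ?_
  rw [Measure.prod_restrict]
  filter_upwards [ae_restrict_mem (measurableSet_Ioo.prod Metric.isOpen_ball.measurableSet)] with z hz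
  rw [hψ1 _ hz.1, χ.one_of_mem_closedBall (Metric.ball_subset_closedBall hz.2)]
  simp [Function.uncurry]

lemma integrable_restrict_trajectory (hv : Measurable (Function.uncurry v))
    (hB : ∀ t x, ‖v t x‖ ≤ B) (T' R : ℝ) :
    Integrable (Function.uncurry (trajectory v))
      (((volume : Measure ℝ).restrict (Ioo 0 T')).prod (volume.restrict (Metric.ball (0 : Eu d) R))) := by
  have : IsFiniteMeasure ((volume : Measure (Eu d)).restrict (Metric.ball (0 : Eu d) R)) :=
    ⟨by simp [measure_ball_lt_top]⟩
  refine Integrable.of_bound (C := B * T' + R) (measurable_trajectory hv).aestronglyMeasurable ?_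
  rw [Measure.prod_restrict]
  filter_upwards [ae_restrict_mem (measurableSet_Ioo.prod Metric.isOpen_ball.measurableSet)] with z hz
  have hB0 : 0 ≤ B := (norm_nonneg _).trans (hB 0 0)
  have h1 := norm_trajectory_sub_le hv hB le_rfl hz.1.1.le z.2
  have h0 : trajectory v 0 z.2 = z.2 := by simp [trajectory]
  rw [h0, sub_zero] at h1
  have h2 : ‖z.2‖ < R := by simpa using hz.2
  have h3 := norm_le_norm_sub_add (trajectory v z.1 z.2) z.2
  have h4 : B * z.1 ≤ B * T' := by
    have := hz.1.2.le
    gcongr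
  show ‖trajectory v z.1 z.2‖ ≤ _
  linarith

lemma IsWeakTrajectory.ae_integral_smul_sub_eq_zero (H : IsWeakTrajectory T X v) (hT : 0 < T)
    (hv : Measurable (Function.uncurry v)) (hB : ∀ t x, ‖v t x‖ ≤ B)
    {η : ℝ → ℝ} (hη : ContDiff ℝ ∞ η) (hηc : HasCompactSupport η) {T' : ℝ} (hT' : 0 < T')
    (hTT : T' < T) (hηT : tsupport η ⊆ Ioo 0 T') (R : ℝ) (hR : 0 < R) :
    ∀ᵐ x ∂(volume.restrict (Metric.ball (0 : Eu d) R)),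
      ∫ t in Ioo 0 T', η t • (X t x - trajectory v t x) = 0 := by
  have hηT2 : tsupport η ⊆ Iio T := fun t ht => (hηT ht).2.trans hTT
  obtain ⟨ψ, hψ, hψc, hψT, hψη⟩ := exists_primitive_test hT hη hηc hηT2
  have hηT' : ∀ t, t ∉ Ioo 0 T' → η t = 0 := fun t ht =>
    image_eq_zero_of_notMem_tsupport fun h => ht (hηT h)
  have hXx := (H.integrable_restrict hT' hTT hR).prod_left_ae
  obtain ⟨D, hD⟩ := hη.continuous.bounded_above_of_compact_support hηc
  filter_upwards [ae_restrict_of_ae (H.ae_integral_eq_zero hv hB hψ hψc hψT), hXx] with x hx hXi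
  have htr := integral_deriv_smul_trajectory hT hv hB hψ hψT x
  have hXi : Integrable (fun t => X t x) (volume.restrict (Ioo 0 T')) := hXi
  have e : ∀ F : ℝ → Eu d, ∫ t in Ioo 0 T, deriv ψ t • F t = ∫ t in Ioo 0 T', η t • F t := by
    intro F
    have h1 : ∫ t in Ioo 0 T, deriv ψ t • F t = ∫ t in Ioo 0 T, η t • F t :=
      setIntegral_congr_fun measurableSet_Ioo fun t ht => by simp only [hψη t ht]
    rw [h1]
    refine (setIntegral_eq_of_subset_of_forall_sdiff_eq_zero measurableSet_Ioo
      (Ioo_subset_Ioo_right hTT.le) fun t ht => ?_)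
    rw [hηT' t ht.2, zero_smul]
  have iX : Integrable (fun t => η t • X t x) (volume.restrict (Ioo 0 T')) :=
    hXi.bdd_smul D hη.continuous.aestronglyMeasurable (ae_of_all _ hD)
  have iXT : Integrable (fun t => deriv ψ t • X t x) (volume.restrict (Ioo 0 T)) := by
    have h1 : IntegrableOn (fun t => η t • X t x) (Ioo 0 T) volume := by
      refine IntegrableOn.of_forall_sdiff_eq_zero (s := Ioo 0 T') iX measurableSet_Ioo fun t ht => ?_
      rw [hηT' t ht.2, zero_smul]
    exact h1.congr_fun (fun t ht => by simp only [hψη t ht]) measurableSet_Ioo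
  have hvx : Measurable fun s => v s x := hv.comp (by fun_prop : Measurable fun s : ℝ => (s, x))
  have iv : Integrable (fun t => ψ t • v t x) (volume.restrict (Ioo 0 T)) := by
    obtain ⟨D', hD'⟩ := hψ.continuous.bounded_above_of_compact_support hψc
    exact (Integrable.of_bound hvx.aestronglyMeasurable B (ae_of_all _ fun s => hB s x)).bdd_smul
      D' hψ.continuous.aestronglyMeasurable (ae_of_all _ hD')
  have htx : Measurable fun s => trajectory v s x :=
    (measurable_trajectory hv).comp (by fun_prop : Measurable fun s : ℝ => (s, x))
  have itr : Integrable (fun t => η t • trajectory v t x) (volume.restrict (Ioo 0 T')) := by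
    have hB0 : 0 ≤ B := (norm_nonneg _).trans (hB 0 0)
    have h0 : trajectory v 0 x = x := by simp [trajectory]
    refine (Integrable.of_bound htx.aestronglyMeasurable (B * T' + ‖x‖) ?_).bdd_smul
      D hη.continuous.aestronglyMeasurable (ae_of_all _ hD)
    filter_upwards [ae_restrict_mem measurableSet_Ioo] with t ht
    have h1 := norm_trajectory_sub_le hv hB le_rfl ht.1.le x
    rw [h0, sub_zero] at h1
    have h3 := norm_le_norm_sub_add (trajectory v t x) x
    have h4 : B * t ≤ B * T' := by
      have := ht.2.le
      gcongr
    linarith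
  simp_rw [smul_sub]
  rw [integral_sub iX itr, ← e, ← e, htr]
  rw [integral_add iXT iv] at hx
  rw [← hx]
  abel

/-- The null sets in `ae_integral_smul_sub_eq_zero` depend on `η`. Integrating first over a set `E`
in space leaves a function of time annihilated by every `η`, so the difference has zero integral
over all rectangles, which determine it a.e. Finally `T'` increases to `T` and `R` to infinity. -/
lemma IsWeakTrajectory.ae_eq_trajectory (H : IsWeakTrajectory T X v) (hT : 0 < T)
    (hX : Measurable (Function.uncurry X)) (hv : Measurable (Function.uncurry v))
    (hB : ∀ t x, ‖v t x‖ ≤ B) :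
    ∀ᵐ z ∂(slab d T), X z.1 z.2 = trajectory v z.1 z.2 := by
  set u : ℝ × Eu d → Eu d := fun z => X z.1 z.2 - trajectory v z.1 z.2 with hu
  have hum : Measurable u := hX.sub (measurable_trajectory hv)
  have key : ∀ T' R : ℝ, 0 < T' → T' < T → 0 < R →
      ∀ᵐ z ∂(slab d T), z.1 ∈ Ioo 0 T' → z.2 ∈ Metric.ball (0 : Eu d) R → u z = 0 := by
    intro T' R hT' hTT hR
    have hfin : IsFiniteMeasure ((volume : Measure (Eu d)).restrict (Metric.ball (0 : Eu d) R)) :=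
      ⟨by simp [measure_ball_lt_top]⟩
    have hui : Integrable u (((volume : Measure ℝ).restrict (Ioo 0 T')).prod
        (volume.restrict (Metric.ball (0 : Eu d) R))) :=
      (H.integrable_restrict hT' hTT hR).sub (integrable_restrict_trajectory hv hB T' R)
    have h0 := Integrable.ae_eq_zero_of_setIntegral_prod_eq_zero hui (fun A hA E hE => by
      have huE : Integrable u (((volume : Measure ℝ).restrict (Ioo 0 T')).prod
          ((volume.restrict (Metric.ball (0 : Eu d) R)).restrict E)) :=
        hui.mono_measure (Measure.prod_mono le_rfl Measure.restrict_le_self)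
      have hw : ∀ᵐ t, t ∈ Ioo 0 T' → ∫ x in E, u (t, x) ∂(volume.restrict (Metric.ball (0 : Eu d) R)) = 0 := by
        refine isOpen_Ioo.ae_eq_zero_of_integral_contDiff_smul_eq_zero
          (IntegrableOn.locallyIntegrableOn huE.integral_prod_left) fun η hη hηc hηT => ?_
        obtain ⟨D, hD⟩ := hη.continuous.bounded_above_of_compact_support hηc
        have hηu : Integrable (fun z : ℝ × Eu d => η z.1 • u z) (((volume : Measure ℝ).restrict (Ioo 0 T')).prod
          ((volume.restrict (Metric.ball (0 : Eu d) R)).restrict E)) :=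
          huE.bdd_smul D (hη.continuous.comp continuous_fst).aestronglyMeasurable
            (ae_of_all _ fun z => hD z.1)
        have e1 : ∫ t, η t • ∫ x in E, u (t, x) ∂(volume.restrict (Metric.ball (0 : Eu d) R)) =
            ∫ t in Ioo 0 T', ∫ x in E, η t • u (t, x) ∂(volume.restrict (Metric.ball (0 : Eu d) R)) := by
          simp_rw [integral_smul]
          refine (setIntegral_eq_integral_of_forall_compl_eq_zero fun t ht => ?_).symm
          rw [image_eq_zero_of_notMem_tsupport fun h => ht (hηT h), zero_smul]
        rw [e1, integral_integral_swap hηu]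
        refine integral_eq_zero_of_ae ?_
        exact ae_restrict_of_ae (H.ae_integral_smul_sub_eq_zero hT hv hB hη hηc hT' hTT hηT R hR)
      rw [setIntegral_prod _ hui.integrableOn]
      refine integral_eq_zero_of_ae (ae_restrict_of_ae ?_)
      exact (ae_restrict_iff' measurableSet_Ioo).2 hw)
    rw [Measure.prod_restrict] at h0
    replace h0 := (ae_restrict_iff' (measurableSet_Ioo.prod Metric.isOpen_ball.measurableSet)).1 h0
    have hac : slab d T ≪ (volume : Measure ℝ).prod (volume : Measure (Eu d)) :=
      (Measure.prod_mono Measure.restrict_le_self le_rfl).absolutelyContinuous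
    filter_upwards [hac.ae_le h0] with z hz h1 h2 using hz ⟨h1, h2⟩
  have key2 : ∀ᵐ z ∂(slab d T), ∀ n : ℕ, z.1 ∈ Ioo 0 (T - T / (n + 2)) →
      z.2 ∈ Metric.ball (0 : Eu d) (n + 1) → u z = 0 := by
    rw [ae_all_iff]
    intro n
    have h2 : (1 : ℝ) < n + 2 := by have : (0 : ℝ) ≤ n := n.cast_nonneg; linarith
    refine key _ _ ?_ ?_ (by positivity)
    · rw [sub_pos, div_lt_iff₀ (by linarith)]; nlinarith
    · have : 0 < T / (n + 2) := by positivity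
      linarith
  have hmem : ∀ᵐ z : ℝ × Eu d ∂(slab d T), z.1 ∈ Ioo 0 T :=
    Measure.quasiMeasurePreserving_fst.ae (ae_restrict_mem measurableSet_Ioo)
  filter_upwards [key2, hmem] with z hz hzT
  have hlim : 0 < T - z.1 := by linarith [hzT.2]
  obtain ⟨n, hn⟩ := exists_nat_gt (max (T / (T - z.1)) ‖z.2‖)
  have hn1 := (le_max_left _ _).trans_lt hn
  have hn2 := (le_max_right _ _).trans_lt hn
  refine sub_eq_zero.1 (hz n ⟨hzT.1, ?_⟩ (by rw [Metric.mem_ball, dist_zero_right]; linarith))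
  rw [div_lt_iff₀ hlim] at hn1
  have hpos : (0 : ℝ) < n + 2 := by positivity
  have : T / (n + 2) < T - z.1 := by
    rw [div_lt_iff₀ hpos]; nlinarith
  linarith

end Identification

/-! ### Normalisation of the velocity field and of the flow -/

lemma measurable_slice {α β γ : Type*} [MeasurableSpace α] [MeasurableSpace β] [MeasurableSpace γ]
    {F : α → β → γ} (hF : Measurable (Function.uncurry F)) (a : α) : Measurable (F a) :=
  hF.comp measurable_prodMk_left

/-- The constant of the maximal estimate for a field on `ℝ^d`. -/
def maximalConst (d : ℕ) (p : ℝ) : ℝ≥0∞ :=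
  ENNReal.ofReal (4 ^ d) ^ p * ENNReal.ofReal (5 ^ d * (2 * p / (p - 1)) * 2 ^ (p - 1))

/-- The increments of `b(s,·)` are controlled by `g(s,·)`, with `g` in `L^1_t L^p_x`. -/
structure HasMaximalBound {d : ℕ} (T p : ℝ) (A M : ℝ≥0∞) (b : ℝ → Eu d → Eu d)
    (g : ℝ → Eu d → ℝ≥0∞) : Prop where
  measurable : Measurable (Function.uncurry g)
  enorm_sub_le : ∀ᵐ s ∂(volume.restrict (Ioo (0 : ℝ) T)), ∃ S : Set (Eu d), volume S = 0 ∧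
    ∀ x ∉ S, ∀ y ∉ S, ‖b s x - b s y‖ₑ ≤ ‖x - y‖ₑ * (g s x + g s y)
  exists_weight : ∃ m : ℝ → ℝ≥0∞, Measurable m ∧
    (∀ᵐ s ∂(volume.restrict (Ioo (0 : ℝ) T)), m s ≠ 0 ∧ m s ≠ ⊤ ∧ ∫⁻ x, g s x ^ p ≤ A * m s ^ p) ∧
    ∫⁻ s in Ioo 0 T, m s ≤ M

lemma HasWeakGradient.congr {d : ℕ} {f f' : Eu d → Eu d} {G G' : Eu d → Eu d →L[ℝ] Eu d}
    (h : HasWeakGradient f G) (hf : f =ᵐ[volume] f') (hG : G =ᵐ[volume] G') : HasWeakGradient f' G' := by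
  refine ⟨h.locallyIntegrable.congr hf, h.locallyIntegrable_grad.congr hG, fun φ hφ hφc v => ?_⟩
  have h1 : ∫ x, (fderiv ℝ φ x v) • f' x = ∫ x, (fderiv ℝ φ x v) • f x := by
    refine integral_congr_ae ?_
    filter_upwards [hf] with x hx
    rw [hx]
  have h2 : ∫ x, φ x • G' x v = ∫ x, φ x • G x v := by
    refine integral_congr_ae ?_
    filter_upwards [hG] with x hx
    rw [hx]
  rw [h1, h2]
  exact h.integral_eq φ hφ hφc v

lemma IsL1W1p.exists_hasMaximalBound {d : ℕ} {T p M : ℝ} {b b' : ℝ → Eu d → Eu d}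
    {D : ℝ → Eu d → Eu d →L[ℝ] Eu d} (hb : IsL1W1p T p b D) (hp : 1 < p)
    (hM : ∫⁻ t in Ioo (0 : ℝ) T, eLpNorm (D t) (ENNReal.ofReal p) volume ≤ ENNReal.ofReal M)
    (hb'm : Measurable (Function.uncurry b'))
    (hb' : ∀ᵐ s ∂(volume.restrict (Ioo (0 : ℝ) T)), b s =ᵐ[volume] b' s) :
    ∃ g : ℝ → Eu d → ℝ≥0∞,
      HasMaximalBound T p (maximalConst d p) (ENNReal.ofReal M + ENNReal.ofReal T) b' g := by
  have hp0 : 0 < p := by linarith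
  set D' : ℝ → Eu d → Eu d →L[ℝ] Eu d := fun s x => hb.aestronglyMeasurable_grad.mk _ (s, x) with hD'
  have hD'm : StronglyMeasurable (Function.uncurry D') := hb.aestronglyMeasurable_grad.stronglyMeasurable_mk
  have hDD : ∀ᵐ s ∂(volume.restrict (Ioo (0 : ℝ) T)), D s =ᵐ[volume] D' s :=
    Measure.ae_ae_of_ae_prod hb.aestronglyMeasurable_grad.ae_eq_mk
  have hF : Measurable (Function.uncurry fun s x => ‖D' s x‖ₑ) := hD'm.enorm
  have hslice : ∀ s, Measurable fun x => ‖D' s x‖ₑ := fun s => measurable_slice hF s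
  have hM1 : Measurable (Function.uncurry fun s => maximalFn fun x => ‖D' s x‖ₑ) :=
    measurable_maximalFn hF
  have hM2 : ∀ s, Measurable (maximalFn fun x => ‖D' s x‖ₑ) := fun s => measurable_slice hM1 s
  have hnorm : ∀ᵐ s ∂(volume.restrict (Ioo (0 : ℝ) T)),
      eLpNorm (D s) (ENNReal.ofReal p) volume = (∫⁻ x, ‖D' s x‖ₑ ^ p) ^ (1 / p) := by
    filter_upwards [hDD] with s hs
    rw [eLpNorm_congr_ae hs, eLpNorm_eq_lintegral_rpow_enorm_toReal (by simpa using hp0) (by simp),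
      ENNReal.toReal_ofReal hp0.le]
  have hmm : Measurable fun s => (∫⁻ x, ‖D' s x‖ₑ ^ p) ^ (1 / p) :=
    ((hF.pow_const p).lintegral_prod_right' (ν := (volume : Measure (Eu d)))).pow_const _
  have hint : ∫⁻ s in Ioo 0 T, (∫⁻ x, ‖D' s x‖ₑ ^ p) ^ (1 / p) ≤ ENNReal.ofReal M := by
    refine le_trans (le_of_eq ?_) hM
    refine lintegral_congr_ae ?_
    filter_upwards [hnorm] with s hs using hs.symm
  -- The weight is the `L^p` norm of the gradient plus one: the summand keeps it nonzero, as
  -- negative powers of it occur in `lintegral_rpow_le_of_weight`, and costs `T` in the bound on its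
  -- integral.
  refine ⟨fun s x => ENNReal.ofReal (4 ^ d) * maximalFn (fun x => ‖D' s x‖ₑ) x, ?_, ?_,
    fun s => (∫⁻ x, ‖D' s x‖ₑ ^ p) ^ (1 / p) + 1, hmm.add_const _, ?_, ?_⟩
  · exact hM1.const_mul _
  · filter_upwards [hb.hasWeakGradient, hb', hDD] with s h1 h2 h3
    exact (h1.congr h2 h3).exists_null_enorm_sub_le
      (measurable_slice hb'm s) (hslice s)
  · filter_upwards [ae_lt_top hmm (hint.trans_lt ENNReal.ofReal_lt_top).ne] with s hs
    refine ⟨by simp, by simpa using hs.ne, ?_⟩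
    simp_rw [ENNReal.mul_rpow_of_nonneg _ _ hp0.le]
    rw [lintegral_const_mul _ ((hM2 s).pow_const p), maximalConst, mul_assoc]
    gcongr
    refine (lintegral_maximalFn_rpow_le hp (hslice s)).trans ?_
    gcongr
    calc ∫⁻ x, ‖D' s x‖ₑ ^ p = ((∫⁻ x, ‖D' s x‖ₑ ^ p) ^ (1 / p)) ^ p := by
          rw [← ENNReal.rpow_mul, one_div_mul_cancel hp0.ne', ENNReal.rpow_one]
      _ ≤ _ := by gcongr; exact le_self_add
  · rw [lintegral_add_right _ measurable_const]
    gcongr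
    simp

lemma exists_bounded_version {d : ℕ} {T B : ℝ} {b : ℝ → Eu d → Eu d}
    (hb : AEStronglyMeasurable (Function.uncurry b) (slab d T))
    (hB : eLpNorm (Function.uncurry b) ⊤ (slab d T) ≤ ENNReal.ofReal B) :
    ∃ b' : ℝ → Eu d → Eu d, Measurable (Function.uncurry b') ∧ (∀ s x, ‖b' s x‖ ≤ max B 0) ∧
      Function.uncurry b =ᵐ[slab d T] Function.uncurry b' := by
  classical
  have hset : MeasurableSet {z : ℝ × Eu d | ‖hb.mk _ z‖ ≤ max B 0} :=
    measurableSet_le hb.stronglyMeasurable_mk.measurable.norm measurable_const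
  refine ⟨fun s x => ({z : ℝ × Eu d | ‖hb.mk _ z‖ ≤ max B 0}).indicator (hb.mk _) (s, x),
    hb.stronglyMeasurable_mk.measurable.indicator hset, fun s x => ?_, ?_⟩
  · dsimp only
    by_cases h : (s, x) ∈ {z : ℝ × Eu d | ‖hb.mk _ z‖ ≤ max B 0}
    · rw [indicator_of_mem h]; exact h
    · rw [indicator_of_notMem h, norm_zero]; exact le_max_right _ _
  · rw [eLpNorm_exponent_top] at hB
    filter_upwards [hb.ae_eq_mk, enorm_ae_le_eLpNormEssSup (Function.uncurry b) (slab d T)] with z h1 h2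
    have h3 : z ∈ {z : ℝ × Eu d | ‖hb.mk _ z‖ ≤ max B 0} := by
      have h4 := h2.trans hB
      rw [h1, ← ofReal_norm] at h4
      show ‖hb.mk _ z‖ ≤ max B 0
      rcases le_total 0 B with h0 | h0
      · exact ((ENNReal.ofReal_le_ofReal_iff h0).1 h4).trans (le_max_left _ _)
      · rw [ENNReal.ofReal_of_nonpos h0] at h4
        exact (ENNReal.ofReal_eq_zero.1 (le_antisymm h4 bot_le)).trans (le_max_right _ _)
    rw [h1]
    exact (indicator_of_mem h3 (hb.mk _)).symm

/-- `v` is the velocity of trajectories of the field `b`. -/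
structure IsVelocity {d : ℕ} (T B : ℝ) (b v : ℝ → Eu d → Eu d) : Prop where
  measurable : Measurable (Function.uncurry v)
  bound : ∀ s x, ‖v s x‖ ≤ B
  ae_eq : ∀ᵐ s ∂(volume.restrict (Ioo (0 : ℝ) T)), ∀ᵐ x, v s x = b s (trajectory v s x)

/-- The maps `W(s,·)` have compressibility constant `L` for a.e. `s ∈ (0,T)`. -/
def IsCompressible {d : ℕ} (T : ℝ) (L : ℝ≥0∞) (W : ℝ → Eu d → Eu d) : Prop :=
  ∀ᵐ s ∂(volume.restrict (Ioo (0 : ℝ) T)), Measure.map (W s) volume ≤ L • volume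

lemma volume_preimage_le_of_isOpen {d : ℕ} {f : Eu d → Eu d} {L : ℝ} (hL : 0 < L)
    (h : ∀ A, IsOpen A → volume (f ⁻¹' A) ≤ ENNReal.ofReal L * volume A) (A : Set (Eu d)) :
    volume (f ⁻¹' A) ≤ ENNReal.ofReal L * volume A := by
  rw [A.measure_eq_iInf_isOpen (μ := volume)]
  simp_rw [ENNReal.mul_iInf_of_ne (by simpa using hL : ENNReal.ofReal L ≠ 0) ENNReal.ofReal_ne_top]
  refine le_iInf fun U => le_iInf fun hU => le_iInf fun hUo => ?_
  exact (measure_mono (preimage_mono hU)).trans (h U hUo)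

lemma tsupport_mul_subset_prod {d : ℕ} (ψ : ℝ → ℝ) (χ : Eu d → ℝ) :
    tsupport (Function.uncurry fun t (x : Eu d) => ψ t * χ x) ⊆ tsupport ψ ×ˢ tsupport χ := by
  refine closure_minimal ?_ ((isClosed_tsupport ψ).prod (isClosed_tsupport χ))
  rintro ⟨t, x⟩ h
  exact ⟨subset_tsupport _ (left_ne_zero_of_mul h), subset_tsupport _ (right_ne_zero_of_mul h)⟩

lemma IsRegularLagrangianFlow.isWeakTrajectory {d : ℕ} {T : ℝ} {b X X' v : ℝ → Eu d → Eu d}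
    (H : IsRegularLagrangianFlow T b X)
    (hX : ∀ᵐ z ∂(slab d T), X z.1 z.2 = X' z.1 z.2)
    (hv : ∀ᵐ z ∂(slab d T), b z.1 (X z.1 z.2) = v z.1 z.2) : IsWeakTrajectory T X' v := by
  intro ψ hψ hψc hψT χ hχ hχc
  have hd : ∀ t x, deriv (fun s => ψ s * χ x) t = deriv ψ t * χ x := fun t x => by
    rw [deriv_mul_const (hψ.differentiable (by simp) t)]
  obtain ⟨h1, h2, h3⟩ := H.weak_formulation (fun t x => ψ t * χ x)
    ((hψ.comp contDiff_fst).mul (hχ.comp contDiff_snd))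
    (HasCompactSupport.of_support_subset_isCompact (hψc.prod hχc) ((subset_tsupport _).trans (tsupport_mul_subset_prod ψ χ)))
    ((tsupport_mul_subset_prod ψ χ).trans (prod_mono hψT (subset_univ _)))
  simp only [hd] at h1 h3
  refine ⟨h1.congr ?_, ?_⟩
  · filter_upwards [hX] with z hz
    rw [hz]
  · rw [← h3]
    congr 1
    refine integral_congr_ae ?_
    filter_upwards [hX, hv] with z hz hz'
    rw [hz', hz]

/-- Compressibility makes preimages of null sets null, so a.e. equal fields stay a.e. equal after
composition with the flow. -/
lemma ae_slab_comp_of_compressible {d : ℕ} {T : ℝ} {L : ℝ≥0∞} {X : ℝ → Eu d → Eu d}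
    (hX : Measurable (Function.uncurry X)) (hL : IsCompressible T L X) {P : ℝ × Eu d → Prop}
    (hP : ∀ᵐ z ∂(slab d T), P z) : ∀ᵐ z ∂(slab d T), P (z.1, X z.1 z.2) := by
  obtain ⟨S, hSs, hSm, hS0⟩ := exists_measurable_superset_of_null (ae_iff.1 hP)
  have hmeas : MeasurableSet {z : ℝ × Eu d | (z.1, X z.1 z.2) ∈ S} :=
    (measurable_fst.prodMk hX) hSm
  have h0 : slab d T {z : ℝ × Eu d | (z.1, X z.1 z.2) ∈ S} = 0 := by
    rw [slab, Measure.measure_prod_null hmeas]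
    filter_upwards [hL, (Measure.measure_prod_null hSm).1 hS0] with s hs hs0
    have hXs : Measurable (X s) := measurable_slice hX s
    have hSs : MeasurableSet (Prod.mk s ⁻¹' S) := measurable_prodMk_left hSm
    have h1 := hs (Prod.mk s ⁻¹' S)
    rw [Measure.map_apply hXs hSs, Measure.smul_apply, hs0, Pi.zero_apply, smul_zero] at h1
    exact le_antisymm h1 bot_le
  filter_upwards [measure_eq_zero_iff_ae_notMem.1 h0] with z hz
  by_contra hcon
  exact hz (hSs hcon)

/-- A regular Lagrangian flow is given by trajectories. -/
lemma IsRegularLagrangianFlow.exists_velocity {d : ℕ} {T B : ℝ} {b b' X : ℝ → Eu d → Eu d}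
    (H : IsRegularLagrangianFlow T b X) (hT : 0 < T)
    (hb'm : Measurable (Function.uncurry b')) (hb'B : ∀ s x, ‖b' s x‖ ≤ B)
    (hbb' : Function.uncurry b =ᵐ[slab d T] Function.uncurry b') :
    ∃ v : ℝ → Eu d → Eu d, IsVelocity T B b' v ∧ (∃ L : ℝ≥0∞, L ≠ ⊤ ∧ IsCompressible T L (trajectory v)) ∧
      (∀ᵐ s ∂(volume.restrict (Ioo (0 : ℝ) T)), X s =ᵐ[volume] trajectory v s) ∧
      ((∀ᵐ x : Eu d, ContinuousOn (fun t => X t x) (Ico 0 T)) →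
        ∀ t ∈ Ico (0 : ℝ) T, X t =ᵐ[volume] trajectory v t) := by
  obtain ⟨L, hL, hcomp⟩ := H.compressibility
  set X' : ℝ → Eu d → Eu d := fun s x => H.aestronglyMeasurable.mk _ (s, x) with hX'
  have hX'm : Measurable (Function.uncurry X') := H.aestronglyMeasurable.stronglyMeasurable_mk.measurable
  have hXX' : ∀ᵐ z ∂(slab d T), X z.1 z.2 = X' z.1 z.2 := H.aestronglyMeasurable.ae_eq_mk
  have hXs : ∀ᵐ s ∂(volume.restrict (Ioo (0 : ℝ) T)), X s =ᵐ[volume] X' s := Measure.ae_ae_of_ae_prod hXX'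
  have hcompX' : IsCompressible T (ENNReal.ofReal L) X' := by
    filter_upwards [hcomp, hXs] with s h1 h2
    refine Measure.le_iff.2 fun A hA => ?_
    rw [Measure.map_apply (measurable_slice hX'm s) hA]
    refine le_trans (le_of_eq (measure_congr ?_)) (volume_preimage_le_of_isOpen hL h1 A)
    filter_upwards [h2] with x hx
    simp only [preimage, eq_iff_iff]
    show X' s x ∈ A ↔ X s x ∈ A
    rw [hx]
  -- Measurable and bounded at every point, so that its trajectories are defined and Lipschitz in
  -- time for every `x`.
  set v : ℝ → Eu d → Eu d := fun s x => b' s (X' s x) with hv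
  have hvm : Measurable (Function.uncurry v) := hb'm.comp (measurable_fst.prodMk hX'm)
  have hvB : ∀ s x, ‖v s x‖ ≤ B := fun s x => hb'B _ _
  have hbv : ∀ᵐ z ∂(slab d T), b z.1 (X z.1 z.2) = v z.1 z.2 := by
    filter_upwards [hXX', ae_slab_comp_of_compressible hX'm hcompX' hbb'] with z h1 h2
    rw [h1]
    exact h2
  have hae := (H.isWeakTrajectory hXX' hbv).ae_eq_trajectory hT hX'm hvm hvB
  have haes : ∀ᵐ s ∂(volume.restrict (Ioo (0 : ℝ) T)), X' s =ᵐ[volume] trajectory v s :=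
    Measure.ae_ae_of_ae_prod hae
  refine ⟨v, ⟨hvm, hvB, ?_⟩, ⟨ENNReal.ofReal L, ENNReal.ofReal_ne_top, ?_⟩, ?_, ?_⟩
  · filter_upwards [haes] with s hs
    filter_upwards [hs] with x hx
    rw [← hx]
  · filter_upwards [hcompX', haes] with s h1 h2
    rwa [← Measure.map_congr h2]
  · filter_upwards [hXs, haes] with s h1 h2 using h1.trans h2
  · intro hcont t ht
    have hm : MeasurableSet {z : Eu d × ℝ | X' z.2 z.1 = trajectory v z.2 z.1} :=
      measurableSet_eq_fun (hX'm.comp measurable_swap) ((measurable_trajectory hvm).comp measurable_swap)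
    have hsw : ∀ᵐ x : Eu d, ∀ᵐ s ∂(volume.restrict (Ioo (0 : ℝ) T)), X s x = trajectory v s x := by
      have hall : ∀ᵐ z ∂(slab d T), X z.1 z.2 = trajectory v z.1 z.2 := by
        filter_upwards [hXX', hae] with z h1 h2 using h1.trans h2
      exact Measure.ae_ae_of_ae_prod (Measure.measurePreserving_swap.quasiMeasurePreserving.ae hall)
    filter_upwards [hcont, hsw] with x hx1 hx2
    -- The times of agreement have full measure, hence are dense in `[0, T)`, and both paths are
    -- continuous there; so they agree at every time, including `t = 0`.
    have hd : Ioo (0 : ℝ) T ⊆ closure {s ∈ Ioo (0 : ℝ) T | X s x = trajectory v s x} := by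
      intro s hs
      rw [mem_closure_iff]
      intro U hU hsU
      by_contra hcon
      have hsub : U ∩ Ioo 0 T ⊆ {s | ¬ (s ∈ Ioo 0 T → X s x = trajectory v s x)} := by
        rintro r ⟨hrU, hr⟩ hr2
        exact hcon ⟨r, hrU, hr, hr2 hr⟩
      have h0 : volume (U ∩ Ioo 0 T) = 0 :=
        measure_mono_null hsub (ae_iff.1 ((ae_restrict_iff' measurableSet_Ioo).1 hx2))
      exact ((hU.inter isOpen_Ioo).measure_pos volume ⟨s, hsU, hs⟩).ne' h0
    have hcl : Ico (0 : ℝ) T ⊆ closure {s ∈ Ioo (0 : ℝ) T | X s x = trajectory v s x} := by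
      intro s hs
      have h1 : closure (Ioo (0 : ℝ) T) ⊆ closure {s ∈ Ioo (0 : ℝ) T | X s x = trajectory v s x} :=
        closure_minimal hd isClosed_closure
      refine h1 ?_
      rw [closure_Ioo hT.ne]
      exact ⟨hs.1, hs.2.le⟩
    have hEq : EqOn (fun t => X t x) (fun t => trajectory v t x)
        {s ∈ Ioo (0 : ℝ) T | X s x = trajectory v s x} := fun s hs => hs.2
    exact hEq.of_subset_closure hx1 ((continuousOn_trajectory hvm hvB x).mono fun s hs => hs.1)
      (fun s hs => ⟨hs.1.1.le, hs.1.2⟩) hcl ht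

/-! ### Stability estimate -/

lemma lintegral_comp_le_of_map_le {α : Type*} [MeasurableSpace α] {μ : Measure α} {φ : α → α}
    (hφ : Measurable φ) {L : ℝ≥0∞} (h : Measure.map φ μ ≤ L • μ) {F : α → ℝ≥0∞} (hF : Measurable F) :
    ∫⁻ x, F (φ x) ∂μ ≤ L * ∫⁻ x, F x ∂μ := by
  rw [← lintegral_map hF hφ, ← smul_eq_mul, ← lintegral_smul_measure]
  exact lintegral_mono' h le_rfl

/-- Hölder for `f * m ^ (-1/q)` and `m ^ (1/q)`. With a weight dominating the spatial norm of the
gradient this replaces Minkowski's integral inequality, which is needed as the gradient is only `L¹`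
in time. -/
lemma lintegral_rpow_le_of_weight {μ : Measure ℝ} {p : ℝ} (hp : 1 < p) {f m : ℝ → ℝ≥0∞}
    (hf : Measurable f) (hm : Measurable m) (hm0 : ∀ᵐ s ∂μ, m s ≠ 0 ∧ m s ≠ ⊤) :
    (∫⁻ s, f s ∂μ) ^ p ≤ (∫⁻ s, m s ∂μ) ^ (p - 1) * ∫⁻ s, f s ^ p * m s ^ (-(p - 1)) ∂μ := by
  have hp0 : 0 < p := by linarith
  have hp1 : 0 < p - 1 := by linarith
  set q := p / (p - 1) with hq
  have hpq : p.HolderConjugate q := Real.HolderConjugate.conjExponent hp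
  have hq0 : 0 < q := hpq.symm.pos
  have h1 : ∫⁻ s, f s ∂μ = ∫⁻ s, (fun s => f s * m s ^ (-(1 / q))) s * (fun s => m s ^ (1 / q)) s ∂μ := by
    refine lintegral_congr_ae ?_
    filter_upwards [hm0] with s hs
    rw [mul_assoc, ← ENNReal.rpow_add _ _ hs.1 hs.2, neg_add_cancel, ENNReal.rpow_zero, mul_one]
  have h2 := ENNReal.lintegral_mul_le_Lp_mul_Lq μ hpq
    (f := fun s => f s * m s ^ (-(1 / q))) (g := fun s => m s ^ (1 / q))
    (hf.mul (hm.pow_const _)).aemeasurable (hm.pow_const _).aemeasurable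
  have e1 : ∀ s, (m s ^ (1 / q)) ^ q = m s := fun s => by
    rw [← ENNReal.rpow_mul, one_div_mul_cancel hq0.ne', ENNReal.rpow_one]
  have hpq1 : p / q = p - 1 := by rw [hq]; field_simp
  have e2 : ∀ s, (f s * m s ^ (-(1 / q))) ^ p = f s ^ p * m s ^ (-(p - 1)) := fun s => by
    rw [ENNReal.mul_rpow_of_nonneg _ _ hp0.le, ← ENNReal.rpow_mul]
    congr 2
    rw [← hpq1]; ring
  rw [h1]
  calc _ ≤ ((∫⁻ s, (f s * m s ^ (-(1 / q))) ^ p ∂μ) ^ (1 / p) * (∫⁻ s, (m s ^ (1 / q)) ^ q ∂μ) ^ (1 / q)) ^ p :=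
        ENNReal.rpow_le_rpow h2 hp0.le
    _ = _ := by
        simp_rw [e1, e2]
        rw [ENNReal.mul_rpow_of_nonneg _ _ hp0.le, ← ENNReal.rpow_mul, ← ENNReal.rpow_mul,
          one_div_mul_cancel hp0.ne', ENNReal.rpow_one, one_div_mul_eq_div, hpq1, mul_comm]

lemma measurable_uncurry_swap {α β γ : Type*} [MeasurableSpace α] [MeasurableSpace β]
    [MeasurableSpace γ] {F : α → β → γ} (hF : Measurable (Function.uncurry F)) :
    Measurable fun z : β × α => F z.2 z.1 := hF.comp measurable_swap

/-- The sublevel estimate for the integral of `g` along a compressible family of maps. -/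
lemma HasMaximalBound.rpow_mul_volume_le {d : ℕ} {T p : ℝ} {A M L : ℝ≥0∞} {b : ℝ → Eu d → Eu d}
    {g : ℝ → Eu d → ℝ≥0∞} (hg : HasMaximalBound T p A M b g) (hp : 1 < p) {φ : ℝ → Eu d → Eu d}
    (hφ : Measurable (Function.uncurry φ)) (hL : IsCompressible T L φ) (c : ℝ≥0∞) :
    c ^ p * volume {x | c ≤ ∫⁻ s in Ioo 0 T, g s (φ s x)} ≤ L * A * M ^ p := by
  obtain ⟨m, hm, hmae, hmM⟩ := hg.exists_weight
  have hp0 : 0 < p := by linarith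
  have hp1 : 0 < p - 1 := by linarith
  have hgφ : Measurable fun z : ℝ × Eu d => g z.1 (φ z.1 z.2) := hg.measurable.comp (measurable_fst.prodMk hφ)
  have hgφ' : Measurable fun z : Eu d × ℝ => g z.2 (φ z.2 z.1) := hgφ.comp measurable_swap
  have hG : Measurable fun x => ∫⁻ s in Ioo 0 T, g s (φ s x) := hgφ'.lintegral_prod_right'
  calc c ^ p * volume {x | c ≤ ∫⁻ s in Ioo 0 T, g s (φ s x)}
      ≤ c ^ p * volume {x | c ^ p ≤ (∫⁻ s in Ioo 0 T, g s (φ s x)) ^ p} := by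
        refine mul_le_mul_right (measure_mono fun x hx => ?_) _
        exact ENNReal.rpow_le_rpow (show c ≤ ∫⁻ s in Ioo 0 T, g s (φ s x) from hx) hp0.le
    _ ≤ ∫⁻ x, (∫⁻ s in Ioo 0 T, g s (φ s x)) ^ p := mul_meas_ge_le_lintegral (hG.pow_const p) _
    _ ≤ ∫⁻ x, M ^ (p - 1) * ∫⁻ s in Ioo 0 T, g s (φ s x) ^ p * m s ^ (-(p - 1)) := by
        refine lintegral_mono fun x => ?_
        refine (lintegral_rpow_le_of_weight hp (measurable_slice (F := fun x s => g s (φ s x)) hgφ' x) hm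
          (hmae.mono fun s hs => ⟨hs.1, hs.2.1⟩)).trans ?_
        gcongr
    _ = M ^ (p - 1) * ∫⁻ s in Ioo 0 T, (∫⁻ x, g s (φ s x) ^ p) * m s ^ (-(p - 1)) := by
        have hk : Measurable fun z : Eu d × ℝ => g z.2 (φ z.2 z.1) ^ p * m z.2 ^ (-(p - 1)) :=
          (hgφ'.pow_const p).mul ((hm.comp measurable_snd).pow_const _)
        rw [lintegral_const_mul _ hk.lintegral_prod_right', lintegral_lintegral_swap hk.aemeasurable]
        congr 1
        refine lintegral_congr fun s => ?_
        dsimp only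
        exact lintegral_mul_const _ ((measurable_slice (F := fun s x => g s (φ s x)) hgφ s).pow_const p)
    -- Compressibility costs the factor `L`, and `m ^ p * m ^ (-(p - 1)) = m` leaves an integrable
    -- weight.
    _ ≤ M ^ (p - 1) * ∫⁻ s in Ioo 0 T, L * A * m s := by
        refine mul_le_mul_right (lintegral_mono_ae ?_) _
        filter_upwards [hmae, hL] with s hs hLs
        calc (∫⁻ x, g s (φ s x) ^ p) * m s ^ (-(p - 1))
            ≤ (L * (A * m s ^ p)) * m s ^ (-(p - 1)) := by
              gcongr
              refine (lintegral_comp_le_of_map_le (measurable_slice hφ s) hLs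
                ((measurable_slice hg.measurable s).pow_const p)).trans ?_
              gcongr
              exact hs.2.2
          _ = L * A * m s := by
              rw [mul_assoc, mul_assoc, mul_assoc, ← ENNReal.rpow_add _ _ hs.1 hs.2.1]
              ring_nf
              rw [ENNReal.rpow_one]
    _ ≤ M ^ (p - 1) * (L * A * M) := by
        rw [lintegral_const_mul _ hm]
        gcongr
    _ = _ := by
        have : M ^ p = M ^ (p - 1) * M := by
          have := ENNReal.rpow_add_of_nonneg (x := M) (p - 1) 1 hp1.le zero_le_one
          rwa [sub_add_cancel, ENNReal.rpow_one] at this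
        rw [this]; ring

/-- A scheme for a regular field together with the trajectories of a Sobolev field. -/
structure IsSchemeSetting {d : ℕ} (T p h θ B B' K C : ℝ) (N : ℕ) (A M L : ℝ≥0∞)
    (b c v : ℝ → Eu d → Eu d) (g : ℝ → Eu d → ℝ≥0∞) (Y : ℕ → Eu d → Eu d) : Prop where
  one_lt : 1 < p
  step_pos : 0 < h
  mul_step : N * h = T
  theta_nonneg : 0 ≤ θ
  theta_le : θ ≤ 1
  measurable : Measurable (Function.uncurry b)
  bound : ∀ s x, ‖b s x‖ ≤ B
  maximalBound : HasMaximalBound T p A M b g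
  velocity : IsVelocity T B b v
  compressible : IsCompressible T L (trajectory v)
  regular : IsRegularField c K C B'
  iteration : IsIntegralIteration h θ N c Y
  measurable_iterate : ∀ i ≤ N, Measurable (Y i)
  map_iterate_le : ∀ i ≤ N, Measure.map (Y i) volume ≤ L • volume

/-- The left node value of the interval containing `s`. -/
def leftNode {d : ℕ} (h : ℝ) (N : ℕ) (Y : ℕ → Eu d → Eu d) (s : ℝ) : Eu d → Eu d :=
  Y (min (⌈s / h⌉₊ - 1) N)

/-- The right node value of the interval containing `s`. -/
def rightNode {d : ℕ} (h : ℝ) (N : ℕ) (Y : ℕ → Eu d → Eu d) (s : ℝ) : Eu d → Eu d :=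
  Y (min ⌈s / h⌉₊ N)

/-- The growth rate of the error. -/
def errorRate {d : ℕ} (h : ℝ) (N : ℕ) (v : ℝ → Eu d → Eu d) (g : ℝ → Eu d → ℝ≥0∞)
    (Y : ℕ → Eu d → Eu d) (s : ℝ) (x : Eu d) : ℝ≥0∞ :=
  (g s (leftNode h N Y s x) + g s (trajectory v s x)) +
    (g s (rightNode h N Y s x) + g s (trajectory v s x))

/-- The consistency error due to the regularisation. -/
def errorSource {d : ℕ} (h : ℝ) (N : ℕ) (b c : ℝ → Eu d → Eu d)
    (Y : ℕ → Eu d → Eu d) (s : ℝ) (x : Eu d) : ℝ≥0∞ :=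
  ‖c s (leftNode h N Y s x) - b s (leftNode h N Y s x)‖ₑ +
    ‖c s (rightNode h N Y s x) - b s (rightNode h N Y s x)‖ₑ

lemma ceil_div_eq {h s : ℝ} (hh : 0 < h) {i : ℕ} (hs : s ∈ Ioc (i * h) ((i + 1) * h)) :
    ⌈s / h⌉₊ = i + 1 := by
  rw [Nat.ceil_eq_iff (Nat.succ_ne_zero i)]
  push_cast [Nat.add_sub_cancel]
  exact ⟨(lt_div_iff₀ hh).2 hs.1, (div_le_iff₀ hh).2 hs.2⟩

lemma leftNode_eq {d : ℕ} {h s : ℝ} (hh : 0 < h) {N i : ℕ} (hi : i < N)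
    (hs : s ∈ Ioc (i * h) ((i + 1) * h)) (Y : ℕ → Eu d → Eu d) : leftNode h N Y s = Y i := by
  rw [leftNode, ceil_div_eq hh hs, Nat.add_sub_cancel, min_eq_left hi.le]

lemma rightNode_eq {d : ℕ} {h s : ℝ} (hh : 0 < h) {N i : ℕ} (hi : i < N)
    (hs : s ∈ Ioc (i * h) ((i + 1) * h)) (Y : ℕ → Eu d → Eu d) : rightNode h N Y s = Y (i + 1) := by
  rw [rightNode, ceil_div_eq hh hs, min_eq_left hi]

lemma measurable_comp_index {d N : ℕ} {Y : ℕ → Eu d → Eu d} (hY : ∀ i ≤ N, Measurable (Y i))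
    {k : ℝ → ℕ} (hk : Measurable k) : Measurable (Function.uncurry fun s => Y (min (k s) N)) := by
  have h1 : Measurable (fun z : ℕ × Eu d => Y (min z.1 N) z.2) :=
    measurable_from_prod_countable_right fun n => hY _ (min_le_right n N)
  exact h1.comp ((hk.comp measurable_fst).prodMk measurable_snd)

/-! ### Size of the error rate and of the regularisation error. -/

namespace IsSchemeSetting

variable {d N : ℕ} {T p h θ B B' K C : ℝ} {A M L : ℝ≥0∞} {b c v : ℝ → Eu d → Eu d}
  {g : ℝ → Eu d → ℝ≥0∞} {Y : ℕ → Eu d → Eu d}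

lemma measurable_leftNode (H : IsSchemeSetting T p h θ B B' K C N A M L b c v g Y) :
    Measurable (Function.uncurry (leftNode h N Y)) :=
  measurable_comp_index H.measurable_iterate
    (k := fun s => ⌈s / h⌉₊ - 1) ((measurable_from_nat (f := fun n => n - 1)).comp
      (Nat.measurable_ceil.comp (measurable_id.div_const h)))

lemma measurable_rightNode (H : IsSchemeSetting T p h θ B B' K C N A M L b c v g Y) :
    Measurable (Function.uncurry (rightNode h N Y)) :=
  measurable_comp_index H.measurable_iterate
    (k := fun s => ⌈s / h⌉₊) (Nat.measurable_ceil.comp (measurable_id.div_const h))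

/-- Capping the index at `N` makes this true for every real `s`. -/
lemma compressible_leftNode (H : IsSchemeSetting T p h θ B B' K C N A M L b c v g Y) (s : ℝ) :
    Measure.map (leftNode h N Y s) volume ≤ L • volume := H.map_iterate_le _ (min_le_right _ _)

lemma compressible_rightNode (H : IsSchemeSetting T p h θ B B' K C N A M L b c v g Y) (s : ℝ) :
    Measure.map (rightNode h N Y s) volume ≤ L • volume := H.map_iterate_le _ (min_le_right _ _)

lemma measurable_comp_path (H : IsSchemeSetting T p h θ B B' K C N A M L b c v g Y)
    {φ : ℝ → Eu d → Eu d} (hφ : Measurable (Function.uncurry φ)) :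
    Measurable fun z : ℝ × Eu d => g z.1 (φ z.1 z.2) :=
  H.maximalBound.measurable.comp (measurable_fst.prodMk hφ)

lemma measurable_errorRate (H : IsSchemeSetting T p h θ B B' K C N A M L b c v g Y) :
    Measurable (Function.uncurry (errorRate h N v g Y)) := by
  have h3 := H.measurable_comp_path (measurable_trajectory H.velocity.measurable)
  exact ((H.measurable_comp_path H.measurable_leftNode).add h3).add
    ((H.measurable_comp_path H.measurable_rightNode).add h3)

lemma measurable_errorSource (H : IsSchemeSetting T p h θ B B' K C N A M L b c v g Y) :
    Measurable (Function.uncurry (errorSource h N b c Y)) := by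
  have key : ∀ φ : ℝ → Eu d → Eu d, Measurable (Function.uncurry φ) →
      Measurable fun z : ℝ × Eu d => ‖c z.1 (φ z.1 z.2) - b z.1 (φ z.1 z.2)‖ₑ := fun φ hφ =>
    ((H.regular.measurable.comp (measurable_fst.prodMk hφ)).sub
      (H.measurable.comp (measurable_fst.prodMk hφ))).enorm
  exact (key _ H.measurable_leftNode).add (key _ H.measurable_rightNode)

lemma lintegral_errorSource_le (H : IsSchemeSetting T p h θ B B' K C N A M L b c v g Y) :
    ∫⁻ x, ∫⁻ s in Ioo 0 T, errorSource h N b c Y s x ≤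
      2 * L * ∫⁻ s in Ioo 0 T, ∫⁻ x, ‖c s x - b s x‖ₑ := by
  have hcb : Measurable (Function.uncurry fun s x => ‖c s x - b s x‖ₑ) := by
    have h : Measurable fun z : ℝ × Eu d => Function.uncurry c z - Function.uncurry b z :=
      H.regular.measurable.sub H.measurable
    exact h.enorm
  have hcb' : Measurable fun s => ∫⁻ x, ‖c s x - b s x‖ₑ :=
    hcb.lintegral_prod_right' (f := Function.uncurry fun s x => ‖c s x - b s x‖ₑ)
  have hk : Measurable fun z : Eu d × ℝ => errorSource h N b c Y z.2 z.1 :=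
    measurable_uncurry_swap H.measurable_errorSource
  rw [lintegral_lintegral_swap (f := fun x s => errorSource h N b c Y s x) hk.aemeasurable,
    ← lintegral_const_mul _ hcb']
  refine lintegral_mono fun s => ?_
  have hs : Measurable fun x => ‖c s x - b s x‖ₑ :=
    measurable_slice (F := fun s x => ‖c s x - b s x‖ₑ) hcb s
  have h1 := lintegral_comp_le_of_map_le (measurable_slice H.measurable_leftNode s)
    (H.compressible_leftNode s) hs
  have h2 := lintegral_comp_le_of_map_le (measurable_slice H.measurable_rightNode s)
    (H.compressible_rightNode s) hs
  have h3 : Measurable fun x => ‖c s (leftNode h N Y s x) - b s (leftNode h N Y s x)‖ₑ :=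
    hs.comp (measurable_slice H.measurable_leftNode s)
  calc ∫⁻ x, errorSource h N b c Y s x
      = (∫⁻ x, ‖c s (leftNode h N Y s x) - b s (leftNode h N Y s x)‖ₑ) +
        ∫⁻ x, ‖c s (rightNode h N Y s x) - b s (rightNode h N Y s x)‖ₑ := lintegral_add_left h3 _
    _ ≤ _ := add_le_add h1 h2
    _ = _ := by ring

/-- The rate has four summands, the trajectory term occurring twice. If its integral exceeds `4 *
a`, one of the three distinct integrals is at least `a`, and each of these events obeys the sublevel
estimate. -/
lemma volume_lt_lintegral_errorRate_le (H : IsSchemeSetting T p h θ B B' K C N A M L b c v g Y)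
    (a : ℝ≥0∞) :
    a ^ p * volume {x | 4 * a < ∫⁻ s in Ioo 0 T, errorRate h N v g Y s x} ≤ 3 * (L * A * M ^ p) := by
  have hW := measurable_trajectory H.velocity.measurable
  have m1 := H.measurable_comp_path H.measurable_leftNode
  have m2 := H.measurable_comp_path H.measurable_rightNode
  have m3 := H.measurable_comp_path hW
  have s1 : ∀ x, Measurable fun s => g s (leftNode h N Y s x) := fun x =>
    measurable_slice (F := fun x s => g s (leftNode h N Y s x)) (m1.comp measurable_swap) x
  have s2 : ∀ x, Measurable fun s => g s (rightNode h N Y s x) := fun x =>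
    measurable_slice (F := fun x s => g s (rightNode h N Y s x)) (m2.comp measurable_swap) x
  have s3 : ∀ x, Measurable fun s => g s (trajectory v s x) := fun x =>
    measurable_slice (F := fun x s => g s (trajectory v s x)) (m3.comp measurable_swap) x
  have hsub : {x | 4 * a < ∫⁻ s in Ioo 0 T, errorRate h N v g Y s x} ⊆
      ({x | a ≤ ∫⁻ s in Ioo 0 T, g s (leftNode h N Y s x)} ∪
      {x | a ≤ ∫⁻ s in Ioo 0 T, g s (rightNode h N Y s x)}) ∪
      {x | a ≤ ∫⁻ s in Ioo 0 T, g s (trajectory v s x)} := by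
    intro x hx
    by_contra hcon
    simp only [mem_union, not_or] at hcon
    obtain ⟨⟨h1, h2⟩, h3⟩ := hcon
    have h1' : ∫⁻ s in Ioo 0 T, g s (leftNode h N Y s x) < a := not_le.1 h1
    have h2' : ∫⁻ s in Ioo 0 T, g s (rightNode h N Y s x) < a := not_le.1 h2
    have h3' : ∫⁻ s in Ioo 0 T, g s (trajectory v s x) < a := not_le.1 h3
    have hx' : 4 * a < ∫⁻ s in Ioo 0 T, errorRate h N v g Y s x := hx
    refine absurd hx' (not_lt.2 ?_)
    simp only [errorRate]
    have s13 : Measurable fun s => g s (leftNode h N Y s x) + g s (trajectory v s x) :=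
      (s1 x).add (s3 x)
    rw [lintegral_add_left s13, lintegral_add_left (s1 x), lintegral_add_left (s2 x)]
    calc _ ≤ (a + a) + (a + a) := by gcongr
      _ = 4 * a := by ring
  calc a ^ p * volume {x | 4 * a < ∫⁻ s in Ioo 0 T, errorRate h N v g Y s x}
      ≤ a ^ p * (volume {x | a ≤ ∫⁻ s in Ioo 0 T, g s (leftNode h N Y s x)} +
          volume {x | a ≤ ∫⁻ s in Ioo 0 T, g s (rightNode h N Y s x)} +
          volume {x | a ≤ ∫⁻ s in Ioo 0 T, g s (trajectory v s x)}) := by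
        refine mul_le_mul_right ((measure_mono hsub).trans ((measure_union_le _ _).trans ?_)) _
        exact add_le_add (measure_union_le _ _) le_rfl
    _ ≤ L * A * M ^ p + L * A * M ^ p + L * A * M ^ p := by
        rw [mul_add, mul_add]
        exact add_le_add (add_le_add
          (H.maximalBound.rpow_mul_volume_le H.one_lt H.measurable_leftNode
            (ae_of_all _ H.compressible_leftNode) a)
          (H.maximalBound.rpow_mul_volume_le H.one_lt H.measurable_rightNode
            (ae_of_all _ H.compressible_rightNode) a))
          (H.maximalBound.rpow_mul_volume_le H.one_lt hW H.compressible a)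
    _ = _ := by ring

end IsSchemeSetting

/-- Discrete Gronwall. Following `a j + η` in place of `a j` makes the recursion purely
multiplicative up to the source: `(a j + η) * (1 + γ j) + ε j`. -/
lemma add_le_prod_mul_of_le {a γ ε : ℕ → ℝ≥0∞} {η : ℝ≥0∞} {n : ℕ} (h0 : a 0 = 0)
    (h : ∀ i < n, a (i + 1) ≤ a i + (a i + η) * γ i + ε i) :
    ∀ j ≤ n, a j + η ≤ (∏ i ∈ Finset.range j, (1 + γ i)) * (η + ∑ i ∈ Finset.range j, ε i) := by
  intro j
  induction j with
  | zero => intro _; simp [h0]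
  | succ j ih =>
    intro hj
    have hP : 1 ≤ ∏ i ∈ Finset.range (j + 1), (1 + γ i) :=
      Finset.one_le_prod' fun i _ => le_self_add
    calc a (j + 1) + η ≤ (a j + (a j + η) * γ j + ε j) + η := by gcongr; exact h j hj
      _ = (a j + η) * (1 + γ j) + ε j := by ring
      _ ≤ ((∏ i ∈ Finset.range j, (1 + γ i)) * (η + ∑ i ∈ Finset.range j, ε i)) * (1 + γ j)
          + (∏ i ∈ Finset.range (j + 1), (1 + γ i)) * ε j := by
          gcongr
          · exact ih (by omega)
          · exact le_mul_of_one_le_left' hP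
      _ = _ := by rw [Finset.prod_range_succ, Finset.sum_range_succ]; ring

lemma prod_one_add_le_exp {γ : ℕ → ℝ≥0∞} {j : ℕ} {Λ : ℝ}
    (h : ∑ i ∈ Finset.range j, γ i ≤ ENNReal.ofReal Λ) (hΛ : 0 ≤ Λ) :
    ∏ i ∈ Finset.range j, (1 + γ i) ≤ ENNReal.ofReal (Real.exp Λ) := by
  have hfin : ∀ i ∈ Finset.range j, γ i ≠ ⊤ := fun i hi =>
    ne_top_of_le_ne_top ENNReal.ofReal_ne_top ((Finset.single_le_sum (fun _ _ => bot_le) hi).trans h)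
  calc ∏ i ∈ Finset.range j, (1 + γ i)
      ≤ ∏ i ∈ Finset.range j, ENNReal.ofReal (Real.exp (γ i).toReal) := by
        refine Finset.prod_le_prod' fun i hi => ?_
        rw [← ENNReal.ofReal_toReal (hfin i hi), ← ENNReal.ofReal_one,
          ← ENNReal.ofReal_add zero_le_one ENNReal.toReal_nonneg,
          ENNReal.toReal_ofReal ENNReal.toReal_nonneg]
        refine ENNReal.ofReal_le_ofReal ?_
        rw [add_comm]
        exact Real.add_one_le_exp _
    _ = ENNReal.ofReal (Real.exp (∑ i ∈ Finset.range j, (γ i).toReal)) := by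
        rw [Real.exp_sum, ENNReal.ofReal_prod_of_nonneg fun i _ => (Real.exp_pos _).le]
    _ ≤ _ := by
        refine ENNReal.ofReal_le_ofReal (Real.exp_le_exp.2 ?_)
        rw [← ENNReal.toReal_sum hfin]
        exact ENNReal.toReal_le_of_le_ofReal hΛ h

lemma sum_setLIntegral_Ioc {h : ℝ} (hh : 0 < h) (f : ℝ → ℝ≥0∞) (j : ℕ) :
    ∑ i ∈ Finset.range j, ∫⁻ s in Ioc (i * h) ((i + 1) * h), f s = ∫⁻ s in Ioc 0 (j * h), f s := by
  induction j with
  | zero => simp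
  | succ j ih =>
    have h1 : (0 : ℝ) ≤ j * h := by positivity
    have h2 : (j : ℝ) * h ≤ (j + 1) * h := by nlinarith
    push_cast
    rw [Finset.sum_range_succ, ih, ← Ioc_union_Ioc_eq_Ioc h1 h2,
      lintegral_union measurableSet_Ioc (Ioc_disjoint_Ioc_of_le le_rfl)]

lemma sum_setLIntegral_Ioc_le {h T : ℝ} {N j : ℕ} (hh : 0 < h) (hN : N * h = T) (hj : j ≤ N)
    (f : ℝ → ℝ≥0∞) :
    ∑ i ∈ Finset.range j, ∫⁻ s in Ioc (i * h) ((i + 1) * h), f s ≤ ∫⁻ s in Ioo 0 T, f s := by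
  rw [sum_setLIntegral_Ioc hh, setLIntegral_congr (Ioo_ae_eq_Ioc (a := (0 : ℝ)) (b := T))]
  refine lintegral_mono_set (Ioc_subset_Ioc_right ?_)
  rw [← hN]
  gcongr

lemma ae_notMem_of_map_le {α : Type*} [MeasurableSpace α] {μ : Measure α} {φ : α → α}
    (hφ : Measurable φ) {L : ℝ≥0∞} (h : Measure.map φ μ ≤ L • μ) {S : Set α} (hS : μ S = 0) :
    ∀ᵐ x ∂μ, φ x ∉ S := by
  have h1 : Measure.map φ μ S = 0 := le_antisymm ((h S).trans (by simp [hS])) bot_le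
  have h2 := Measure.preimage_null_of_map_null hφ.aemeasurable h1
  exact measure_eq_zero_iff_ae_notMem.1 h2

/-- The Lipschitz-type inequality along a pair of compressible families. -/
lemma HasMaximalBound.ae_enorm_sub_le {d : ℕ} {T p : ℝ} {A M L : ℝ≥0∞} {b : ℝ → Eu d → Eu d}
    {g : ℝ → Eu d → ℝ≥0∞} (hg : HasMaximalBound T p A M b g) (hb : Measurable (Function.uncurry b))
    {φ ψ : ℝ → Eu d → Eu d}
    (hφ : Measurable (Function.uncurry φ)) (hφL : IsCompressible T L φ)
    (hψ : Measurable (Function.uncurry ψ)) (hψL : IsCompressible T L ψ) :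
    ∀ᵐ x, ∀ᵐ s ∂(volume.restrict (Ioo (0 : ℝ) T)),
      ‖b s (φ s x) - b s (ψ s x)‖ₑ ≤ ‖φ s x - ψ s x‖ₑ * (g s (φ s x) + g s (ψ s x)) := by
  have hc : ∀ χ : ℝ → Eu d → Eu d, Measurable (Function.uncurry χ) →
      Measurable fun z : ℝ × Eu d => (z.1, χ z.1 z.2) := fun χ hχ => measurable_fst.prodMk hχ
  refine (Measure.ae_ae_comm (p := fun s x => ‖b s (φ s x) - b s (ψ s x)‖ₑ ≤
    ‖φ s x - ψ s x‖ₑ * (g s (φ s x) + g s (ψ s x))) ?_).1 ?_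
  · have h1 : Measurable fun z : ℝ × Eu d => b z.1 (φ z.1 z.2) := hb.comp (hc φ hφ)
    have h2 : Measurable fun z : ℝ × Eu d => b z.1 (ψ z.1 z.2) := hb.comp (hc ψ hψ)
    have h3 : Measurable fun z : ℝ × Eu d => g z.1 (φ z.1 z.2) := hg.measurable.comp (hc φ hφ)
    have h4 : Measurable fun z : ℝ × Eu d => g z.1 (ψ z.1 z.2) := hg.measurable.comp (hc ψ hψ)
    have h5 : Measurable fun z : ℝ × Eu d => φ z.1 z.2 := hφ
    have h6 : Measurable fun z : ℝ × Eu d => ψ z.1 z.2 := hψ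
    exact measurableSet_le (h1.sub h2).enorm ((h5.sub h6).enorm.mul (h3.add h4))
  · filter_upwards [hg.enorm_sub_le, hφL, hψL] with s ⟨S, hS, hle⟩ h1 h2
    filter_upwards [ae_notMem_of_map_le (measurable_slice hφ s) h1 hS,
      ae_notMem_of_map_le (measurable_slice hψ s) h2 hS] with x hx1 hx2
    exact hle _ hx1 _ hx2

lemma IsVelocity.ae_ae_eq {d : ℕ} {T B : ℝ} {b v : ℝ → Eu d → Eu d} (H : IsVelocity T B b v)
    (hb : Measurable (Function.uncurry b)) :
    ∀ᵐ x, ∀ᵐ s ∂(volume.restrict (Ioo (0 : ℝ) T)), v s x = b s (trajectory v s x) := by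
  refine (Measure.ae_ae_comm (p := fun s x => v s x = b s (trajectory v s x)) ?_).1 H.ae_eq
  have h1 : Measurable fun z : ℝ × Eu d => b z.1 (trajectory v z.1 z.2) :=
    hb.comp (measurable_fst.prodMk (measurable_trajectory H.measurable))
  have h2 : Measurable fun z : ℝ × Eu d => v z.1 z.2 := H.measurable
  exact measurableSet_eq_fun h2 h1

lemma IsRegularField.norm_step_field_le {d : ℕ} {c : ℝ → Eu d → Eu d} {K C B θ : ℝ}
    (hc : IsRegularField c K C B) (hθ : 0 ≤ θ) (hθ1 : θ ≤ 1) (s : ℝ) (y z : Eu d) :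
    ‖(1 - θ) • c s y + θ • c s z‖ ≤ B := by
  have h1 : 0 ≤ 1 - θ := sub_nonneg.2 hθ1
  calc ‖(1 - θ) • c s y + θ • c s z‖ ≤ (1 - θ) * ‖c s y‖ + θ * ‖c s z‖ := by
        refine (norm_add_le _ _).trans (le_of_eq ?_)
        rw [norm_smul, norm_smul, Real.norm_of_nonneg h1, Real.norm_of_nonneg hθ]
    _ ≤ (1 - θ) * B + θ * B := by gcongr <;> exact hc.bound _ _
    _ = B := by ring

namespace IsIntegralIteration

variable {d N : ℕ} {h θ B B' K C : ℝ} {c v : ℝ → Eu d → Eu d} {Y : ℕ → Eu d → Eu d}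

lemma norm_succ_sub_le (H : IsIntegralIteration h θ N c Y) (hc : IsRegularField c K C B')
    (hθ : 0 ≤ θ) (hθ1 : θ ≤ 1) (hh : 0 < h) {i : ℕ}
    (hi : i < N) (x : Eu d) : ‖Y (i + 1) x - Y i x‖ ≤ B' * h := by
  rw [H.step i hi x]
  refine (norm_setIntegral_le_of_norm_le_const (by simp)
    fun s _ => hc.norm_step_field_le hθ hθ1 s _ _).trans (le_of_eq ?_)
  rw [Measure.real, Real.volume_Ioc, ENNReal.toReal_ofReal] <;>
  · ring_nf
    try positivity

lemma norm_iterate_sub_trajectory_le (H : IsIntegralIteration h θ N c Y)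
    (hc : IsRegularField c K C B') (hθ : 0 ≤ θ) (hθ1 : θ ≤ 1) (hh : 0 < h)
    (hv : Measurable (Function.uncurry v)) (hB : ∀ s x, ‖v s x‖ ≤ B) {j : ℕ} (hj : j ≤ N) (x : Eu d) :
    ‖Y j x - trajectory v (j * h) x‖ ≤ (B + B') * (j * h) := by
  have h1 : ∀ j ≤ N, ‖Y j x - x‖ ≤ B' * (j * h) := by
    intro j
    induction j with
    | zero => intro _; simp [H.zero]
    | succ j ih =>
      intro hj
      calc ‖Y (j + 1) x - x‖ = ‖(Y (j + 1) x - Y j x) + (Y j x - x)‖ := by congr 1; abel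
        _ ≤ B' * h + B' * (j * h) :=
          (norm_add_le _ _).trans (add_le_add (H.norm_succ_sub_le hc hθ hθ1 hh hj x) (ih (by omega)))
        _ = _ := by push_cast; ring
  have h2 := norm_trajectory_sub_le hv hB le_rfl (by positivity : (0 : ℝ) ≤ j * h) x
  have h3 : trajectory v 0 x = x := by simp [trajectory]
  rw [h3] at h2
  calc _ = ‖(Y j x - x) - (trajectory v (j * h) x - x)‖ := by congr 1; abel
    _ ≤ B' * (j * h) + B * (j * h - 0) := (norm_sub_le _ _).trans (add_le_add (h1 j hj) h2)
    _ = _ := by ring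

lemma norm_interpolant_sub_trajectory_le (H : IsIntegralIteration h θ N c Y)
    (hc : IsRegularField c K C B') (hθ : 0 ≤ θ) (hθ1 : θ ≤ 1) (hh : 0 < h)
    (hv : Measurable (Function.uncurry v)) (hB : ∀ s x, ‖v s x‖ ≤ B) {i : ℕ} (hi : i < N) {t : ℝ}
    (ht : t ∈ Ico (i * h) ((i + 1) * h)) (x : Eu d) :
    ‖interpolant h N Y t x - trajectory v t x‖ ≤
      ‖Y i x - trajectory v (i * h) x‖ + (B + B') * h := by
  have hB0 : 0 ≤ B := (norm_nonneg _).trans (hB 0 0)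
  have hint : interpolant h N Y t x = Y i x + ((t - i * h) / h) • (Y (i + 1) x - Y i x) := by
    rw [interpolant, Finset.sum_eq_single_of_mem i (Finset.mem_range.2 hi), indicator_of_mem ht]
    intro k _ hki
    refine indicator_of_notMem (fun hk => hki ?_) _
    have h1 : (i : ℝ) < k + 1 := lt_of_mul_lt_mul_right (ht.1.trans_lt hk.2) hh.le
    have h2 : (k : ℝ) < i + 1 := lt_of_mul_lt_mul_right (hk.1.trans_lt ht.2) hh.le
    norm_cast at h1 h2
    omega
  have h1 : ‖((t - i * h) / h) • (Y (i + 1) x - Y i x)‖ ≤ B' * h := by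
    rw [norm_smul, Real.norm_of_nonneg (div_nonneg (sub_nonneg.2 ht.1) hh.le)]
    refine le_trans (mul_le_of_le_one_left (norm_nonneg _) ?_) (H.norm_succ_sub_le hc hθ hθ1 hh hi x)
    rw [div_le_one hh]
    linarith [ht.2]
  have h2 : ‖trajectory v t x - trajectory v (i * h) x‖ ≤ B * h := by
    refine (norm_trajectory_sub_le hv hB (by positivity) ht.1 x).trans ?_
    gcongr
    linarith [ht.2]
  rw [hint]
  calc _ = ‖(Y i x - trajectory v (i * h) x) + (((t - i * h) / h) • (Y (i + 1) x - Y i x)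
        - (trajectory v t x - trajectory v (i * h) x))‖ := by congr 1; abel
    _ ≤ ‖Y i x - trajectory v (i * h) x‖ + (B' * h + B * h) :=
      (norm_add_le _ _).trans (add_le_add le_rfl ((norm_sub_le _ _).trans (add_le_add h1 h2)))
    _ = _ := by ring

end IsIntegralIteration

/-! ### Error recursion and stability. -/

namespace IsSchemeSetting

variable {d N : ℕ} {T p h θ B B' K C : ℝ} {A M L : ℝ≥0∞} {b c v : ℝ → Eu d → Eu d}
  {g : ℝ → Eu d → ℝ≥0∞} {Y : ℕ → Eu d → Eu d}

lemma succ_sub_trajectory_eq (H : IsSchemeSetting T p h θ B B' K C N A M L b c v g Y) {i : ℕ}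
    (hi : i < N) (x : Eu d) :
    Y (i + 1) x - trajectory v ((i + 1) * h) x = (Y i x - trajectory v (i * h) x) +
      ∫ s in Ioc (i * h) ((i + 1) * h),
        ((1 - θ) • c s (Y i x) + θ • c s (Y (i + 1) x) - v s x) := by
  have hh := H.step_pos
  have hcm : ∀ y, Measurable fun s => c s y := fun y =>
    H.regular.measurable.comp measurable_prodMk_right
  have hm : Measurable fun s => (1 - θ) • c s (Y i x) + θ • c s (Y (i + 1) x) := by
    have h1 := hcm (Y i x)
    have h2 := hcm (Y (i + 1) x)
    fun_prop
  have hint1 : Integrable (fun s => (1 - θ) • c s (Y i x) + θ • c s (Y (i + 1) x))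
      (volume.restrict (Ioc (i * h) ((i + 1) * h))) :=
    Integrable.of_bound hm.aestronglyMeasurable B'
      (ae_of_all _ fun s => H.regular.norm_step_field_le H.theta_nonneg H.theta_le s _ _)
  have hint2 : Integrable (fun s => v s x) (volume.restrict (Ioc (i * h) ((i + 1) * h))) :=
    integrableOn_of_measurable_of_bound H.velocity.measurable H.velocity.bound _ _ _
  rw [integral_sub hint1 hint2, ← H.iteration.step i hi x,
    ← trajectory_sub H.velocity.measurable H.velocity.bound
    (by positivity : (0 : ℝ) ≤ i * h) (by nlinarith)]
  abel

/-- During one step the iterate and the trajectory together move by at most `η = (B + B') * h`, so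
both nodes lie within `a + η` of the trajectory. Thus even the implicit term is bounded by the old
error, and no `γ` has to be small to solve for the new one. -/
lemma ae_forall_enorm_succ_sub_le (H : IsSchemeSetting T p h θ B B' K C N A M L b c v g Y) :
    ∀ᵐ x, ∀ i < N, ‖Y (i + 1) x - trajectory v ((i + 1) * h) x‖ₑ ≤
      ‖Y i x - trajectory v (i * h) x‖ₑ +
      (‖Y i x - trajectory v (i * h) x‖ₑ + ENNReal.ofReal ((B + B') * h)) *
        (∫⁻ s in Ioc (i * h) ((i + 1) * h), errorRate h N v g Y s x) +
      ∫⁻ s in Ioc (i * h) ((i + 1) * h), errorSource h N b c Y s x := by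
  have hh := H.step_pos
  have hW := measurable_trajectory H.velocity.measurable
  filter_upwards [H.maximalBound.ae_enorm_sub_le H.measurable H.measurable_leftNode
      (ae_of_all _ H.compressible_leftNode) hW H.compressible,
    H.maximalBound.ae_enorm_sub_le H.measurable H.measurable_rightNode
      (ae_of_all _ H.compressible_rightNode) hW H.compressible,
    H.velocity.ae_ae_eq H.measurable] with x hl hr hv i hi
  set a := ‖Y i x - trajectory v (i * h) x‖ₑ with ha
  set η := ENNReal.ofReal ((B + B') * h) with hη
  have hB : 0 ≤ B := (norm_nonneg _).trans (H.bound 0 0)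
  have hB' : 0 ≤ B' := (norm_nonneg _).trans (H.regular.bound 0 0)
  have hsub : volume.restrict (Ioc (i * h) ((i + 1) * h)) ≤ volume.restrict (Ioo 0 T) := by
    rw [Measure.restrict_congr_set (Ioo_ae_eq_Ioc (a := (0 : ℝ)) (b := T))]
    exact Measure.restrict_mono (Ioc_subset_Ioc_of_lt hh H.mul_step hi) le_rfl
  have hER : Measurable fun s => errorRate h N v g Y s x :=
    measurable_slice (F := fun x s => errorRate h N v g Y s x)
      (measurable_uncurry_swap H.measurable_errorRate) x
  have hpt : ∀ᵐ s ∂(volume.restrict (Ioc (i * h) ((i + 1) * h))),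
      ‖(1 - θ) • c s (Y i x) + θ • c s (Y (i + 1) x) - v s x‖ₑ ≤
        (a + η) * errorRate h N v g Y s x + errorSource h N b c Y s x := by
    filter_upwards [Filter.Eventually.filter_mono (ae_mono hsub) hl,
      Filter.Eventually.filter_mono (ae_mono hsub) hr,
      Filter.Eventually.filter_mono (ae_mono hsub) hv,
      ae_restrict_mem measurableSet_Ioc] with s hl hr hv hs
    rw [leftNode_eq hh hi hs] at hl
    rw [rightNode_eq hh hi hs] at hr
    have hWs : ‖trajectory v s x - trajectory v (i * h) x‖ ≤ B * h := by
      refine (norm_trajectory_sub_le H.velocity.measurable H.velocity.bound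
        (by positivity) hs.1.le x).trans ?_
      gcongr
      linarith [hs.2]
    have hl' : ‖Y i x - trajectory v s x‖ₑ ≤ a + η := by
      calc ‖Y i x - trajectory v s x‖ₑ
          = ‖(Y i x - trajectory v (i * h) x) - (trajectory v s x - trajectory v (i * h) x)‖ₑ := by
            congr 1; abel
        _ ≤ a + ‖trajectory v s x - trajectory v (i * h) x‖ₑ := enorm_sub_le
        _ ≤ a + η := by
            gcongr
            rw [← ofReal_norm]
            exact ENNReal.ofReal_le_ofReal (hWs.trans (by gcongr; linarith))
    have hr' : ‖Y (i + 1) x - trajectory v s x‖ₑ ≤ a + η := by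
      calc ‖Y (i + 1) x - trajectory v s x‖ₑ
          = ‖(Y i x - trajectory v (i * h) x) + ((Y (i + 1) x - Y i x)
              - (trajectory v s x - trajectory v (i * h) x))‖ₑ := by
            congr 1; abel
        _ ≤ a + ‖(Y (i + 1) x - Y i x) - (trajectory v s x - trajectory v (i * h) x)‖ₑ :=
            enorm_add_le _ _
        _ ≤ a + η := by
            gcongr
            rw [← ofReal_norm]
            refine ENNReal.ofReal_le_ofReal ((norm_sub_le _ _).trans ?_)
            linarith [H.iteration.norm_succ_sub_le H.regular H.theta_nonneg H.theta_le hh hi x]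
    have hθ : ‖θ‖ₑ ≤ 1 := by
      rw [← ofReal_norm, Real.norm_of_nonneg H.theta_nonneg, ← ENNReal.ofReal_one]
      exact ENNReal.ofReal_le_ofReal H.theta_le
    have hθ' : ‖1 - θ‖ₑ ≤ 1 := by
      rw [← ofReal_norm, Real.norm_of_nonneg (sub_nonneg.2 H.theta_le), ← ENNReal.ofReal_one]
      exact ENNReal.ofReal_le_ofReal (by linarith [H.theta_nonneg])
    have hsplit : ∀ y, ‖c s y - b s (trajectory v s x)‖ₑ ≤
        ‖c s y - b s y‖ₑ + ‖b s y - b s (trajectory v s x)‖ₑ := fun y => by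
      calc _ = ‖(c s y - b s y) + (b s y - b s (trajectory v s x))‖ₑ := by congr 1; abel
        _ ≤ _ := enorm_add_le _ _
    calc ‖(1 - θ) • c s (Y i x) + θ • c s (Y (i + 1) x) - v s x‖ₑ
        = ‖(1 - θ) • (c s (Y i x) - b s (trajectory v s x)) +
            θ • (c s (Y (i + 1) x) - b s (trajectory v s x))‖ₑ := by
          rw [hv]; congr 1; module
      _ ≤ ‖c s (Y i x) - b s (trajectory v s x)‖ₑ +
            ‖c s (Y (i + 1) x) - b s (trajectory v s x)‖ₑ := by
          refine (enorm_add_le _ _).trans (add_le_add ?_ ?_)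
          · rw [enorm_smul]; exact mul_le_of_le_one_left' hθ'
          · rw [enorm_smul]; exact mul_le_of_le_one_left' hθ
      _ ≤ (‖c s (Y i x) - b s (Y i x)‖ₑ +
            (a + η) * (g s (Y i x) + g s (trajectory v s x))) +
          (‖c s (Y (i + 1) x) - b s (Y (i + 1) x)‖ₑ +
            (a + η) * (g s (Y (i + 1) x) + g s (trajectory v s x))) := by
          refine add_le_add ((hsplit _).trans ?_) ((hsplit _).trans ?_)
          · exact add_le_add le_rfl (hl.trans (mul_le_mul_left hl' _))
          · exact add_le_add le_rfl (hr.trans (mul_le_mul_left hr' _))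
      _ = _ := by
          rw [errorRate, errorSource, leftNode_eq hh hi hs, rightNode_eq hh hi hs]
          ring
  rw [H.succ_sub_trajectory_eq hi x]
  calc _ ≤ a + ‖∫ s in Ioc (i * h) ((i + 1) * h),
        ((1 - θ) • c s (Y i x) + θ • c s (Y (i + 1) x) - v s x)‖ₑ := enorm_add_le _ _
    _ ≤ a + ∫⁻ s in Ioc (i * h) ((i + 1) * h),
        ((a + η) * errorRate h N v g Y s x + errorSource h N b c Y s x) :=
        add_le_add le_rfl ((enorm_integral_le_lintegral_enorm _).trans (lintegral_mono_ae hpt))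
    _ = _ := by
        rw [lintegral_add_left (hER.const_mul _), lintegral_const_mul _ hER, add_assoc]

lemma ae_enorm_sub_trajectory_le (H : IsSchemeSetting T p h θ B B' K C N A M L b c v g Y)
    {Λ : ℝ} (hΛ : 0 ≤ Λ) :
    ∀ᵐ x, ∀ j ≤ N, ‖Y j x - trajectory v (j * h) x‖ₑ ≤
      ENNReal.ofReal (Real.exp Λ) * (ENNReal.ofReal ((B + B') * h) +
        ∫⁻ s in Ioo 0 T, errorSource h N b c Y s x) +
      {x | ENNReal.ofReal Λ < ∫⁻ s in Ioo 0 T, errorRate h N v g Y s x}.indicator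
        (fun _ => ENNReal.ofReal ((B + B') * T)) x := by
  have hh := H.step_pos
  filter_upwards [H.ae_forall_enorm_succ_sub_le] with x hx j hj
  have hB : 0 ≤ B := (norm_nonneg _).trans (H.bound 0 0)
  have hB' : 0 ≤ B' := (norm_nonneg _).trans (H.regular.bound 0 0)
  -- Where the rate is large, only the a priori bound from the two maximal speeds is used; elsewhere
  -- Gronwall costs a factor `exp Λ`.
  by_cases hG : ENNReal.ofReal Λ < ∫⁻ s in Ioo 0 T, errorRate h N v g Y s x
  · have hxS : x ∈ {x | ENNReal.ofReal Λ < ∫⁻ s in Ioo 0 T, errorRate h N v g Y s x} := hG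
    rw [indicator_of_mem hxS]
    refine le_trans ?_ le_add_self
    rw [← ofReal_norm]
    refine ENNReal.ofReal_le_ofReal ((H.iteration.norm_iterate_sub_trajectory_le H.regular H.theta_nonneg H.theta_le hh
      H.velocity.measurable H.velocity.bound hj x).trans ?_)
    rw [← H.mul_step]
    gcongr
  · refine le_trans ?_ le_self_add
    have h1 := add_le_prod_mul_of_le (a := fun i => ‖Y i x - trajectory v (i * h) x‖ₑ)
      (γ := fun i => ∫⁻ s in Ioc (i * h) ((i + 1) * h), errorRate h N v g Y s x)
      (ε := fun i => ∫⁻ s in Ioc (i * h) ((i + 1) * h), errorSource h N b c Y s x)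
      (η := ENNReal.ofReal ((B + B') * h)) (n := N) (by simp [H.iteration.zero, trajectory])
      (fun i hi => by simpa using hx i hi) j hj
    refine (le_self_add.trans h1).trans ?_
    gcongr
    · exact prod_one_add_le_exp ((sum_setLIntegral_Ioc_le hh H.mul_step hj _).trans (not_lt.1 hG)) hΛ
    · exact sum_setLIntegral_Ioc_le hh H.mul_step hj _

/-- The stability estimate for the iterates. -/
theorem lintegral_enorm_sub_trajectory_le
    (H : IsSchemeSetting T p h θ B B' K C N A M L b c v g Y) {Λ : ℝ} (hΛ : 0 < Λ) {j : ℕ}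
    (hj : j ≤ N) (U : Set (Eu d)) :
    ∫⁻ x in U, ‖Y j x - trajectory v (j * h) x‖ₑ ≤
      ENNReal.ofReal (Real.exp Λ) * (ENNReal.ofReal ((B + B') * h) * volume U +
        2 * L * ∫⁻ s in Ioo 0 T, ∫⁻ x, ‖c s x - b s x‖ₑ) +
      ENNReal.ofReal ((B + B') * T) * (3 * (L * A * M ^ p) / ENNReal.ofReal (Λ / 4) ^ p) := by
  have hp0 : 0 < p := by linarith [H.one_lt]
  have hEm : Measurable fun x => ∫⁻ s in Ioo 0 T, errorSource h N b c Y s x :=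
    Measurable.lintegral_prod_right' (f := fun z : Eu d × ℝ => errorSource h N b c Y z.2 z.1)
      (measurable_uncurry_swap H.measurable_errorSource)
  have hRm : Measurable fun x => ∫⁻ s in Ioo 0 T, errorRate h N v g Y s x :=
    Measurable.lintegral_prod_right' (f := fun z : Eu d × ℝ => errorRate h N v g Y z.2 z.1)
      (measurable_uncurry_swap H.measurable_errorRate)
  have hS : MeasurableSet {x | ENNReal.ofReal Λ < ∫⁻ s in Ioo 0 T, errorRate h N v g Y s x} :=
    measurableSet_lt measurable_const hRm
  have hV : volume {x | ENNReal.ofReal Λ < ∫⁻ s in Ioo 0 T, errorRate h N v g Y s x} ≤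
      3 * (L * A * M ^ p) / ENNReal.ofReal (Λ / 4) ^ p := by
    have h4 : 4 * ENNReal.ofReal (Λ / 4) = ENNReal.ofReal Λ := by
      rw [← ENNReal.ofReal_ofNat 4, ← ENNReal.ofReal_mul (by norm_num)]
      congr 1; ring
    have := H.volume_lt_lintegral_errorRate_le (ENNReal.ofReal (Λ / 4))
    rw [h4] at this
    rw [ENNReal.le_div_iff_mul_le, mul_comm]
    · exact this
    · left
      exact (ENNReal.rpow_pos (ENNReal.ofReal_pos.2 (by positivity)) ENNReal.ofReal_ne_top).ne'
    · left
      exact ENNReal.rpow_ne_top_of_nonneg hp0.le ENNReal.ofReal_ne_top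
  calc ∫⁻ x in U, ‖Y j x - trajectory v (j * h) x‖ₑ
      ≤ ∫⁻ x in U, (ENNReal.ofReal (Real.exp Λ) * (ENNReal.ofReal ((B + B') * h) +
        ∫⁻ s in Ioo 0 T, errorSource h N b c Y s x) +
      {x | ENNReal.ofReal Λ < ∫⁻ s in Ioo 0 T, errorRate h N v g Y s x}.indicator
        (fun _ => ENNReal.ofReal ((B + B') * T)) x) := by
        refine lintegral_mono_ae (ae_restrict_of_ae ?_)
        filter_upwards [H.ae_enorm_sub_trajectory_le hΛ.le] with x hx
        exact hx j hj
    _ = ENNReal.ofReal (Real.exp Λ) * (ENNReal.ofReal ((B + B') * h) * volume U +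
        ∫⁻ x in U, ∫⁻ s in Ioo 0 T, errorSource h N b c Y s x) +
        ∫⁻ x in U, {x | ENNReal.ofReal Λ < ∫⁻ s in Ioo 0 T, errorRate h N v g Y s x}.indicator
        (fun _ => ENNReal.ofReal ((B + B') * T)) x := by
        rw [lintegral_add_left ((hEm.const_add _).const_mul _), lintegral_const_mul _ (hEm.const_add _),
          lintegral_add_left measurable_const, setLIntegral_const]
    _ ≤ _ := by
        refine add_le_add (mul_le_mul_right (add_le_add le_rfl ?_) _) ?_
        · exact (setLIntegral_le_lintegral _ _).trans H.lintegral_errorSource_le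
        · refine (setLIntegral_le_lintegral _ _).trans ?_
          rw [lintegral_indicator hS, setLIntegral_const]
          exact mul_le_mul_right hV _

end IsSchemeSetting

/-! ### Convergence rate -/

/-- The convergence rate obtained by balancing the terms of the stability estimate. -/
def schemeRate (p κ γ a₁ a₂ a₃ h : ℝ) : ℝ :=
  Real.exp (κ * |Real.log h|) * (a₁ * h + a₂ * h ^ γ) + a₃ / (κ * |Real.log h| / 4) ^ p + a₁ * h

/-- Here `exp (κ * |log h|) = h ^ (-κ)`, so the first two terms are positive powers of `h` when `κ <
min 1 γ`. The term from the bad set gives `|log h| ^ (1 - p)`, which vanishes precisely because `p >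
1`. -/
lemma tendsto_abs_log_mul_schemeRate {p κ γ : ℝ} (a₁ a₂ a₃ : ℝ) (hp : 1 < p) (hκ : 0 < κ)
    (hκ1 : κ < 1) (hκγ : κ < γ) :
    Filter.Tendsto (fun h => |Real.log h| * schemeRate p κ γ a₁ a₂ a₃ h) (𝓝[>] 0) (𝓝 0) := by
  have t : ∀ r : ℝ, 0 < r → Filter.Tendsto (fun h : ℝ => |Real.log h| * h ^ r) (𝓝[>] 0) (𝓝 0) := by
    intro r hr
    have := (tendsto_log_mul_rpow_nhdsGT_zero hr).abs
    rw [abs_zero] at this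
    refine this.congr' ?_
    filter_upwards [self_mem_nhdsWithin] with h hh
    rw [abs_mul, abs_of_pos (Real.rpow_pos_of_pos hh r)]
  have hlog : Filter.Tendsto (fun h : ℝ => |Real.log h|) (𝓝[>] 0) Filter.atTop :=
    Filter.tendsto_abs_atBot_atTop.comp Real.tendsto_log_nhdsGT_zero
  have t3 : Filter.Tendsto (fun h : ℝ => |Real.log h| ^ (-(p - 1))) (𝓝[>] 0) (𝓝 0) :=
    (tendsto_rpow_neg_atTop (by linarith : 0 < p - 1)).comp hlog
  have key := ((((t (1 - κ) (by linarith)).const_mul a₁).add ((t (γ - κ) (by linarith)).const_mul a₂)).add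
    (t3.const_mul (a₃ * (4 / κ) ^ p))).add ((t 1 one_pos).const_mul a₁)
  simp only [mul_zero, add_zero] at key
  refine key.congr' ?_
  filter_upwards [Ioo_mem_nhdsGT (zero_lt_one (α := ℝ))] with h hh
  have hl : 0 < |Real.log h| := abs_pos.2 (Real.log_neg hh.1 hh.2).ne
  have he : Real.exp (κ * |Real.log h|) = h ^ (-κ) := by
    rw [abs_of_neg (Real.log_neg hh.1 hh.2), Real.rpow_def_of_pos hh.1]
    congr 1; ring
  have e1 : h ^ (1 - κ) = h ^ (-κ) * h := by
    rw [show 1 - κ = -κ + 1 by ring, Real.rpow_add hh.1, Real.rpow_one]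
  have e2 : h ^ (γ - κ) = h ^ (-κ) * h ^ γ := by
    rw [show γ - κ = -κ + γ by ring, Real.rpow_add hh.1]
  have e3 : |Real.log h| * (a₃ / (κ * |Real.log h| / 4) ^ p) =
      a₃ * (4 / κ) ^ p * |Real.log h| ^ (-(p - 1)) := by
    rw [show κ * |Real.log h| / 4 = (4 / κ)⁻¹ * |Real.log h| by field_simp,
      Real.mul_rpow (by positivity) hl.le, Real.inv_rpow (by positivity),
      show -(p - 1) = 1 - p by ring, Real.rpow_sub hl, Real.rpow_one]
    have : 0 < (4 / κ) ^ p := by positivity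
    have : 0 < |Real.log h| ^ p := by positivity
    field_simp
  rw [schemeRate, he, e1, e2, mul_add, mul_add, e3, Real.rpow_one]
  ring

/-- The function `ρ` is fixed before the fields, `N`, `θ` and the iterates, so one threshold on `h`
serves them all. The extra term `(B + B') * h * volume U` pays for motion inside a time step. -/
lemma exists_rate {d : ℕ} {U : Set (Eu d)} (hU : volume U ≠ ⊤) {p T B B' C₀ γ : ℝ} (hp : 1 < p)
    (hT : 0 ≤ T) (hB : 0 ≤ B) (hB' : 0 ≤ B') (hC₀ : 0 ≤ C₀) (hγ : 0 < γ) {A M L : ℝ≥0∞}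
    (hA : A ≠ ⊤) (hM : M ≠ ⊤) (hL : L ≠ ⊤) :
    ∃ ρ : ℝ → ℝ, Filter.Tendsto (fun h => |Real.log h| * ρ h) (𝓝[>] 0) (𝓝 0) ∧
      ∀ (h θ K C : ℝ) (N : ℕ) (b c v : ℝ → Eu d → Eu d) (g : ℝ → Eu d → ℝ≥0∞)
        (Y : ℕ → Eu d → Eu d), h < 1 → IsSchemeSetting T p h θ B B' K C N A M L b c v g Y →
        ∫⁻ s in Ioo 0 T, ∫⁻ x, ‖c s x - b s x‖ₑ ≤ ENNReal.ofReal (C₀ * h ^ γ) →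
        ∀ j ≤ N, (∫⁻ x in U, ‖Y j x - trajectory v (j * h) x‖ₑ) +
          ENNReal.ofReal ((B + B') * h) * volume U ≤ ENNReal.ofReal (ρ h) := by
  have hp0 : 0 < p := by linarith
  set κ := min γ 1 / 2 with hκdef
  have hκ : 0 < κ := by positivity
  have hκ1 : κ < 1 := by have := min_le_right γ 1; linarith
  have hκγ : κ < γ := by have := min_le_left γ 1; have := lt_min hγ one_pos; linarith
  set V := (volume U).toReal with hV
  have hV0 : 0 ≤ V := ENNReal.toReal_nonneg
  set Q := (L * A * M ^ p).toReal with hQ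
  have hQ0 : 0 ≤ Q := ENNReal.toReal_nonneg
  have hL0 : 0 ≤ L.toReal := ENNReal.toReal_nonneg
  have eV : volume U = ENNReal.ofReal V := (ENNReal.ofReal_toReal hU).symm
  have eL : L = ENNReal.ofReal L.toReal := (ENNReal.ofReal_toReal hL).symm
  have eQ : L * A * M ^ p = ENNReal.ofReal Q := (ENNReal.ofReal_toReal (ENNReal.mul_ne_top
    (ENNReal.mul_ne_top hL hA) (ENNReal.rpow_ne_top_of_nonneg hp0.le hM))).symm
  refine ⟨schemeRate p κ γ ((B + B') * V) (2 * L.toReal * C₀) ((B + B') * T * (3 * Q)),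
    tendsto_abs_log_mul_schemeRate _ _ _ hp hκ hκ1 hκγ, ?_⟩
  intro h θ K C N b c v g Y hh1 H hδ j hj
  have hh := H.step_pos
  have hΛ : 0 < κ * |Real.log h| := mul_pos hκ (abs_pos.2 (Real.log_neg hh hh1).ne)
  have hΛp : 0 < (κ * |Real.log h| / 4) ^ p := by positivity
  have hhγ : 0 ≤ h ^ γ := by positivity
  have hBB : 0 ≤ B + B' := by positivity
  refine (add_le_add (H.lintegral_enorm_sub_trajectory_le hΛ hj U) le_rfl).trans ?_
  have e1 : ENNReal.ofReal ((B + B') * h) * volume U = ENNReal.ofReal ((B + B') * V * h) := by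
    rw [eV, ← ENNReal.ofReal_mul (by positivity)]; congr 1; ring
  have e2 : 2 * L * ∫⁻ s in Ioo 0 T, ∫⁻ x, ‖c s x - b s x‖ₑ ≤
      ENNReal.ofReal (2 * L.toReal * C₀ * h ^ γ) := by
    refine (mul_le_mul_right hδ _).trans (le_of_eq ?_)
    nth_rewrite 1 [eL]
    rw [← ENNReal.ofReal_ofNat 2, ← ENNReal.ofReal_mul (by norm_num),
      ← ENNReal.ofReal_mul (by positivity)]
    congr 1; ring
  have e3 : ENNReal.ofReal ((B + B') * T) * (3 * (L * A * M ^ p) /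
      ENNReal.ofReal (κ * |Real.log h| / 4) ^ p) =
      ENNReal.ofReal ((B + B') * T * (3 * Q) / (κ * |Real.log h| / 4) ^ p) := by
    rw [eQ, ENNReal.ofReal_rpow_of_pos (by positivity), ← ENNReal.ofReal_ofNat 3,
      ← ENNReal.ofReal_mul (by norm_num), ← ENNReal.ofReal_div_of_pos hΛp,
      ← ENNReal.ofReal_mul (by positivity)]
    congr 1; ring
  rw [e1, e3, schemeRate, ENNReal.ofReal_add (by positivity) (by positivity),
    ENNReal.ofReal_add (by positivity) (by positivity), ENNReal.ofReal_mul (Real.exp_pos _).le,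
    ENNReal.ofReal_add (by positivity) (by positivity)]
  gcongr

/-- Compressibility is stable under local `L¹` approximation: the `n`-Lipschitz functions `min 1 (n
* dist(y, Aᶜ))` lie below the indicator of `A`, and their integrals pass from `Φ` to `W`. As `n`
grows, the points of a ball of radius `n` where they equal one exhaust the preimage. -/
lemma volume_preimage_le_of_approx {d : ℕ} {W : Eu d → Eu d} (hW : Measurable W) {L : ℝ≥0∞}
    (h : ∀ r : ℝ, ∀ η : ℝ≥0∞, η ≠ 0 → ∃ Φ : Eu d → Eu d, Measurable Φ ∧
      Measure.map Φ volume ≤ L • volume ∧ ∫⁻ x in Metric.ball 0 r, ‖Φ x - W x‖ₑ ≤ η)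
    {A : Set (Eu d)} (hA : IsOpen A) : volume (W ⁻¹' A) ≤ L * volume A := by
  let f : ℕ → Eu d → ℝ≥0∞ := fun n y => min 1 (n * Metric.infEDist y Aᶜ)
  have hfm : ∀ n, Measurable (f n) := fun n =>
    measurable_const.min (Metric.continuous_infEDist.measurable.const_mul _)
  have hfA : ∀ n y, f n y ≤ A.indicator 1 y := by
    intro n y
    by_cases hy : y ∈ A
    · simp [f, hy]
    · have : Metric.infEDist y Aᶜ = 0 := Metric.infEDist_zero_of_mem hy
      simp [f, this]
  have hlip : ∀ n y z, f n z ≤ f n y + n * ‖y - z‖ₑ := by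
    intro n y z
    have h1 : Metric.infEDist z Aᶜ ≤ Metric.infEDist y Aᶜ + ‖y - z‖ₑ := by
      rw [← edist_eq_enorm_sub, edist_comm]
      exact Metric.infEDist_le_infEDist_add_edist
    calc f n z ≤ min 1 (n * Metric.infEDist y Aᶜ + n * ‖y - z‖ₑ) := by
          refine min_le_min le_rfl ?_
          rw [← mul_add]
          exact mul_le_mul_right h1 _
      _ ≤ f n y + n * ‖y - z‖ₑ := by
          rcases le_total 1 (n * Metric.infEDist y Aᶜ) with h2 | h2
          · exact (min_le_left _ _).trans ((le_min le_rfl h2).trans le_self_add)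
          · refine (min_le_right _ _).trans ?_
            gcongr
            exact le_min h2 le_rfl
  have key : ∀ (n : ℕ) (r : ℝ), ∫⁻ x in Metric.ball 0 r, f n (W x) ≤ L * volume A := by
    intro n r
    refine ENNReal.le_of_forall_pos_le_add fun ε hε _ => ?_
    -- Dividing by `n + 1` absorbs the Lipschitz constant `n` and covers `n = 0`.
    obtain ⟨Φ, hΦm, hΦL, hΦ⟩ := h r (ε / (n + 1)) (ENNReal.div_pos (by simpa using hε.ne') (by finiteness)).ne'
    calc ∫⁻ x in Metric.ball 0 r, f n (W x)
        ≤ ∫⁻ x in Metric.ball 0 r, (f n (Φ x) + n * ‖Φ x - W x‖ₑ) := lintegral_mono fun x => hlip _ _ _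
      _ = (∫⁻ x in Metric.ball 0 r, f n (Φ x)) + n * ∫⁻ x in Metric.ball 0 r, ‖Φ x - W x‖ₑ := by
          have hc : Measurable fun x => f n (Φ x) := (hfm n).comp hΦm
          rw [lintegral_add_left hc, lintegral_const_mul' _ _ (by finiteness)]
      _ ≤ L * volume A + ε := by
          refine add_le_add ?_ ?_
          · refine (setLIntegral_le_lintegral _ _).trans
              ((lintegral_comp_le_of_map_le hΦm hΦL (hfm n)).trans (mul_le_mul_right ?_ _))
            refine (lintegral_mono (hfA n)).trans (le_of_eq ?_)
            rw [lintegral_indicator_one hA.measurableSet]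
          · refine (mul_le_mul_right hΦ _).trans ?_
            calc (n : ℝ≥0∞) * (ε / (n + 1)) ≤ (n + 1) * (ε / (n + 1)) := by gcongr; exact le_self_add
              _ = ε := ENNReal.mul_div_cancel (by positivity) (by finiteness)
  let S : ℕ → Set (Eu d) := fun n => {x | 1 ≤ n * Metric.infEDist (W x) Aᶜ} ∩ Metric.ball 0 n
  have hS : Monotone S := by
    intro m n hmn x hx
    refine ⟨?_, Metric.ball_subset_ball (by exact_mod_cast hmn) hx.2⟩
    have h1 : 1 ≤ m * Metric.infEDist (W x) Aᶜ := hx.1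
    exact show 1 ≤ n * Metric.infEDist (W x) Aᶜ from h1.trans (by gcongr)
  have hsub : W ⁻¹' A ⊆ ⋃ n, S n := by
    intro x hx
    have hpos : Metric.infEDist (W x) Aᶜ ≠ 0 := fun h0 =>
      (Metric.mem_iff_infEDist_zero_of_closed hA.isClosed_compl).2 h0 hx
    obtain ⟨n, -, hn⟩ := ENNReal.exists_nat_pos_mul_gt hpos ENNReal.one_ne_top
    obtain ⟨m, hm⟩ := exists_nat_gt ‖x‖
    refine mem_iUnion.2 ⟨max n m, ?_, ?_⟩
    · refine show 1 ≤ ((max n m : ℕ) : ℝ≥0∞) * Metric.infEDist (W x) Aᶜ from hn.le.trans ?_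
      gcongr
      exact le_max_left n m
    · rw [mem_ball_zero_iff]
      exact hm.trans_le (by exact_mod_cast le_max_right n m)
  calc volume (W ⁻¹' A) ≤ volume (⋃ n, S n) := measure_mono hsub
    _ = ⨆ n, volume (S n) := hS.measure_iUnion
    _ ≤ L * volume A := by
        refine iSup_le fun n => le_trans ?_ (key n n)
        have hfW : Measurable fun x => f n (W x) := (hfm n).comp hW
        have h1 := mul_meas_ge_le_lintegral (μ := volume.restrict (Metric.ball (0 : Eu d) n)) hfW 1
        rw [one_mul, Measure.restrict_apply (measurableSet_le measurable_const hfW)] at h1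
        have h2 : S n ⊆ {x | 1 ≤ f n (W x)} ∩ Metric.ball 0 n := fun x hx =>
          ⟨show 1 ≤ f n (W x) from le_min le_rfl hx.1, hx.2⟩
        exact (measure_mono h2).trans h1

lemma IsApproximatingSequence.exists_isRegularField_step {d : ℕ} {T : ℝ} {b b' : ℝ → Eu d → Eu d}
    {bε : ℝ → ℝ → Eu d → Eu d} {C₀ C₁ C₂ C₃ α β : ℝ}
    (H : IsApproximatingSequence T b bε C₀ C₁ C₂ C₃ α β) (hC₁ : 0 ≤ C₁) (hC₂ : 0 ≤ C₂) (hC₃ : 0 ≤ C₃)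
    (hβ : 0 < β) (hbb' : ∀ᵐ s ∂(volume.restrict (Ioo (0 : ℝ) T)), b s =ᵐ[volume] b' s)
    {h : ℝ} (hh : 0 < h) :
    ∃ c : ℝ → Eu d → Eu d, IsRegularField c (C₁ / √h) C₂ C₃ ∧
      (∀ᵐ t ∂(volume.restrict (Ioo (0 : ℝ) T)), c t = bε (h ^ (1 / (2 * β))) t) ∧
      ∫⁻ s in Ioo 0 T, ∫⁻ x, ‖c s x - b' s x‖ₑ ≤ ENNReal.ofReal (C₀ * h ^ (α / (2 * β))) := by
  have hε : 0 < h ^ (1 / (2 * β)) := by positivity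
  obtain ⟨c, hc, hce⟩ := H.exists_isRegularField hC₁ hC₂ hC₃ hε
  have e1 : (h ^ (1 / (2 * β))) ^ β = √h := by
    rw [← Real.rpow_mul hh.le, Real.sqrt_eq_rpow]; congr 1; field_simp
  have e2 : (h ^ (1 / (2 * β))) ^ α = h ^ (α / (2 * β)) := by
    rw [← Real.rpow_mul hh.le]; congr 1; ring
  rw [e1] at hc
  refine ⟨c, hc, hce, ?_⟩
  rw [← e2]
  refine le_trans (lintegral_mono_ae ?_) (H.error_le _ hε)
  filter_upwards [hce, hbb'] with s h1 h2
  rw [eLpNorm_one_eq_lintegral_enorm, h1]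
  refine lintegral_mono_ae ?_
  filter_upwards [h2] with x hx
  rw [hx]

/-- The iterates of the explicit Euler method. -/
def eulerIterate {d : ℕ} (h : ℝ) (c : ℝ → Eu d → Eu d) : ℕ → Eu d → Eu d
  | 0 => id
  | i + 1 => fun x => eulerIterate h c i x +
      ∫ s in Ioc (i * h) ((i + 1) * h), c s (eulerIterate h c i x)

lemma isIntegralIteration_eulerIterate {d : ℕ} (h : ℝ) (N : ℕ) (c : ℝ → Eu d → Eu d) :
    IsIntegralIteration h 0 N c (eulerIterate h c) :=
  ⟨fun _ => rfl, fun i _ x => by simp [eulerIterate]⟩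

lemma smul_measure_mono {α : Type*} [MeasurableSpace α] {μ ν : Measure α} {L L' : ℝ≥0∞}
    (h : ν ≤ L • μ) (hL : L ≤ L') : ν ≤ L' • μ :=
  Measure.le_intro fun s _ _ => (h s).trans <| by
    rw [Measure.smul_apply, Measure.smul_apply, smul_eq_mul, smul_eq_mul]
    gcongr

lemma tendsto_div_natCast_nhdsGT {T : ℝ} (hT : 0 < T) :
    Filter.Tendsto (fun N : ℕ => T / N) Filter.atTop (𝓝[>] 0) := by
  refine tendsto_nhdsWithin_iff.2 ⟨tendsto_const_div_atTop_nhds_zero_nat T, ?_⟩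
  filter_upwards [Filter.eventually_gt_atTop 0] with N hN
  exact div_pos hT (Nat.cast_pos.2 hN)

lemma tendsto_ofReal_of_abs_log_mul {ρ : ℝ → ℝ}
    (h : Filter.Tendsto (fun h => |Real.log h| * ρ h) (𝓝[>] 0) (𝓝 0)) :
    Filter.Tendsto (fun h => ENNReal.ofReal (ρ h)) (𝓝[>] 0) (𝓝 0) := by
  have h1 : Filter.Tendsto ρ (𝓝[>] 0) (𝓝 0) := by
    have hlog : Filter.Tendsto (fun h : ℝ => |Real.log h|) (𝓝[>] 0) Filter.atTop :=
      Filter.tendsto_abs_atBot_atTop.comp Real.tendsto_log_nhdsGT_zero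
    refine squeeze_zero_norm' ?_ (by simpa using h.norm)
    filter_upwards [hlog.eventually_ge_atTop 1] with x hx
    exact le_mul_of_one_le_left (norm_nonneg _) hx
  simpa using ENNReal.tendsto_ofReal h1

/-- The compressibility constant of the trajectories of a Sobolev field is controlled by the one of
its numerical approximations. -/
theorem IsVelocity.isCompressible_trajectory {d : ℕ} {p T B C₀ C₁ C₂ C₃ α β L₁ h₁ : ℝ}
    {A M L : ℝ≥0∞} {b b' v : ℝ → Eu d → Eu d} {bε : ℝ → ℝ → Eu d → Eu d} {g : ℝ → Eu d → ℝ≥0∞}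
    (hv : IsVelocity T B b' v) (hp : 1 < p) (hT : 0 < T)
    (H : IsApproximatingSequence T b bε C₀ C₁ C₂ C₃ α β) (hC₀ : 0 ≤ C₀) (hC₁ : 0 ≤ C₁)
    (hC₂ : 0 ≤ C₂) (hC₃ : 0 ≤ C₃) (hα : 0 < α) (hβ : 0 < β)
    (hb' : Measurable (Function.uncurry b')) (hB : ∀ s x, ‖b' s x‖ ≤ B)
    (hbb' : ∀ᵐ s ∂(volume.restrict (Ioo (0 : ℝ) T)), b s =ᵐ[volume] b' s)
    (hg : HasMaximalBound T p A M b' g) (hA : A ≠ ⊤) (hM : M ≠ ⊤)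
    (hW : IsCompressible T L (trajectory v)) (hL : L ≠ ⊤) (hL₁ : 0 < L₁) (hh₁ : 0 < h₁)
    (hcomp : ∀ (h θ B : ℝ) (N : ℕ) (c : ℝ → Eu d → Eu d) (Y : ℕ → Eu d → Eu d),
      0 < h → h ≤ h₁ → N * h = T → 0 ≤ θ → θ ≤ 1 → IsRegularField c (C₁ / √h) C₂ B →
      IsIntegralIteration h θ N c Y →
      ∀ i ≤ N, Continuous (Y i) ∧ Measure.map (Y i) volume ≤ ENNReal.ofReal L₁ • volume) :
    IsCompressible T (ENNReal.ofReal L₁) (trajectory v) := by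
  have hB0 : 0 ≤ B := (norm_nonneg _).trans (hB 0 0)
  filter_upwards [ae_restrict_mem measurableSet_Ioo] with t ht
  have hWt : Measurable (trajectory v t) := measurable_slice (measurable_trajectory hv.measurable) t
  refine Measure.le_iff.2 fun S hS => ?_
  rw [Measure.map_apply hWt hS]
  refine volume_preimage_le_of_isOpen hL₁ (fun O hO => volume_preimage_le_of_approx hWt ?_ hO) S
  intro r η hη
  -- The flow's own constant `L` enters only this auxiliary rate, which is sent to zero; the final
  -- bound retains only `L₁`, the constant of the approximating maps.
  obtain ⟨ρ, hρ, hrate⟩ := exists_rate (U := Metric.ball (0 : Eu d) r) measure_ball_lt_top.ne hp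
    hT.le hB0 hC₃ hC₀ (by positivity : 0 < α / (2 * β)) hA hM
    (L := max L (ENNReal.ofReal L₁)) (by simp [hL])
  have hev : ∀ᶠ h in 𝓝[>] (0 : ℝ), (0 < h ∧ h < 1) ∧ h ≤ h₁ ∧ ENNReal.ofReal (ρ h) < η := by
    filter_upwards [Ioo_mem_nhdsGT (zero_lt_one (α := ℝ)), Ioc_mem_nhdsGT hh₁,
      (tendsto_order.1 (tendsto_ofReal_of_abs_log_mul hρ)).2 η (bot_lt_iff_ne_bot.2 hη)] with h h1 h2 h3
    exact ⟨h1, h2.2, h3⟩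
  obtain ⟨N, hN0, ⟨hh, hh1⟩, hhh₁, hη'⟩ := ((Filter.eventually_gt_atTop 0).and
    ((tendsto_div_natCast_nhdsGT hT).eventually hev)).exists
  set h := T / N with hdef
  have hNh : N * h = T := mul_div_cancel₀ T (Nat.cast_pos.2 hN0).ne'
  obtain ⟨c, hc, -, hδ⟩ := H.exists_isRegularField_step hC₁ hC₂ hC₃ hβ hbb' hh
  -- Explicit Euler, where `θ = 0`, is used because its iterates exist for every step size with no
  -- equation to solve.
  have hY := isIntegralIteration_eulerIterate h N c
  have hYc := hcomp h 0 C₃ N c _ hh hhh₁ hNh le_rfl zero_le_one hc hY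
  have HS : IsSchemeSetting T p h 0 B C₃ (C₁ / √h) C₂ N A M (max L (ENNReal.ofReal L₁)) b' c v g
      (eulerIterate h c) :=
    ⟨hp, hh, hNh, le_rfl, zero_le_one, hb', hB, hg, hv,
      hW.mono fun s hs => smul_measure_mono hs (le_max_left _ _), hc, hY,
      fun i hi => (hYc i hi).1.measurable,
      fun i hi => smul_measure_mono (hYc i hi).2 (le_max_right _ _)⟩
  have hj1 : (⌊t / h⌋₊ : ℝ) * h ≤ t :=
    (le_div_iff₀ hh).1 (Nat.floor_le (div_nonneg ht.1.le hh.le))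
  have hj2 : t ≤ (⌊t / h⌋₊ + 1 : ℝ) * h := ((div_lt_iff₀ hh).1 (Nat.lt_floor_add_one _)).le
  have hj : ⌊t / h⌋₊ ≤ N := Nat.floor_le_of_le ((div_le_iff₀ hh).2 (hNh ▸ ht.2.le))
  refine ⟨eulerIterate h c ⌊t / h⌋₊, (hYc _ hj).1.measurable, (hYc _ hj).2, ?_⟩
  refine le_trans ?_ ((hrate h 0 _ _ N b' c v g _ hh1 HS hδ _ hj).trans hη'.le)
  rw [← setLIntegral_const, ← lintegral_add_right _ measurable_const]
  refine lintegral_mono fun x => ?_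
  have hx := norm_trajectory_sub_le hv.measurable hv.bound (by positivity) hj1 x
  calc ‖eulerIterate h c ⌊t / h⌋₊ x - trajectory v t x‖ₑ
      = ‖(eulerIterate h c ⌊t / h⌋₊ x - trajectory v (⌊t / h⌋₊ * h) x) -
          (trajectory v t x - trajectory v (⌊t / h⌋₊ * h) x)‖ₑ := by congr 1; abel
    _ ≤ _ := by
        refine enorm_sub_le.trans (add_le_add le_rfl ?_)
        rw [← ofReal_norm]
        refine ENNReal.ofReal_le_ofReal (hx.trans ?_)
        gcongr <;> linarith

/-! ### The error estimate -/

lemma maximalConst_ne_top (d : ℕ) {p : ℝ} (hp : 0 ≤ p) : maximalConst d p ≠ ⊤ :=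
  ENNReal.mul_ne_top (ENNReal.rpow_ne_top_of_nonneg hp ENNReal.ofReal_ne_top) ENNReal.ofReal_ne_top

lemma L1ErrorLe.of_trajectory {d : ℕ} {T r ρ : ℝ} {Z X W : ℝ → Eu d → Eu d}
    (hae : ∀ᵐ s ∂(volume.restrict (Ioo (0 : ℝ) T)), X s =ᵐ[volume] W s)
    (hcont : (∀ᵐ x : Eu d, ContinuousOn (fun t => X t x) (Ico 0 T)) →
      ∀ t ∈ Ico (0 : ℝ) T, X t =ᵐ[volume] W t)
    (h : ∀ t ∈ Ico (0 : ℝ) T, ∫⁻ x in Metric.ball (0 : Eu d) r, ‖Z t x - W t x‖ₑ ≤ ENNReal.ofReal ρ) :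
    L1ErrorLe T r Z X ρ := by
  have key : ∀ t ∈ Ico (0 : ℝ) T, X t =ᵐ[volume] W t →
      ∫⁻ x in Metric.ball (0 : Eu d) r, ‖Z t x - X t x‖ₑ ≤ ENNReal.ofReal ρ := by
    intro t ht hX
    refine le_trans (lintegral_mono_ae (ae_restrict_of_ae ?_)) (h t ht)
    filter_upwards [hX] with x hx
    rw [hx]
  refine ⟨?_, fun hX t ht => key t ht (hcont hX t ht)⟩
  filter_upwards [hae, ae_restrict_mem measurableSet_Ioo] with t hX ht
  exact key t (Ioo_subset_Ico_self ht) hX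

lemma exists_mem_Ico_step {h T t : ℝ} {N : ℕ} (hh : 0 < h) (hN : N * h = T) (ht : t ∈ Ico 0 T) :
    ∃ i < N, t ∈ Ico (i * h) ((i + 1) * h) := by
  refine ⟨⌊t / h⌋₊, ?_, (le_div_iff₀ hh).1 (Nat.floor_le (div_nonneg ht.1 hh.le)),
    (div_lt_iff₀ hh).1 (Nat.lt_floor_add_one _)⟩
  rw [Nat.floor_lt (div_nonneg ht.1 hh.le), div_lt_iff₀ hh, hN]
  exact ht.2

theorem theoremA (d : ℕ) (p r T B M C₁ C₂ : ℝ) (hp : 1 < p) (hr : 0 < r) (hT : 0 < T)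
    (hC₁ : 0 < C₁) (hC₂ : 0 < C₂) :
    ∃ C : ℝ, 0 < C ∧
      ∀ C₀ C₃ α β : ℝ, 0 < C₀ → 0 < C₃ → 0 < α → 0 < β →
        ∃ h₀ : ℝ, 0 < h₀ ∧ h₀ < 1 ∧ ∃ C' : ℝ, 0 < C' ∧
          ∀ (b : ℝ → Eu d → Eu d) (D : ℝ → Eu d → Eu d →L[ℝ] Eu d)
            (X : ℝ → Eu d → Eu d) (bε : ℝ → ℝ → Eu d → Eu d),
            IsL1W1p T p b D →
            eLpNorm (Function.uncurry b) ⊤ (slab d T) ≤ ENNReal.ofReal B →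
            ∫⁻ t in Ioo (0 : ℝ) T, eLpNorm (D t) (ENNReal.ofReal p) volume
              ≤ ENNReal.ofReal M →
            (∀ᵐ t ∂(volume.restrict (Ioo (0 : ℝ) T)), ∀ᵐ x, tr (D t x) = 0) →
            IsRegularLagrangianFlow T b X →
            IsApproximatingSequence T b bε C₀ C₁ C₂ C₃ α β →
            ∀ (N : ℕ) (h θ : ℝ) (Y : ℕ → Eu d → Eu d),
              0 < N → h = T / N → 0 ≤ θ → θ ≤ 1 →
              IsThetaIteration h θ N (bε (h ^ (1 / (2 * β)))) Y →
              (h ≤ h₀ → L1ErrorLe T r (interpolant h N Y) X (C / |Real.log h|)) ∧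
              (h < 1 → L1ErrorLe T r (interpolant h N Y) X (C' / |Real.log h|)) := by
  obtain ⟨L₁, hL₁, h₁, hh₁, hcomp⟩ := exists_iterates_compressibility d T C₁ C₂ hC₁ hC₂
  -- The error is `o(1/|log h|)`, so any positive constant would do; the dependence on the data is
  -- carried by `h₀`.
  refine ⟨1, one_pos, fun C₀ C₃ α β hC₀ hC₃ hα hβ => ?_⟩
  set B' := max B 0 with hB'
  have hB'0 : 0 ≤ B' := le_max_right _ _
  have hA := maximalConst_ne_top d (zero_le_one.trans hp.le)
  have hM : ENNReal.ofReal M + ENNReal.ofReal T ≠ ⊤ := by finiteness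
  obtain ⟨ρ, hρ, hrate⟩ := exists_rate (U := Metric.ball (0 : Eu d) r) measure_ball_lt_top.ne hp
    hT.le hB'0 hC₃.le hC₀.le (by positivity : 0 < α / (2 * β)) hA hM
    (L := ENNReal.ofReal L₁) ENNReal.ofReal_ne_top
  obtain ⟨δ, hδ0, hδ⟩ := mem_nhdsGT_iff_exists_Ioc_subset.1
    ((tendsto_order.1 hρ).2 1 one_pos)
  have hδ0 : 0 < δ := hδ0
  -- Here `δ` gives `|log h| * ρ h < 1`, `h₁` gives compressibility of the iterates, and `1 / 2`
  -- keeps the logarithm away from zero.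
  set h₀ := min δ (min h₁ (1 / 2)) with hh₀
  have hh₀0 : 0 < h₀ := by positivity
  have hh₀1 : h₀ < 1 := ((min_le_right _ _).trans (min_le_right _ _)).trans_lt (by norm_num)
  set V := (volume (Metric.ball (0 : Eu d) r)).toReal with hV
  have hV0 : 0 ≤ V := ENNReal.toReal_nonneg
  have eV : volume (Metric.ball (0 : Eu d) r) = ENNReal.ofReal V :=
    (ENNReal.ofReal_toReal measure_ball_lt_top.ne).symm
  have hK0 : 0 ≤ (B' + C₃) * (2 * T) * V * |Real.log h₀| := by positivity
  refine ⟨h₀, hh₀0, hh₀1, 1 + (B' + C₃) * (2 * T) * V * |Real.log h₀|, by positivity, ?_⟩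
  intro b D X bε hb hbB hbM _ hX hbε N h θ Y hN hhN hθ0 hθ1 hY
  have hh : 0 < h := hhN ▸ div_pos hT (Nat.cast_pos.2 hN)
  have hNh : N * h = T := hhN ▸ mul_div_cancel₀ T (Nat.cast_pos.2 hN).ne'
  obtain ⟨b', hb'm, hb'B, hbb'⟩ := exists_bounded_version hb.aestronglyMeasurable hbB
  have hbb's : ∀ᵐ s ∂(volume.restrict (Ioo (0 : ℝ) T)), b s =ᵐ[volume] b' s :=
    Measure.ae_ae_of_ae_prod hbb'
  obtain ⟨g, hg⟩ := hb.exists_hasMaximalBound hp hbM hb'm hbb's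
  obtain ⟨v, hv, ⟨L, hL, hW⟩, hXv, hXc⟩ := hX.exists_velocity hT hb'm hb'B hbb'
  have hW₁ := hv.isCompressible_trajectory hp hT hbε hC₀.le hC₁.le hC₂.le hC₃.le hα hβ hb'm hb'B
    hbb's hg hA hM hW hL (zero_lt_one.trans_le hL₁) hh₁ hcomp
  obtain ⟨c, hc, hcb, hcδ⟩ := hbε.exists_isRegularField_step hC₁.le hC₂.le hC₃.le hβ hbb's hh
  have hY' : IsIntegralIteration h θ N c Y := hY.isIntegralIteration hh hNh hc hcb
  have hsmall : h ≤ h₀ → ∀ t ∈ Ico 0 T, ∫⁻ x in Metric.ball (0 : Eu d) r,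
      ‖interpolant h N Y t x - trajectory v t x‖ₑ ≤ ENNReal.ofReal (1 / |Real.log h|) := by
    intro hle t ht
    have hh1 : h < 1 := hle.trans_lt hh₀1
    have hl : 0 < |Real.log h| := abs_pos.2 (Real.log_neg hh hh1).ne
    have hYc := hcomp h θ C₃ N c Y hh (hle.trans ((min_le_right _ _).trans (min_le_left _ _)))
      hNh hθ0 hθ1 hc hY'
    have HS : IsSchemeSetting T p h θ B' C₃ (C₁ / √h) C₂ N (maximalConst d p)
        (ENNReal.ofReal M + ENNReal.ofReal T) (ENNReal.ofReal L₁) b' c v g Y :=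
      ⟨hp, hh, hNh, hθ0, hθ1, hb'm, hb'B, hg, hv, hW₁, hc, hY',
        fun i hi => (hYc i hi).1.measurable, fun i hi => (hYc i hi).2⟩
    obtain ⟨i, hi, hti⟩ := exists_mem_Ico_step hh hNh ht
    have hρh : |Real.log h| * ρ h < 1 := hδ ⟨hh, hle.trans (min_le_left _ _)⟩
    calc _ ≤ ∫⁻ x in Metric.ball (0 : Eu d) r, (‖Y i x - trajectory v (i * h) x‖ₑ +
          ENNReal.ofReal ((B' + C₃) * h)) := by
          refine lintegral_mono fun x => ?_
          rw [← ofReal_norm, ← ofReal_norm, ← ENNReal.ofReal_add (norm_nonneg _) (by positivity)]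
          exact ENNReal.ofReal_le_ofReal (hY'.norm_interpolant_sub_trajectory_le hc hθ0 hθ1 hh
            hv.measurable hv.bound hi hti x)
      _ = (∫⁻ x in Metric.ball (0 : Eu d) r, ‖Y i x - trajectory v (i * h) x‖ₑ) +
          ENNReal.ofReal ((B' + C₃) * h) * volume (Metric.ball (0 : Eu d) r) := by
          rw [lintegral_add_right _ measurable_const, setLIntegral_const]
      _ ≤ ENNReal.ofReal (ρ h) := hrate h θ _ _ N b' c v g Y hh1 HS hcδ i hi.le
      _ ≤ _ := by
          refine ENNReal.ofReal_le_ofReal ((le_div_iff₀ hl).2 ?_)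
          rw [mul_comm]
          exact hρh.le
  have hlarge : h < 1 → ∀ t ∈ Ico 0 T, ∫⁻ x in Metric.ball (0 : Eu d) r,
      ‖interpolant h N Y t x - trajectory v t x‖ₑ ≤
        ENNReal.ofReal ((1 + (B' + C₃) * (2 * T) * V * |Real.log h₀|) / |Real.log h|) := by
    intro hh1 t ht
    have hl : 0 < |Real.log h| := abs_pos.2 (Real.log_neg hh hh1).ne
    rcases le_total h h₀ with hle | hle
    · refine (hsmall hle t ht).trans (ENNReal.ofReal_le_ofReal ?_)
      gcongr
      linarith
    -- For `h₀ ≤ h < 1` boundedness is enough: bounded speeds keep the two paths within `(B' + C₃) *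
    -- (2 * T)` of each other, and `|log h| ≤ |log h₀|`.
    · obtain ⟨i, hi, hti⟩ := exists_mem_Ico_step hh hNh ht
      have hiT : (i : ℝ) * h ≤ T := by
        rw [← hNh]
        gcongr
      have hhT : h ≤ T := by
        rw [← hNh]
        exact le_mul_of_one_le_left hh.le (by exact_mod_cast hN)
      have hlog : |Real.log h| ≤ |Real.log h₀| := by
        rw [abs_of_neg (Real.log_neg hh hh1), abs_of_neg (Real.log_neg hh₀0 hh₀1)]
        exact neg_le_neg (Real.log_le_log hh₀0 hle)
      calc _ ≤ ∫⁻ x in Metric.ball (0 : Eu d) r, ENNReal.ofReal ((B' + C₃) * (2 * T)) := by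
            refine lintegral_mono fun x => ?_
            rw [← ofReal_norm]
            refine ENNReal.ofReal_le_ofReal ((hY'.norm_interpolant_sub_trajectory_le hc hθ0 hθ1 hh
              hv.measurable hv.bound hi hti x).trans ?_)
            calc _ ≤ (B' + C₃) * (i * h) + (B' + C₃) * h := by
                  gcongr
                  exact hY'.norm_iterate_sub_trajectory_le hc hθ0 hθ1 hh hv.measurable hv.bound hi.le x
              _ ≤ (B' + C₃) * T + (B' + C₃) * T := by gcongr
              _ = _ := by ring
        _ = ENNReal.ofReal ((B' + C₃) * (2 * T) * V) := by
            rw [setLIntegral_const, eV, ← ENNReal.ofReal_mul (by positivity)]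
        _ ≤ _ := by
            refine ENNReal.ofReal_le_ofReal ((le_div_iff₀ hl).2 ?_)
            have : (B' + C₃) * (2 * T) * V * |Real.log h| ≤
                (B' + C₃) * (2 * T) * V * |Real.log h₀| := by gcongr
            linarith
  exact ⟨fun hle => L1ErrorLe.of_trajectory hXv hXc (hsmall hle),
    fun hh1 => L1ErrorLe.of_trajectory hXv hXc (hlarge hh1)⟩

end
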